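/- Let $a\in\mathbb C\setminus\{0,1\}$ and $q,\alpha,\beta,\gamma,\delta,\varepsilon\in\mathbb C$ with $\gamma+\delta+\varepsilon=\alpha+\beta+1$. Heun's equation is $$y''+\Big(\frac{\gamma}{z}+\frac{\delta}{z-1}+\frac{\varepsilon}{z-a}\Big)y'+\frac{\alpha\beta z-q}{z(z-1)(z-a)}\,y=0 .\qquad(1)$$ **(A)** Let $y$ be a holomorphic solution of (1) on an open set $U$ on which holomorphic branches of $\log z,\log(z-1),\log(z-a)$ are given. Then $v=z^{\gamma}(z-1)^{\delta}(z-a)^{\varepsilon}y'$ is holomorphic on $U$ and satisfies, at the points of $U$ with $\alpha\beta z\ne q$, $$v''+\Big(\frac{1-\gamma}{z}+\frac{1-\delta}{z-1}+\frac{1-\varepsilon}{z-a}-\frac{\alpha\beta}{\alpha\beta z-q}\Big)v'+\frac{\alpha\beta z-q}{z(z-1)(z-a)}\,v=0 .\qquad(2)$$ If $\alpha\beta\neq0$ and $q\notin\{0,\alpha\beta,a\alpha\beta\}$, then (2) is Fuchsian with exactly five singular points, all regular: $0,1,a,z_0:=q/(\alpha\beta),\infty$, with exponents $\{0,\gamma\},\{0,\delta\},\{0,\varepsilon\},\{0,2\},\{-\alpha,-\beta\}$.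 If $\alpha\beta=0$ or $q\in\{0,\alpha\beta,a\alpha\beta\}$, then, where $\alpha\beta z\neq q$, (2) is a Heun equation with the same $a$ and other parameters. **(B)** Let $\rho=\min(1,|a|)$, let $U\subseteq\{0<|z|<\rho\}$ be open and connected with a branch of $\log z$, and let $y$ be a holomorphic solution of (1) on $U$. Fix values of $\log(-1)$ and $\log(-a)$, put $\log(z-1)=\log(-1)+\mathrm{Log}(1-z)$ and $\log(z-a)=\log(-a)+\mathrm{Log}(1-z/a)$ (principal $\mathrm{Log}$), and form all powers, and $v$, with these. Let $c\in\{0,1,a,z_0\}$ (for $c=z_0$ assume $\alpha\beta\ne0$, $q\ne0$), with $\mu\in\{0,\gamma\}$ for $c=0$, $\mu\in\{0,\delta\}$ for $c=1$, $\mu\in\{0,\varepsilon\}$ for $c=a$, $\mu=2$ for $c=z_0$. Assume $1-\gamma+\mu\notin\{0,-1,-2,\dots\}$ if $c=0$, and $1-\gamma\notin\{0,-1,-2,\dots\}$ otherwise, wherever the functions $Y_\nu$ below occur. Let $$F_1(A,b,b',C,x,y)=\sum_{m,n\ge0}\frac{(A)_{m+n}(b)_m(b')_n}{(C)_{m+n}\,m!\,n!}x^my^n,$$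 $$F_D(A,b_1,b_2,b_3,C,x_1,x_2,x_3)=\sum_{i,j,k\ge0}\frac{(A)_{i+j+k}(b_1)_i(b_2)_j(b_3)_k}{(C)_{i+j+k}\,i!\,j!\,k!}x_1^ix_2^jx_3^k,$$ and, with $\gamma_0=1-\gamma+\mu$, - $c=0$: $\;Y_\nu=(-1)^{-\delta}(-a)^{-\varepsilon}\,\dfrac{z^{\gamma_0+\nu}}{\gamma_0+\nu}\,F_1\big(\gamma_0+\nu,\delta,\varepsilon,1+\gamma_0+\nu,z,\tfrac za\big)$; - $c=1$: $\;Y_\nu=(-1)^{-\delta+\mu+\nu}(-a)^{-\varepsilon}z^{1-\gamma}\,\dfrac{\Gamma(1-\gamma)}{\Gamma(2-\gamma)}F_1\big(1-\gamma,\delta-\mu-\nu,\varepsilon,2-\gamma,z,\tfrac za\big)$; - $c=a$: $\;Y_\nu=(-1)^{-\delta}(-a)^{-\varepsilon+\mu+\nu}z^{1-\gamma}\,\dfrac{\Gamma(1-\gamma)}{\Gamma(2-\gamma)}F_1\big(1-\gamma,\delta,\varepsilon-\mu-\nu,2-\gamma,z,\tfrac za\big)$; - $c=z_0$: $\;Y_\nu=(-1)^{-\delta}(-a)^{-\varepsilon}(-z_0)^{2+\nu}z^{1-\gamma}\,\dfrac{\Gamma(1-\gamma)}{\Gamma(2-\gamma)}F_D\big(1-\gamma,\delta,\varepsilon,-2-\nu,2-\gamma,z,\tfrac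 za,\tfrac z{z_0}\big)$. 1. (Expansions of $v$.) Suppose $y=(z-c)^{\sigma}g$ on $U$ with $g$ holomorphic in a disc $D\supseteq U$ about $c$ of radius at most the distance from $c$ to the other points of $\{0,1,a\}$, where $\sigma=0$ or $\sigma=1-\gamma,1-\delta,1-\varepsilon$ for $c=0,1,a$ respectively; for $c=z_0$ suppose instead that $y$ solves (1) on such a disc and $y'(z_0)=0$. Then $v=(z-c)^{\mu}\sum_{\nu\ge0}a_\nu(z-c)^\nu$ on $U$ for some $a_\nu$, with $\mu=\gamma,\delta,\varepsilon$ (for $c=0,1,a$) if $\sigma=0$, $\mu=0$ if $\sigma$ is the other exponent, and $\mu=2$ for $c=z_0$. 2. (Integrals.) Suppose $v=(z-c)^{\mu}\sum_{\nu\ge0}a_\nu(z-c)^\nu$ on $U$. On $U$ the function $Y_\nu$ is an indefinite integral of $z^{-\gamma}(z-1)^{-\delta}(z-a)^{-\varepsilon}(z-c)^{\mu+\nu}$. If $\mathrm{Re}(\gamma_0+\nu)>0$ (for $c=0$), respectively $\mathrm{Re}\,\gamma<1$ (for $c\ne0$), then $Y_\nu(z)$ equals the absolutely convergent integral of this function over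 the segment from $0$ to $z$, for every $z\in U$. 3. (Expansions of $y$.) Under the assumption of 2: for $c=0$ there is a constant $C_0$ with $y=C_0+\sum_\nu a_\nu Y_\nu$ on $U$. For $c=1,a,z_0$ one has, for all $z,w\in U$, $y(z)=y(w)+\sum_\nu a_\nu\big(Y_\nu(z)-Y_\nu(w)\big)$. If moreover $\mathrm{Re}\,\gamma<1$, the point $0$ is strictly closer to $c$ than each of the other points of $\{1,a\}\setminus\{c\}$, and $U\supseteq\{|z-c|<|c|\}\cap\{|z|<\rho\}$, then there is a constant $C_0$ with $y=C_0+\sum_\nu a_\nu Y_\nu$ on $U$. 4. If $c=z_0$ and $\varepsilon=0$, then on $U$, for all $\nu$, $Y_\nu=(-1)^{-\delta}(-z_0)^{2+\nu}\dfrac{z^{1-\gamma}}{1-\gamma}F_1\big(1-\gamma,\delta,-2-\nu,2-\gamma,z,\tfrac z{z_0}\big)$. -/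

import Mathlib

noncomputable section

/-- Appell's first hypergeometric function
`F₁(A; b, b'; c; x, y) = ∑_{m,n} (A)_{m+n} (b)_m (b')_n / ((c)_{m+n} m! n!) x^m y^n`. -/
def appellF1 (A b b' c x y : ℂ) : ℂ :=
  ∑' k : ℕ × ℕ,
    (ascPochhammer ℂ (k.1 + k.2)).eval A * (ascPochhammer ℂ k.1).eval b *
        (ascPochhammer ℂ k.2).eval b' /
      ((ascPochhammer ℂ (k.1 + k.2)).eval c * (k.1.factorial : ℂ) * (k.2.factorial : ℂ)) *
      (x ^ k.1 * y ^ k.2)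

/-- Lauricella's fourth hypergeometric function of three variables
`F_D(A; b₁, b₂, b₃; c; x₁, x₂, x₃)
  = ∑_{i,j,k} (A)_{i+j+k} (b₁)_i (b₂)_j (b₃)_k / ((c)_{i+j+k} i! j! k!) x₁^i x₂^j x₃^k`. -/
def lauricellaFD (A b₁ b₂ b₃ c x₁ x₂ x₃ : ℂ) : ℂ :=
  ∑' k : ℕ × ℕ × ℕ,
    (ascPochhammer ℂ (k.1 + k.2.1 + k.2.2)).eval A * (ascPochhammer ℂ k.1).eval b₁ *
        (ascPochhammer ℂ k.2.1).eval b₂ * (ascPochhammer ℂ k.2.2).eval b₃ /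
      ((ascPochhammer ℂ (k.1 + k.2.1 + k.2.2)).eval c *
        (k.1.factorial : ℂ) * (k.2.1.factorial : ℂ) * (k.2.2.factorial : ℂ)) *
      (x₁ ^ k.1 * x₂ ^ k.2.1 * x₃ ^ k.2.2)

/-! ### Second-order linear equations `f'' + P f' + Q f = 0` in the complex domain -/

/-- `f` is a holomorphic solution of `f'' + P f' + Q f = 0` on the (open) set `U`. -/
def SolvesODE (P Q : ℂ → ℂ) (U : Set ℂ) (f : ℂ → ℂ) : Prop :=
  DifferentiableOn ℂ f U ∧
    ∀ z ∈ U, deriv (deriv f) z + P z * deriv f z + Q z * f z = 0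

/-- `c` is an ordinary point of `f'' + P f' + Q f = 0`: near `c` the coefficients agree, off `c`,
with functions analytic at `c`. -/
def IsOrdinaryPoint (P Q : ℂ → ℂ) (c : ℂ) : Prop :=
  ∃ P₀ Q₀ : ℂ → ℂ, AnalyticAt ℂ P₀ c ∧ AnalyticAt ℂ Q₀ c ∧
    P =ᶠ[nhdsWithin c {c}ᶜ] P₀ ∧ Q =ᶠ[nhdsWithin c {c}ᶜ] Q₀

/-- `c` is a regular singular point of `f'' + P f' + Q f = 0` with exponents `r₁, r₂`:
it is not an ordinary point, `(z - c) P` and `(z - c)² Q` are analytic at `c`, and `r₁, r₂` are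
the roots, with multiplicity, of the indicial polynomial. -/
def IsRegularSingularPoint (P Q : ℂ → ℂ) (c r₁ r₂ : ℂ) : Prop :=
  ¬ IsOrdinaryPoint P Q c ∧
    ∃ P₀ Q₀ : ℂ → ℂ, AnalyticAt ℂ P₀ c ∧ AnalyticAt ℂ Q₀ c ∧
      (fun z => (z - c) * P z) =ᶠ[nhdsWithin c {c}ᶜ] P₀ ∧
      (fun z => (z - c) ^ 2 * Q z) =ᶠ[nhdsWithin c {c}ᶜ] Q₀ ∧
      ∀ r : ℂ, r * (r - 1) + P₀ c * r + Q₀ c = (r - r₁) * (r - r₂)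

/-- The point at infinity is a regular singular point with exponents `r₁, r₂`: so is `t = 0` for
the equation obtained by the substitution `z = 1 / t`. -/
def IsRegularSingularAtInfinity (P Q : ℂ → ℂ) (r₁ r₂ : ℂ) : Prop :=
  IsRegularSingularPoint (fun t => 2 / t - P (1 / t) / t ^ 2) (fun t => Q (1 / t) / t ^ 4) 0 r₁ r₂

/-- `ℓ` is a holomorphic branch of `log (z - c)` on the open set `U` (so `c ∉ U`). -/
def IsLogBranch (c : ℂ) (U : Set ℂ) (ℓ : ℂ → ℂ) : Prop :=
  ContinuousOn ℓ U ∧ ∀ z ∈ U, Complex.exp (ℓ z) = z - c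

/-! ### Heun's equation -/

/-- The parameters of Heun's equation, with the Fuchsian relation. -/
structure HeunParams where
  a : ℂ
  q : ℂ
  α : ℂ
  β : ℂ
  γ : ℂ
  δ : ℂ
  ε : ℂ
  a_ne_zero : a ≠ 0
  a_ne_one : a ≠ 1
  fuchs : γ + δ + ε = α + β + 1

namespace HeunParams

/-- The coefficient of `y'` in Heun's equation. -/
def P (H : HeunParams) (z : ℂ) : ℂ := H.γ / z + H.δ / (z - 1) + H.ε / (z - H.a)

/-- The coefficient of `y` in Heun's equation. -/
def Q (H : HeunParams) (z : ℂ) : ℂ :=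
  (H.α * H.β * z - H.q) / (z * (z - 1) * (z - H.a))

/-- The coefficient of `v'` in the equation for `v = z^γ (z-1)^δ (z-a)^ε y'`. -/
def derivP (H : HeunParams) (z : ℂ) : ℂ :=
  (1 - H.γ) / z + (1 - H.δ) / (z - 1) + (1 - H.ε) / (z - H.a)
    - H.α * H.β / (H.α * H.β * z - H.q)

/-- The extra singular point `q / (α β)`. -/
def z₀ (H : HeunParams) : ℂ := H.q / (H.α * H.β)

/-- `z^γ (z-1)^δ (z-a)^ε`, the powers being formed with the values `l₀, l₁, lₐ` of
`log z`, `log (z-1)`, `log (z-a)`. -/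
def weight (H : HeunParams) (l₀ l₁ lₐ : ℂ) : ℂ :=
  Complex.exp (H.γ * l₀) * Complex.exp (H.δ * l₁) * Complex.exp (H.ε * lₐ)

/-- The radius of the disc about `0` in which the hypergeometric functions are evaluated. -/
def ρ (H : HeunParams) : ℝ := min 1 ‖H.a‖

/-- The branch of `log (z - 1)` on `|z| < 1` whose value at `0` is `L₁`, a logarithm of `-1`. -/
def log₁ (_H : HeunParams) (L₁ z : ℂ) : ℂ := L₁ + Complex.log (1 - z)

/-- The branch of `log (z - a)` on `|z| < |a|` whose value at `0` is `Lₐ`, a logarithm of `-a`. -/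
def logₐ (H : HeunParams) (Lₐ z : ℂ) : ℂ := Lₐ + Complex.log (1 - z / H.a)

/-- `z^γ (z-1)^δ (z-a)^ε` at a point `z` of `0 < |z| < ρ`, `l` being a logarithm of `z`. -/
def localWeight (H : HeunParams) (L₁ Lₐ l z : ℂ) : ℂ :=
  H.weight l (H.log₁ L₁ z) (H.logₐ Lₐ z)

/-! The factors `(z - c)^μ` for `c = 0, 1, a` and `(z - z₀)²` for `c = z₀`, as functions of a
logarithm `l` of `z` and of `z`. -/

def pre0 (_H : HeunParams) (μ : ℂ) (l _z : ℂ) : ℂ := Complex.exp (μ * l)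

def pre1 (H : HeunParams) (L₁ μ : ℂ) (_l z : ℂ) : ℂ := Complex.exp (μ * H.log₁ L₁ z)

def preA (H : HeunParams) (Lₐ μ : ℂ) (_l z : ℂ) : ℂ := Complex.exp (μ * H.logₐ Lₐ z)

def preZ (H : HeunParams) (_l z : ℂ) : ℂ := (z - H.z₀) ^ 2

/-- `z^{-γ} (z-1)^{-δ} (z-a)^{-ε} (z-c)^{μ+ν}`, where `pre l z` is the factor `(z-c)^μ`. -/
def integrand (H : HeunParams) (L₁ Lₐ : ℂ) (pre : ℂ → ℂ → ℂ) (c : ℂ) (ν : ℕ) (l z : ℂ) : ℂ :=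
  pre l z * (z - c) ^ ν / H.localWeight L₁ Lₐ l z

/-! The closed forms of the integrals of these functions. `exp (s * L₁)` is `(-1)^s`,
`exp (s * Lₐ)` is `(-a)^s`, `exp (s * l)` is `z^s`. -/

def term0 (H : HeunParams) (L₁ Lₐ μ : ℂ) (ν : ℕ) (l z : ℂ) : ℂ :=
  Complex.exp (-H.δ * L₁) * Complex.exp (-H.ε * Lₐ) *
    (Complex.exp ((1 - H.γ + μ + ν) * l) / (1 - H.γ + μ + ν)) *
    appellF1 (1 - H.γ + μ + ν) H.δ H.ε (1 + (1 - H.γ + μ + ν)) z (z / H.a)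

def term1 (H : HeunParams) (L₁ Lₐ μ : ℂ) (ν : ℕ) (l z : ℂ) : ℂ :=
  Complex.exp ((-H.δ + μ + ν) * L₁) * Complex.exp (-H.ε * Lₐ) * Complex.exp ((1 - H.γ) * l) *
    (Complex.Gamma (1 - H.γ) / Complex.Gamma (2 - H.γ)) *
    appellF1 (1 - H.γ) (H.δ - μ - ν) H.ε (2 - H.γ) z (z / H.a)

def termA (H : HeunParams) (L₁ Lₐ μ : ℂ) (ν : ℕ) (l z : ℂ) : ℂ :=
  Complex.exp (-H.δ * L₁) * Complex.exp ((-H.ε + μ + ν) * Lₐ) * Complex.exp ((1 - H.γ) * l) *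
    (Complex.Gamma (1 - H.γ) / Complex.Gamma (2 - H.γ)) *
    appellF1 (1 - H.γ) H.δ (H.ε - μ - ν) (2 - H.γ) z (z / H.a)

def termZ (H : HeunParams) (L₁ Lₐ : ℂ) (ν : ℕ) (l z : ℂ) : ℂ :=
  Complex.exp (-H.δ * L₁) * Complex.exp (-H.ε * Lₐ) * (-H.z₀) ^ (2 + ν) *
    Complex.exp ((1 - H.γ) * l) * (Complex.Gamma (1 - H.γ) / Complex.Gamma (2 - H.γ)) *
    lauricellaFD (1 - H.γ) H.δ H.ε (-2 - ν) (2 - H.γ) z (z / H.a) (z / H.z₀)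

end HeunParams

/-! ### Expansions and term-by-term integration. Below `ℓ` is a branch of `log z` on `U`. -/

/-- `v = (z-c)^μ ∑ a_ν (z-c)^ν` on `U`, with `(z-c)^μ = pre (ℓ z) z`. -/
def HasExpansion (U : Set ℂ) (ℓ v : ℂ → ℂ) (pre : ℂ → ℂ → ℂ) (c : ℂ) (coef : ℕ → ℂ) : Prop :=
  ∀ z ∈ U, HasSum (fun ν => coef ν * (pre (ℓ z) z * (z - c) ^ ν)) (v z)

/-- On `U`, `Y ν` is an indefinite integral of `f ν`, for all `ν`. -/
def IsIndefiniteIntegral (U : Set ℂ) (ℓ : ℂ → ℂ) (f Y : ℕ → ℂ → ℂ → ℂ) : Prop :=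
  ∀ ν, ∀ z ∈ U, HasDerivAt (fun w => Y ν (ℓ w) w) (f ν (ℓ z) z) z

/-- The integral of `f` along the segment `u ↦ u z`, `0 ≤ u ≤ 1`, converges absolutely and equals
`I`. The logarithm of `u z` is `log u + l`, where `l` is the chosen logarithm of `z`. -/
def HasSegmentIntegral (f : ℂ → ℂ → ℂ) (l z I : ℂ) : Prop :=
  IntervalIntegrable (fun u : ℝ => f ((Real.log u : ℂ) + l) ((u : ℂ) * z) * z)
    MeasureTheory.volume 0 1 ∧
  ∫ u in (0 : ℝ)..1, f ((Real.log u : ℂ) + l) ((u : ℂ) * z) * z = I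

/-- `y = C₀ + ∑ a_ν Y_ν` on `U`. -/
def IsTermwiseExpansion (U : Set ℂ) (ℓ y : ℂ → ℂ) (coef : ℕ → ℂ) (Y : ℕ → ℂ → ℂ → ℂ) : Prop :=
  ∃ C₀ : ℂ, ∀ z ∈ U, HasSum (fun ν => coef ν * Y ν (ℓ z) z) (y z - C₀)

/-- `y(z) = y(w) + ∑ a_ν (Y_ν(z) - Y_ν(w))` on `U`: each indefinite integral is normalised, by its
constant of integration, to vanish at `w`. -/
def IsNormalisedTermwiseExpansion (U : Set ℂ) (ℓ y : ℂ → ℂ) (coef : ℕ → ℂ)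
    (Y : ℕ → ℂ → ℂ → ℂ) : Prop :=
  ∀ z ∈ U, ∀ w ∈ U, HasSum (fun ν => coef ν * (Y ν (ℓ z) z - Y ν (ℓ w) w)) (y z - y w)

end

/-! Write w = z^γ (z-1)^δ (z-a)^ε. Since w' = P w, Heun's equation says (w y')' = -w Q y; hence v' =
-w Q y and y' = v/w. Eliminating y gives the equation for v, whose first-order coefficient -(P +
Q'/Q) has a new pole at the zero z₀ of Q (`solvesODE_weight_mul_deriv`). In the exceptional cases
this new term is absent or merges with an old pole.

Near c, the factors of w belonging to the other singular points extend holomorphically to a disc.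
The remaining factor (z-c)^θ either multiplies g' or cancels the pole created by differentiating
(z-c)^(1-θ) g (`exists_hasSum_of_frobenius`). At z₀, Q vanishes, so y' = 0 forces y'' = 0 and y' has
a double zero.

The integrals come from products of binomial series: z^(s-1+n) integrates to z^(s+n)/(s+n), and
s/(s+n) = (s)_n/(1+s)_n produces the functions of Appell and Lauricella
(`ConvergesInBall.integratesTo`).

The expansion of v converges at points of U farther from c than any given one, hence locally
uniformly. Dividing by w and integrating along a connected set gives the formula for y(z) - y(w)
(`hasSum_mul_sub_of_hasDerivAt`). The constant C₀ exists as soon as ∑ a_ν Y_ν(w) converges at one w.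
For c = 0 this is clear, as Y_ν(w) = O(|w|^ν).

For c ≠ 0 the base point 0 of the integrals lies on the circle |z-c| = |c|. With w between 0 and c,
a Gamma integral gives Y_ν(w) = O(|c|^ν ν^(-p)), p = 1 - Re γ (`summable_mul_of_segment_bound`), so
∑ |a_ν c^ν| ν^(-p) must be shown finite. In the variable z = c(1-ζ), f = v/(z-c)^μ and a companion
proportional to w y/(z-c)^(μ-1), suitably normalised, satisfy a first-order system, singular on |ζ|
= 1 only at ζ = 1 (`exists_companion`). An energy estimate along radii yields |f'| ≤ C |1-ζ|^(-p)
(`norm_deriv_le_rpow`). Maxima over circles would only give terms O(1/n); means over |ζ| = n/(n+1),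
together with the integrability of |1-ζ|^(-η) for small η, gain a factor n^(-η)
(`summable_coeff_of_norm_deriv_le`). -/

open Filter Topology


/-! ### Logarithms and the equation for `v` -/

namespace IsLogBranch

variable {c : ℂ} {U : Set ℂ} {ℓ : ℂ → ℂ}

theorem ne (h : IsLogBranch c U ℓ) {z : ℂ} (hz : z ∈ U) : z ≠ c := by
  rintro rfl
  simpa using h.2 z hz

/-- Continuity of a branch suffices for holomorphy: it locally inverts `exp + c`, whose derivative
does not vanish. -/
theorem hasDerivAt (h : IsLogBranch c U ℓ) (hU : IsOpen U) {z : ℂ} (hz : z ∈ U) :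
    HasDerivAt ℓ (z - c)⁻¹ z := by
  have h1 : HasDerivAt (fun w => Complex.exp w + c) (z - c) (ℓ z) := by
    have := (Complex.hasDerivAt_exp (ℓ z)).add_const c
    rwa [h.2 z hz] at this
  refine HasDerivAt.of_local_left_inverse (h.1.continuousAt (hU.mem_nhds hz)) h1
    (sub_ne_zero.2 (h.ne hz)) ?_
  filter_upwards [hU.mem_nhds hz] with w hw
  rw [h.2 w hw]; ring

theorem exists_eq_add_const (h : IsLogBranch c U ℓ) {ℓ' : ℂ → ℂ} (h' : IsLogBranch c U ℓ')
    (hU : IsOpen U) (hc : IsPreconnected U) : ∃ C : ℂ, ∀ z ∈ U, ℓ z = ℓ' z + C := by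
  obtain ⟨C, hC⟩ := hU.exists_eq_add_of_deriv_eq hc
    (fun z hz => (h.hasDerivAt hU hz).differentiableAt.differentiableWithinAt)
    (fun z hz => (h'.hasDerivAt hU hz).differentiableAt.differentiableWithinAt)
    (fun z hz => by rw [(h.hasDerivAt hU hz).deriv, (h'.hasDerivAt hU hz).deriv])
  exact ⟨C, fun z hz => hC hz⟩

theorem mono (h : IsLogBranch c U ℓ) {V : Set ℂ} (hV : V ⊆ U) : IsLogBranch c V ℓ :=
  ⟨h.1.mono hV, fun z hz => h.2 z (hV hz)⟩

end IsLogBranch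

namespace SolvesODE

variable {P Q : ℂ → ℂ} {U : Set ℂ} {y : ℂ → ℂ}

theorem hasDerivAt (h : SolvesODE P Q U y) (hU : IsOpen U) {z : ℂ} (hz : z ∈ U) :
    HasDerivAt y (deriv y z) z :=
  (h.1.differentiableAt (hU.mem_nhds hz)).hasDerivAt

theorem hasDerivAt_deriv (h : SolvesODE P Q U y) (hU : IsOpen U) {z : ℂ} (hz : z ∈ U) :
    HasDerivAt (deriv y) (-(P z * deriv y z) - Q z * y z) z := by
  have h1 := ((h.1.deriv hU).differentiableAt (hU.mem_nhds hz)).hasDerivAt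
  exact h1.congr_deriv (by linear_combination h.2 z hz)

end SolvesODE

namespace HeunParams

theorem hasDerivAt_weight (H : HeunParams) {ℓ₀ ℓ₁ ℓₐ : ℂ → ℂ} {z : ℂ}
    (h₀ : HasDerivAt ℓ₀ z⁻¹ z) (h₁ : HasDerivAt ℓ₁ (z - 1)⁻¹ z)
    (hₐ : HasDerivAt ℓₐ (z - H.a)⁻¹ z) :
    HasDerivAt (fun z => H.weight (ℓ₀ z) (ℓ₁ z) (ℓₐ z))
      (H.weight (ℓ₀ z) (ℓ₁ z) (ℓₐ z) * H.P z) z := by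
  unfold weight
  refine (((h₀.const_mul H.γ).cexp.mul (h₁.const_mul H.δ).cexp).mul
    (hₐ.const_mul H.ε).cexp).congr_deriv ?_
  simp only [P, Pi.mul_apply]; ring

theorem weight_ne_zero (H : HeunParams) (l₀ l₁ lₐ : ℂ) : H.weight l₀ l₁ lₐ ≠ 0 := by
  simp [weight, Complex.exp_ne_zero]

/-- The self-adjoint form of Heun's equation: P is the logarithmic derivative of the weight, so the
terms in y' cancel. -/
theorem hasDerivAt_weight_mul_deriv (H : HeunParams) {ℓ₀ ℓ₁ ℓₐ y : ℂ → ℂ} {U : Set ℂ}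
    (hU : IsOpen U) (hy : SolvesODE H.P H.Q U y) {z : ℂ} (hz : z ∈ U)
    (h₀ : HasDerivAt ℓ₀ z⁻¹ z) (h₁ : HasDerivAt ℓ₁ (z - 1)⁻¹ z)
    (hₐ : HasDerivAt ℓₐ (z - H.a)⁻¹ z) :
    HasDerivAt (fun z => H.weight (ℓ₀ z) (ℓ₁ z) (ℓₐ z) * deriv y z)
      (-(H.weight (ℓ₀ z) (ℓ₁ z) (ℓₐ z) * H.Q z * y z)) z := by
  refine ((H.hasDerivAt_weight h₀ h₁ hₐ).mul (hy.hasDerivAt_deriv hU hz)).congr_deriv ?_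
  ring

theorem hasDerivAt_Q (H : HeunParams) {z : ℂ} (h₀ : z ≠ 0) (h₁ : z ≠ 1) (hₐ : z ≠ H.a) :
    HasDerivAt H.Q (H.α * H.β / (z * (z - 1) * (z - H.a))
      - H.Q z * (1 / z + 1 / (z - 1) + 1 / (z - H.a))) z := by
  have h1 := sub_ne_zero.2 h₁
  have ha := sub_ne_zero.2 hₐ
  have hd : HasDerivAt (fun w : ℂ => w * (w - 1) * (w - H.a))
      ((1 * (z - 1) + z * 1) * (z - H.a) + z * (z - 1) * 1) z :=
    (((hasDerivAt_id z).mul ((hasDerivAt_id z).sub_const 1))).mul ((hasDerivAt_id z).sub_const H.a)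
  have hn : HasDerivAt (fun w : ℂ => H.α * H.β * w - H.q) (H.α * H.β * 1) z :=
    ((hasDerivAt_id z).const_mul (H.α * H.β)).sub_const H.q
  refine (hn.div hd (by simp [h₀, h1, ha])).congr_deriv ?_
  simp only [Q]
  field_simp

/-- Differentiate v' = -w Q y again. Where Q ≠ 0, y and y' are recovered from v' and v, and
-(wQ)'/(wQ) is exactly `derivP`. -/
theorem solvesODE_weight_mul_deriv (H : HeunParams) {U : Set ℂ} {ℓ₀ ℓ₁ ℓₐ y : ℂ → ℂ}
    (hU : IsOpen U) (h₀ : IsLogBranch 0 U ℓ₀) (h₁ : IsLogBranch 1 U ℓ₁)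
    (hₐ : IsLogBranch H.a U ℓₐ) (hy : SolvesODE H.P H.Q U y) :
    DifferentiableOn ℂ (fun z => H.weight (ℓ₀ z) (ℓ₁ z) (ℓₐ z) * deriv y z) U ∧
      SolvesODE H.derivP H.Q (U \ {z | H.α * H.β * z = H.q})
        (fun z => H.weight (ℓ₀ z) (ℓ₁ z) (ℓₐ z) * deriv y z) := by
  have d₀ : ∀ z ∈ U, HasDerivAt ℓ₀ z⁻¹ z := fun z hz => by simpa using h₀.hasDerivAt hU hz
  have hv : ∀ z ∈ U, HasDerivAt (fun z => H.weight (ℓ₀ z) (ℓ₁ z) (ℓₐ z) * deriv y z)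
      (-(H.weight (ℓ₀ z) (ℓ₁ z) (ℓₐ z) * H.Q z * y z)) z := fun z hz =>
    H.hasDerivAt_weight_mul_deriv hU hy hz (d₀ z hz) (h₁.hasDerivAt hU hz) (hₐ.hasDerivAt hU hz)
  have hdiff : DifferentiableOn ℂ (fun z => H.weight (ℓ₀ z) (ℓ₁ z) (ℓₐ z) * deriv y z) U :=
    fun z hz => (hv z hz).differentiableAt.differentiableWithinAt
  refine ⟨hdiff, hdiff.mono Set.sdiff_subset, ?_⟩
  rintro z ⟨hz, hzq⟩
  have z0 : z ≠ 0 := h₀.ne hz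
  have z1 : z ≠ 1 := h₁.ne hz
  have za : z ≠ H.a := hₐ.ne hz
  have hev : deriv (fun z => H.weight (ℓ₀ z) (ℓ₁ z) (ℓₐ z) * deriv y z) =ᶠ[𝓝 z]
      fun z => -(H.weight (ℓ₀ z) (ℓ₁ z) (ℓₐ z) * H.Q z * y z) := by
    filter_upwards [hU.mem_nhds hz] with w hw using (hv w hw).deriv
  have h2 := (((H.hasDerivAt_weight (d₀ z hz) (h₁.hasDerivAt hU hz) (hₐ.hasDerivAt hU hz)).mul
    (H.hasDerivAt_Q z0 z1 za)).mul (hy.hasDerivAt hU hz)).neg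
  have h2' : deriv (fun z => -(H.weight (ℓ₀ z) (ℓ₁ z) (ℓₐ z) * H.Q z * y z)) z = _ := h2.deriv
  rw [hev.deriv_eq, (hv z hz).deriv, h2']
  have hq : H.α * H.β * z - H.q ≠ 0 := sub_ne_zero.2 hzq
  have h1 := sub_ne_zero.2 z1
  have ha := sub_ne_zero.2 za
  simp only [P, Q, derivP, Pi.mul_apply]
  generalize H.α * H.β * z - H.q = p at hq ⊢
  field_simp
  ring

end HeunParams

/-! ### The singular points of the equation for `v` -/

/-- A test for poles: multiplying a function regular at c by a positive power of z - c gives limit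
0, so a non-zero limit excludes an ordinary point. -/
theorem eq_zero_of_pow_mul_eventuallyEq {g g₀ R : ℂ → ℂ} {c : ℂ} {n : ℕ} (hn : n ≠ 0)
    (hg : g =ᶠ[𝓝[≠] c] g₀) (hg₀ : ContinuousAt g₀ c)
    (hR : (fun z => (z - c) ^ n * g z) =ᶠ[𝓝[≠] c] R) (hRc : ContinuousAt R c) : R c = 0 := by
  have h1 : Tendsto (fun z => (z - c) ^ n * g₀ z) (𝓝[≠] c) (𝓝 ((c - c) ^ n * g₀ c)) := by
    have : ContinuousAt (fun z => (z - c) ^ n * g₀ z) c := by fun_prop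
    exact this.tendsto.mono_left nhdsWithin_le_nhds
  rw [sub_self, zero_pow hn, zero_mul] at h1
  refine tendsto_nhds_unique (hRc.tendsto.mono_left nhdsWithin_le_nhds) (h1.congr' ?_)
  filter_upwards [hg, hR] with z h1 h2
  rw [← h1, h2]

/-- R carries the evidence that the point is genuinely singular, on either coefficient. The power n
is left free because at infinity the pole of the second coefficient is double. -/
theorem IsRegularSingularPoint.of_eventuallyEq {P Q P₀ Q₀ : ℂ → ℂ} {c r₁ r₂ : ℂ}
    (hP₀ : AnalyticAt ℂ P₀ c) (hQ₀ : AnalyticAt ℂ Q₀ c)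
    (hP : (fun z => (z - c) * P z) =ᶠ[𝓝[≠] c] P₀)
    (hQ : (fun z => (z - c) ^ 2 * Q z) =ᶠ[𝓝[≠] c] Q₀)
    (h₁ : P₀ c = 1 - r₁ - r₂) (h₂ : Q₀ c = r₁ * r₂)
    {n : ℕ} (hn : n ≠ 0) {R : ℂ → ℂ} (hR : ContinuousAt R c) (hRc : R c ≠ 0)
    (hPQ : (fun z => (z - c) ^ n * P z) =ᶠ[𝓝[≠] c] R ∨ (fun z => (z - c) ^ n * Q z) =ᶠ[𝓝[≠] c] R) :
    IsRegularSingularPoint P Q c r₁ r₂ := by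
  refine ⟨?_, P₀, Q₀, hP₀, hQ₀, hP, hQ, fun r => by rw [h₁, h₂]; ring⟩
  rintro ⟨P₁, Q₁, hP₁, hQ₁, hPP, hQQ⟩
  rcases hPQ with h | h
  · exact hRc (eq_zero_of_pow_mul_eventuallyEq hn hPP hP₁.continuousAt h hR)
  · exact hRc (eq_zero_of_pow_mul_eventuallyEq hn hQQ hQ₁.continuousAt h hR)

theorem eventually_punctured_ne (c d : ℂ) : ∀ᶠ z in 𝓝[≠] c, z ≠ d := by
  by_cases h : d = c
  · subst h; exact eventually_mem_nhdsWithin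
  · exact eventually_nhdsWithin_of_eventually_nhds (isOpen_ne.mem_nhds (Ne.symm h))

namespace HeunParams

theorem isOrdinaryPoint (H : HeunParams) (hαβ : H.α * H.β ≠ 0) {c : ℂ} (h₀ : c ≠ 0) (h₁ : c ≠ 1)
    (hₐ : c ≠ H.a) (hc : c ≠ H.z₀) : IsOrdinaryPoint H.derivP H.Q c := by
  have h1 := sub_ne_zero.2 h₁
  have ha := sub_ne_zero.2 hₐ
  have hq : H.α * H.β * c - H.q ≠ 0 := by
    intro h
    apply hc
    rw [z₀, eq_div_iff hαβ]; linear_combination h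
  have hΔ : c * (c - 1) * (c - H.a) ≠ 0 := by simp [h₀, h1, ha]
  refine ⟨H.derivP, H.Q, ?_, ?_, EventuallyEq.rfl, EventuallyEq.rfl⟩
  · unfold derivP
    fun_prop (disch := assumption)
  · unfold Q
    fun_prop (disch := assumption)

/-- The singularity is detected on Q, not on `derivP`, whose residue 1 - γ may vanish; q ≠ 0 leaves
Q a simple pole. The points 1 and a are treated alike. -/
theorem isRegularSingularPoint_zero (H : HeunParams) (hαβ : H.α * H.β ≠ 0) (hq : H.q ≠ 0) :
    IsRegularSingularPoint H.derivP H.Q 0 0 H.γ := by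
  have ha := H.a_ne_zero
  have e1 : (0 : ℂ) - 1 ≠ 0 := by simp
  have e2 : 0 - H.a ≠ 0 := by simpa using ha
  have e3 : H.α * H.β * 0 - H.q ≠ 0 := by simpa using hq
  have e4 : ((0 : ℂ) - 1) * (0 - H.a) ≠ 0 := mul_ne_zero e1 e2
  have hev : ∀ᶠ z in 𝓝[≠] (0 : ℂ), z ≠ 0 ∧ z - 1 ≠ 0 ∧ z - H.a ≠ 0 ∧ H.α * H.β * z - H.q ≠ 0 := by
    filter_upwards [eventually_punctured_ne 0 0, eventually_punctured_ne 0 1,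
      eventually_punctured_ne 0 H.a, eventually_punctured_ne 0 H.z₀] with z h0 h1 ha hz
    refine ⟨h0, sub_ne_zero.2 h1, sub_ne_zero.2 ha, fun h => hz ?_⟩
    rw [z₀, eq_div_iff hαβ]; linear_combination h
  refine IsRegularSingularPoint.of_eventuallyEq
    (P₀ := fun z => (1 - H.γ) + z * ((1 - H.δ) / (z - 1) + (1 - H.ε) / (z - H.a)
      - H.α * H.β / (H.α * H.β * z - H.q)))
    (Q₀ := fun z => z * (H.α * H.β * z - H.q) / ((z - 1) * (z - H.a)))
    ?_ ?_ ?_ ?_ (by simp) (by simp) one_ne_zero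
    (R := fun z => (H.α * H.β * z - H.q) / ((z - 1) * (z - H.a))) ?_ ?_ (Or.inr ?_)
  · fun_prop (disch := assumption)
  · fun_prop (disch := assumption)
  · filter_upwards [hev] with z ⟨h0, h1, ha, hz⟩
    simp only [derivP]; field_simp; ring
  · filter_upwards [hev] with z ⟨h0, h1, ha, hz⟩
    simp only [Q]; field_simp; ring
  · fun_prop (disch := assumption)
  · exact div_ne_zero e3 e4
  · filter_upwards [hev] with z ⟨h0, h1, ha, hz⟩
    simp only [Q]; field_simp; ring

theorem isRegularSingularPoint_one (H : HeunParams) (hαβ : H.α * H.β ≠ 0)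
    (hq : H.q ≠ H.α * H.β) : IsRegularSingularPoint H.derivP H.Q 1 0 H.δ := by
  have e1 : (1 : ℂ) ≠ 0 := one_ne_zero
  have e2 : 1 - H.a ≠ 0 := sub_ne_zero.2 H.a_ne_one.symm
  have e3 : H.α * H.β * 1 - H.q ≠ 0 := by rw [mul_one]; exact sub_ne_zero.2 hq.symm
  have e4 : (1 : ℂ) * (1 - H.a) ≠ 0 := mul_ne_zero e1 e2
  have hev : ∀ᶠ z in 𝓝[≠] (1 : ℂ), z ≠ 0 ∧ z - 1 ≠ 0 ∧ z - H.a ≠ 0 ∧ H.α * H.β * z - H.q ≠ 0 := by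
    filter_upwards [eventually_punctured_ne 1 0, eventually_punctured_ne 1 1,
      eventually_punctured_ne 1 H.a, eventually_punctured_ne 1 H.z₀] with z h0 h1 ha hz
    refine ⟨h0, sub_ne_zero.2 h1, sub_ne_zero.2 ha, fun h => hz ?_⟩
    rw [z₀, eq_div_iff hαβ]; linear_combination h
  refine IsRegularSingularPoint.of_eventuallyEq
    (P₀ := fun z => (1 - H.δ) + (z - 1) * ((1 - H.γ) / z + (1 - H.ε) / (z - H.a)
      - H.α * H.β / (H.α * H.β * z - H.q)))
    (Q₀ := fun z => (z - 1) * (H.α * H.β * z - H.q) / (z * (z - H.a)))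
    ?_ ?_ ?_ ?_ (by simp) (by simp) one_ne_zero
    (R := fun z => (H.α * H.β * z - H.q) / (z * (z - H.a))) ?_ ?_ (Or.inr ?_)
  · fun_prop (disch := assumption)
  · fun_prop (disch := assumption)
  · filter_upwards [hev] with z ⟨h0, h1, ha, hz⟩
    simp only [derivP]; field_simp; ring
  · filter_upwards [hev] with z ⟨h0, h1, ha, hz⟩
    simp only [Q]; field_simp
  · fun_prop (disch := assumption)
  · exact div_ne_zero e3 e4
  · filter_upwards [hev] with z ⟨h0, h1, ha, hz⟩
    simp only [Q]; field_simp

theorem isRegularSingularPoint_a (H : HeunParams) (hαβ : H.α * H.β ≠ 0)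
    (hq : H.q ≠ H.a * (H.α * H.β)) : IsRegularSingularPoint H.derivP H.Q H.a 0 H.ε := by
  have e1 : H.a ≠ 0 := H.a_ne_zero
  have e2 : H.a - 1 ≠ 0 := sub_ne_zero.2 H.a_ne_one
  have e3 : H.α * H.β * H.a - H.q ≠ 0 := by rw [mul_comm]; exact sub_ne_zero.2 hq.symm
  have e4 : H.a * (H.a - 1) ≠ 0 := mul_ne_zero e1 e2
  have hev : ∀ᶠ z in 𝓝[≠] H.a, z ≠ 0 ∧ z - 1 ≠ 0 ∧ z - H.a ≠ 0 ∧ H.α * H.β * z - H.q ≠ 0 := by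
    filter_upwards [eventually_punctured_ne _ 0, eventually_punctured_ne _ 1,
      eventually_punctured_ne _ H.a, eventually_punctured_ne _ H.z₀] with z h0 h1 ha hz
    refine ⟨h0, sub_ne_zero.2 h1, sub_ne_zero.2 ha, fun h => hz ?_⟩
    rw [z₀, eq_div_iff hαβ]; linear_combination h
  refine IsRegularSingularPoint.of_eventuallyEq
    (P₀ := fun z => (1 - H.ε) + (z - H.a) * ((1 - H.γ) / z + (1 - H.δ) / (z - 1)
      - H.α * H.β / (H.α * H.β * z - H.q)))
    (Q₀ := fun z => (z - H.a) * (H.α * H.β * z - H.q) / (z * (z - 1)))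
    ?_ ?_ ?_ ?_ (by simp) (by simp) one_ne_zero
    (R := fun z => (H.α * H.β * z - H.q) / (z * (z - 1))) ?_ ?_ (Or.inr ?_)
  · fun_prop (disch := assumption)
  · fun_prop (disch := assumption)
  · filter_upwards [hev] with z ⟨h0, h1, ha, hz⟩
    simp only [derivP]; field_simp; ring
  · filter_upwards [hev] with z ⟨h0, h1, ha, hz⟩
    simp only [Q]; field_simp
  · fun_prop (disch := assumption)
  · exact div_ne_zero e3 e4
  · filter_upwards [hev] with z ⟨h0, h1, ha, hz⟩
    simp only [Q]; field_simp

/-- Here Q is regular with value 0, so the pole is detected on `derivP`: its residue is -1 for all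
parameters, whence the exponents 0 and 2. -/
theorem isRegularSingularPoint_z₀ (H : HeunParams) (hαβ : H.α * H.β ≠ 0) (hq₀ : H.q ≠ 0)
    (hq₁ : H.q ≠ H.α * H.β) (hqₐ : H.q ≠ H.a * (H.α * H.β)) :
    IsRegularSingularPoint H.derivP H.Q H.z₀ 0 2 := by
  have hz : H.α * H.β * H.z₀ = H.q := by rw [z₀, mul_div_cancel₀ _ hαβ]
  have e0 : H.z₀ ≠ 0 := div_ne_zero hq₀ hαβ
  have e1 : H.z₀ - 1 ≠ 0 := fun h => hq₁ (by linear_combination -hz + H.α * H.β * h)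
  have e2 : H.z₀ - H.a ≠ 0 := fun h => hqₐ (by linear_combination -hz + H.α * H.β * h)
  have e4 : H.z₀ * (H.z₀ - 1) * (H.z₀ - H.a) ≠ 0 := mul_ne_zero (mul_ne_zero e0 e1) e2
  have hq' : ∀ z, H.α * H.β * z - H.q = H.α * H.β * (z - H.z₀) := fun z => by
    linear_combination hz
  have hev : ∀ᶠ z in 𝓝[≠] H.z₀, z ≠ 0 ∧ z - 1 ≠ 0 ∧ z - H.a ≠ 0 ∧ z - H.z₀ ≠ 0 := by
    filter_upwards [eventually_punctured_ne _ 0, eventually_punctured_ne _ 1,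
      eventually_punctured_ne _ H.a, eventually_punctured_ne _ H.z₀] with z h0 h1 ha hz
    exact ⟨h0, sub_ne_zero.2 h1, sub_ne_zero.2 ha, sub_ne_zero.2 hz⟩
  have hA : AnalyticAt ℂ (fun z => (z - H.z₀) * ((1 - H.γ) / z + (1 - H.δ) / (z - 1)
      + (1 - H.ε) / (z - H.a)) - 1) H.z₀ := by
    fun_prop (disch := assumption)
  have hP : (fun z => (z - H.z₀) * H.derivP z) =ᶠ[𝓝[≠] H.z₀]
      (fun z => (z - H.z₀) * ((1 - H.γ) / z + (1 - H.δ) / (z - 1)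
        + (1 - H.ε) / (z - H.a)) - 1) := by
    filter_upwards [hev] with z ⟨h0, h1, ha, hz⟩
    have : H.α * H.β / (H.α * H.β * (z - H.z₀)) = 1 / (z - H.z₀) := by
      rw [div_eq_div_iff (mul_ne_zero hαβ hz) hz]; ring
    simp only [derivP, hq', this]; field_simp
  refine IsRegularSingularPoint.of_eventuallyEq hA
    (Q₀ := fun z => (z - H.z₀) ^ 2 * ((H.α * H.β * z - H.q) / (z * (z - 1) * (z - H.a))))
    ?_ hP EventuallyEq.rfl (by simp; norm_num) (by simp) one_ne_zero
    hA.continuousAt (by simp) (Or.inl (by simpa using hP))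
  fun_prop (disch := assumption)

/-- The Fuchs relation turns the value γ + δ + ε of t times the first coefficient at t = 0 into α +
β + 1; the second coefficient has a double pole with leading coefficient αβ ≠ 0. -/
theorem isRegularSingularAtInfinity (H : HeunParams) (hαβ : H.α * H.β ≠ 0) :
    IsRegularSingularAtInfinity H.derivP H.Q (-H.α) (-H.β) := by
  have ha := H.a_ne_zero
  have e1 : (1 : ℂ) - 0 ≠ 0 := by simp
  have e2 : 1 - H.a * 0 ≠ 0 := by simp
  have e3 : H.α * H.β - H.q * 0 ≠ 0 := by simpa using hαβ
  have e4 : (1 - 0) * (1 - H.a * 0) ≠ 0 := mul_ne_zero e1 e2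
  have hev : ∀ᶠ t in 𝓝[≠] (0 : ℂ), t ≠ 0 ∧ 1 - t ≠ 0 ∧ 1 - H.a * t ≠ 0 ∧
      H.α * H.β - H.q * t ≠ 0 := by
    have h1 : ∀ᶠ t in 𝓝 (0 : ℂ), 1 - t ≠ 0 :=
      (show ContinuousAt (fun t : ℂ => 1 - t) 0 by fun_prop).eventually_ne e1
    have h2 : ∀ᶠ t in 𝓝 (0 : ℂ), 1 - H.a * t ≠ 0 :=
      (show ContinuousAt (fun t : ℂ => 1 - H.a * t) 0 by fun_prop).eventually_ne e2
    have h3 : ∀ᶠ t in 𝓝 (0 : ℂ), H.α * H.β - H.q * t ≠ 0 :=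
      (show ContinuousAt (fun t : ℂ => H.α * H.β - H.q * t) 0 by fun_prop).eventually_ne e3
    filter_upwards [eventually_punctured_ne 0 0, eventually_nhdsWithin_of_eventually_nhds h1,
      eventually_nhdsWithin_of_eventually_nhds h2, eventually_nhdsWithin_of_eventually_nhds h3]
      with t a b c d using ⟨a, b, c, d⟩
  have hsub : ∀ t b : ℂ, t ≠ 0 → 1 / t - b = (1 - b * t) / t := fun t b h => by field_simp
  have hsub' : ∀ t : ℂ, t ≠ 0 →
      H.α * H.β * (1 / t) - H.q = (H.α * H.β - H.q * t) / t := fun t h => by field_simp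
  have hQ : (fun t => (t - 0) ^ 2 * (H.Q (1 / t) / t ^ 4)) =ᶠ[𝓝[≠] 0]
      fun t => (H.α * H.β - H.q * t) / ((1 - t) * (1 - H.a * t)) := by
    filter_upwards [hev] with t ⟨h0, h1, ha, hq⟩
    simp only [Q, hsub _ _ h0, hsub' _ h0, one_mul]; field_simp; ring
  refine IsRegularSingularPoint.of_eventuallyEq
    (P₀ := fun t => 2 - ((1 - H.γ) + (1 - H.δ) / (1 - t) + (1 - H.ε) / (1 - H.a * t)
      - H.α * H.β / (H.α * H.β - H.q * t)))
    ?_ (Q₀ := fun t => (H.α * H.β - H.q * t) / ((1 - t) * (1 - H.a * t))) ?_ ?_ hQ ?_ (by simp)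
    two_ne_zero (R := fun t => (H.α * H.β - H.q * t) / ((1 - t) * (1 - H.a * t)))
    ?_ ?_ (Or.inr hQ)
  · fun_prop (disch := assumption)
  · fun_prop (disch := assumption)
  · filter_upwards [hev] with t ⟨h0, h1, ha, hq⟩
    simp only [derivP, hsub _ _ h0, hsub' _ h0, one_mul]; field_simp; ring
  · simp only [mul_zero, sub_zero, div_one, div_self hαβ]
    linear_combination H.fuchs
  · fun_prop (disch := assumption)
  · exact div_ne_zero e3 e4

/-- If αβ = 0 the extra term is zero, and parameters with product 0 satisfy the Fuchs relation.
Otherwise z₀ is one of 0, 1, a; the extra term lowers that residue by 1, and (-α, -β) keeps the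
product. -/
theorem exists_heun_of_exceptional (H : HeunParams)
    (h : H.α * H.β = 0 ∨ H.q = 0 ∨ H.q = H.α * H.β ∨ H.q = H.a * (H.α * H.β)) :
    ∃ H' : HeunParams, H'.a = H.a ∧
      ∀ z : ℂ, z ≠ 0 → z ≠ 1 → z ≠ H.a → H.α * H.β * z ≠ H.q →
        H.derivP z = H'.P z ∧ H.Q z = H'.Q z := by
  by_cases h0 : H.α * H.β = 0
  · refine ⟨⟨H.a, H.q, 0, 1 - H.α - H.β, 1 - H.γ, 1 - H.δ, 1 - H.ε, H.a_ne_zero, H.a_ne_one,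
      by linear_combination -H.fuchs⟩, rfl, fun z _ _ _ _ => ?_⟩
    simp [derivP, P, Q, h0]
  · have key : ∀ e z : ℂ, H.q = e * (H.α * H.β) → H.α * H.β * z ≠ H.q →
        H.α * H.β / (H.α * H.β * z - H.q) = 1 / (z - e) := by
      intro e z he hz
      have hze : z - e ≠ 0 := fun h => hz (by rw [he]; linear_combination H.α * H.β * h)
      rw [he, div_eq_div_iff (fun h => hz (by rw [he]; linear_combination h)) hze]
      ring
    rcases h.resolve_left h0 with h | h | h
    · refine ⟨⟨H.a, H.q, -H.α, -H.β, -H.γ, 1 - H.δ, 1 - H.ε, H.a_ne_zero, H.a_ne_one,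
        by linear_combination -H.fuchs⟩, rfl, fun z h0 h1 ha hz => ⟨?_, by simp [Q]⟩⟩
      simp only [derivP, P, key 0 z (by simp [h]) hz, sub_zero]
      ring
    · refine ⟨⟨H.a, H.q, -H.α, -H.β, 1 - H.γ, -H.δ, 1 - H.ε, H.a_ne_zero, H.a_ne_one,
        by linear_combination -H.fuchs⟩, rfl, fun z h0 h1 ha hz => ⟨?_, by simp [Q]⟩⟩
      simp only [derivP, P, key 1 z (by simp [h]) hz]
      ring
    · refine ⟨⟨H.a, H.q, -H.α, -H.β, 1 - H.γ, 1 - H.δ, -H.ε, H.a_ne_zero, H.a_ne_one,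
        by linear_combination -H.fuchs⟩, rfl, fun z h0 h1 ha hz => ⟨?_, by simp [Q]⟩⟩
      simp only [derivP, P, key H.a z h hz]
      ring

end HeunParams


/-! ### Power series indexed by arbitrary families of monomials -/

/-- The series `∑ c i * z ^ d i` converges absolutely for `|z| < R`. -/
def ConvergesInBall {ι : Type*} (c : ι → ℂ) (d : ι → ℕ) (R : ℝ) : Prop :=
  ∀ r : ℝ, 0 ≤ r → r < R → Summable fun i => ‖c i‖ * r ^ d i

/-- Only finitely many n have |s + n| < 1. The uniform bound keeps the denominators s + d i
harmless. -/
theorem exists_pos_le_norm_add_natCast {s : ℂ} (hs : ∀ n : ℕ, s + n ≠ 0) :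
    ∃ η : ℝ, 0 < η ∧ ∀ n : ℕ, η ≤ ‖s + n‖ := by
  obtain ⟨N, hN⟩ := exists_nat_gt (‖s‖ + 1)
  obtain ⟨m, -, hm⟩ := Finset.exists_min_image (Finset.range (N + 1)) (fun n : ℕ => ‖s + n‖)
    ⟨0, by simp⟩
  refine ⟨min 1 ‖s + m‖, lt_min one_pos (norm_pos_iff.2 (hs m)), fun n => ?_⟩
  by_cases hn : n < N + 1
  · exact (min_le_right _ _).trans (hm n (Finset.mem_range.2 hn))
  · refine (min_le_left _ _).trans ?_
    have h1 : (N : ℝ) ≤ n := by exact_mod_cast (by omega : N ≤ n)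
    have h2 : ‖(n : ℂ)‖ ≤ ‖s + n‖ + ‖s‖ := by
      simpa [add_comm] using norm_sub_le (s + n) s
    rw [Complex.norm_natCast] at h2
    linarith

namespace ConvergesInBall

variable {ι κ : Type*} {c : ι → ℂ} {d : ι → ℕ} {c' : κ → ℂ} {d' : κ → ℕ} {R : ℝ}

theorem summable_norm (h : ConvergesInBall c d R) {z : ℂ} (hz : ‖z‖ < R) :
    Summable fun i => ‖c i * z ^ d i‖ := by
  simpa using h ‖z‖ (norm_nonneg z) hz

theorem summable (h : ConvergesInBall c d R) {z : ℂ} (hz : ‖z‖ < R) :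
    Summable fun i => c i * z ^ d i := (h.summable_norm hz).of_norm

theorem of_norm_le (h : ConvergesInBall c d R) {e : ι → ℂ} {K : ℝ} (he : ∀ i, ‖e i‖ ≤ K * ‖c i‖) :
    ConvergesInBall e d R := fun r h0 hr => by
  refine Summable.of_nonneg_of_le (fun i => by positivity) (fun i => ?_) ((h r h0 hr).mul_left K)
  rw [← mul_assoc]
  exact mul_le_mul_of_nonneg_right (he i) (by positivity)

theorem div_add (h : ConvergesInBall c d R) {s : ℂ} (hs : ∀ n : ℕ, s + n ≠ 0) :
    ConvergesInBall (fun i => c i / (s + d i)) d R := by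
  obtain ⟨η, h0, hη⟩ := exists_pos_le_norm_add_natCast hs
  refine h.of_norm_le (K := η⁻¹) fun i => ?_
  rw [norm_div, div_eq_inv_mul]
  exact mul_le_mul_of_nonneg_right (inv_anti₀ h0 (hη _)) (norm_nonneg _)

theorem mul (h : ConvergesInBall c d R) (h' : ConvergesInBall c' d' R) :
    ConvergesInBall (fun k : ι × κ => c k.1 * c' k.2) (fun k => d k.1 + d' k.2) R :=
  fun r h0 hr => by
  refine ((h r h0 hr).mul_of_nonneg (h' r h0 hr) (fun i => by positivity)
    (fun i => by positivity)).congr fun k => ?_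
  rw [norm_mul, pow_add]; ring

theorem tsum_mul (h : ConvergesInBall c d R) (h' : ConvergesInBall c' d' R) {z : ℂ}
    (hz : ‖z‖ < R) : ∑' k : ι × κ, c k.1 * c' k.2 * z ^ (d k.1 + d' k.2) =
      (∑' i, c i * z ^ d i) * ∑' i, c' i * z ^ d' i := by
  rw [tsum_mul_tsum_of_summable_norm (h.summable_norm hz) (h'.summable_norm hz)]
  refine tsum_congr fun k => ?_
  rw [pow_add]; ring

/-- The derivative enters through the Euler operator z d/dz, which multiplies each monomial by its
degree and avoids the exponent d i - 1. -/
theorem hasDerivAt (h : ConvergesInBall c d R) {z : ℂ} (hz : ‖z‖ < R) :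
    ∃ D : ℂ, HasDerivAt (fun w => ∑' i, c i * w ^ d i) D z ∧
      HasSum (fun i => d i * (c i * z ^ d i)) (z * D) := by
  obtain ⟨r, h1, h2⟩ := exists_between hz
  have hz' : z ∈ Metric.ball (0 : ℂ) r := by simpa using h1
  have hs := h r ((norm_nonneg z).trans h1.le) h2
  have hd : ∀ i, DifferentiableOn ℂ (fun w => c i * w ^ d i) (Metric.ball 0 r) := fun i => by
    fun_prop
  have hle : ∀ i, ∀ w ∈ Metric.ball (0 : ℂ) r, ‖c i * w ^ d i‖ ≤ ‖c i‖ * r ^ d i := by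
    intro i w hw
    rw [norm_mul, norm_pow]
    have : ‖w‖ ≤ r := by simpa using (Metric.mem_ball.1 hw).le
    gcongr
  refine ⟨_, ((Complex.differentiableOn_tsum_of_summable_norm hs hd Metric.isOpen_ball
    hle).differentiableAt (Metric.isOpen_ball.mem_nhds hz')).hasDerivAt, ?_⟩
  refine ((Complex.hasSum_deriv_of_summable_norm hs hd Metric.isOpen_ball hle hz').mul_left
    z).congr_fun fun i => ?_
  have : deriv (fun w => c i * w ^ d i) z = c i * (d i * z ^ (d i - 1)) := by simp
  rw [this]
  rcases Nat.eq_zero_or_pos (d i) with h0 | h0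
  · simp [h0]
  · obtain ⟨m, hm⟩ := Nat.exists_eq_succ_of_ne_zero h0.ne'
    rw [hm, Nat.succ_sub_one, pow_succ]; ring

/-- Division of the coefficients by s + d i inverts the operator z d/dz + s. -/
theorem hasDerivAt_div_add (h : ConvergesInBall c d R) {s : ℂ} (hs : ∀ n : ℕ, s + n ≠ 0) {z : ℂ}
    (hz : ‖z‖ < R) :
    ∃ D : ℂ, HasDerivAt (fun w => ∑' i, c i / (s + d i) * w ^ d i) D z ∧
      z * D + s * ∑' i, c i / (s + d i) * z ^ d i = ∑' i, c i * z ^ d i := by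
  obtain ⟨D, hD, hsum⟩ := (h.div_add hs).hasDerivAt hz
  refine ⟨D, hD, ?_⟩
  refine ((hsum.add (((h.div_add hs).summable hz).hasSum.mul_left s)).congr_fun
    fun i => ?_).tsum_eq.symm
  have := hs (d i)
  field_simp
  ring

/-- `z ^ s * ∑ c i / (s + d i) * z ^ d i` is an indefinite integral of
`z ^ (s - 1) * ∑ c i * z ^ d i`. -/
theorem hasDerivAt_exp_mul (h : ConvergesInBall c d R) {s : ℂ} (hs : ∀ n : ℕ, s + n ≠ 0) {z : ℂ}
    (hz : ‖z‖ < R) (h0 : z ≠ 0) {ℓ : ℂ → ℂ} (hℓ : HasDerivAt ℓ z⁻¹ z) :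
    HasDerivAt (fun w => Complex.exp (s * ℓ w) * ∑' i, c i / (s + d i) * w ^ d i)
      (Complex.exp (s * ℓ z) / z * ∑' i, c i * z ^ d i) z := by
  obtain ⟨D, hD, hsum⟩ := h.hasDerivAt_div_add hs hz
  refine ((hℓ.const_mul s).cexp.mul hD).congr_deriv ?_
  rw [← hsum]
  field_simp
  ring

/-- On the segment the integrand is u^(s-1) times a continuous function, hence integrable as Re s >
0. The fundamental theorem on the open interval then needs only the two endpoint limits. -/
theorem hasSegmentIntegral (h : ConvergesInBall c d R) {s : ℂ} (hs : 0 < s.re) {z l : ℂ}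
    (hz : ‖z‖ < R) (hl : Complex.exp l = z) {f : ℂ → ℂ → ℂ}
    (hf : ∀ u : ℝ, 0 < u → u ≤ 1 → f ((Real.log u : ℂ) + l) (u * z) =
      Complex.exp (s * ((Real.log u : ℂ) + l)) / (u * z) * ∑' i, c i * (u * z) ^ d i) :
    HasSegmentIntegral f l z (Complex.exp (s * l) * ∑' i, c i / (s + d i) * z ^ d i) := by
  have hs' : ∀ n : ℕ, s + n ≠ 0 := fun n hn => by
    have := congrArg Complex.re hn
    simp at this
    have : (0 : ℝ) ≤ n := Nat.cast_nonneg n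
    linarith
  have h0 : z ≠ 0 := hl ▸ Complex.exp_ne_zero l
  have hball : ∀ u : ℝ, 0 ≤ u → u ≤ 1 → ‖(u : ℂ) * z‖ < R := fun u hu hu1 => by
    rw [norm_mul, Complex.norm_real, Real.norm_of_nonneg hu]
    nlinarith [norm_nonneg z]
  have hpow : ∀ u : ℝ, 0 < u → Complex.exp (s * ((Real.log u : ℂ) + l)) =
      Complex.exp (s * l) * (u : ℂ) ^ s := fun u hu => by
    rw [Complex.cpow_def_of_ne_zero (by exact_mod_cast hu.ne'), ← Complex.ofReal_log hu.le,
      ← Complex.exp_add]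
    ring_nf
  have hint : IntervalIntegrable (fun u : ℝ => f ((Real.log u : ℂ) + l) (u * z) * z)
      MeasureTheory.volume 0 1 := by
    have hc : ContinuousOn (fun u : ℝ => Complex.exp (s * l) * ∑' i, c i * ((u : ℂ) * z) ^ d i)
        (Set.uIcc 0 1) := by
      intro u hu
      rw [Set.uIcc_of_le zero_le_one] at hu
      obtain ⟨D, hD, -⟩ := h.hasDerivAt (hball u hu.1 hu.2)
      have h1 : ContinuousAt (fun u : ℝ => (u : ℂ) * z) u := by fun_prop
      exact (continuousAt_const.mul (hD.continuousAt.comp_of_eq h1 rfl)).continuousWithinAt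
    refine ((intervalIntegral.intervalIntegrable_cpow' (r := s - 1) (a := 0) (b := 1)
      (by simpa using hs)).mul_continuousOn hc).congr ?_
    intro u hu
    rw [Set.uIoc_of_le zero_le_one] at hu
    have hu' : (u : ℂ) ≠ 0 := by exact_mod_cast hu.1.ne'
    simp only [hf u hu.1 hu.2, hpow u hu.1, Complex.cpow_sub _ _ hu', Complex.cpow_one]
    field_simp
  refine ⟨hint, ?_⟩
  have hderiv : ∀ u ∈ Set.Ioo (0 : ℝ) 1, HasDerivAt (fun u : ℝ =>
      Complex.exp (s * ((Real.log u : ℂ) + l)) * ∑' i, c i / (s + d i) * ((u : ℂ) * z) ^ d i)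
      (f ((Real.log u : ℂ) + l) (u * z) * z) u := by
    intro u hu
    obtain ⟨D, hD, hsum⟩ := h.hasDerivAt_div_add hs' (hball u hu.1.le hu.2.le)
    have h1 : HasDerivAt (fun u : ℝ => (u : ℂ) * z) z u := by
      simpa using (Complex.ofRealCLM.hasDerivAt (x := u)).mul_const z
    have h2 : HasDerivAt (fun u : ℝ => (Real.log u : ℂ)) ((u⁻¹ : ℝ) : ℂ) u :=
      (Real.hasDerivAt_log hu.1.ne').ofReal_comp
    have h3 := (((h2.add_const l).const_mul s).cexp).mul (hD.scomp u h1)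
    refine h3.congr_deriv ?_
    rw [hf u hu.1 hu.2.le, ← hsum]
    have hu' : (u : ℂ) ≠ 0 := by exact_mod_cast hu.1.ne'
    simp only [Function.comp, smul_eq_mul, Complex.ofReal_inv]
    field_simp
    ring
  have hG0 : ContinuousAt (fun u : ℝ => ∑' i, c i / (s + d i) * ((u : ℂ) * z) ^ d i) 0 := by
    obtain ⟨D, hD, -⟩ := (h.div_add hs').hasDerivAt (hball 0 le_rfl zero_le_one)
    exact hD.continuousAt.comp_of_eq (f := fun u : ℝ => (u : ℂ) * z) (by fun_prop) rfl
  have hG1 : ContinuousAt (fun u : ℝ => ∑' i, c i / (s + d i) * ((u : ℂ) * z) ^ d i) 1 := by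
    obtain ⟨D, hD, -⟩ := (h.div_add hs').hasDerivAt (hball 1 zero_le_one le_rfl)
    exact hD.continuousAt.comp_of_eq (f := fun u : ℝ => (u : ℂ) * z) (by fun_prop) rfl
  -- Since `Real.log 0 = 0`, the primitive as written has a wrong value at u = 0; only its one-sided
  -- limit is used, and u^s tends to 0.
  have ht0 : Tendsto (fun u : ℝ =>
      Complex.exp (s * ((Real.log u : ℂ) + l)) * ∑' i, c i / (s + d i) * ((u : ℂ) * z) ^ d i)
      (𝓝[>] 0) (𝓝 0) := by
    have h1 : Tendsto (fun u : ℝ => Complex.exp (s * l) * (u : ℂ) ^ s *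
        ∑' i, c i / (s + d i) * ((u : ℂ) * z) ^ d i) (𝓝 0) (𝓝 (Complex.exp (s * l) *
          ((0 : ℝ) : ℂ) ^ s * ∑' i, c i / (s + d i) * (((0 : ℝ) : ℂ) * z) ^ d i)) := by
      have := Complex.continuousAt_ofReal_cpow_const 0 s (Or.inl hs)
      exact (continuousAt_const.mul this).mul hG0
    rw [Complex.ofReal_zero, Complex.zero_cpow (by rintro rfl; simp at hs), mul_zero,
      zero_mul] at h1
    refine (h1.mono_left nhdsWithin_le_nhds).congr' ?_
    filter_upwards [self_mem_nhdsWithin] with u hu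
    rw [hpow u hu]
  have ht1 : Tendsto (fun u : ℝ =>
      Complex.exp (s * ((Real.log u : ℂ) + l)) * ∑' i, c i / (s + d i) * ((u : ℂ) * z) ^ d i)
      (𝓝[<] 1) (𝓝 (Complex.exp (s * l) * ∑' i, c i / (s + d i) * z ^ d i)) := by
    have h2 : ContinuousAt (fun u : ℝ => Complex.exp (s * ((Real.log u : ℂ) + l))) 1 := by
      have := (Real.continuousAt_log one_ne_zero)
      fun_prop
    have h3 := (h2.mul hG1).tendsto
    simp only [Pi.mul_apply, Real.log_one, Complex.ofReal_zero, Complex.ofReal_one, zero_add,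
      one_mul] at h3
    exact h3.mono_left nhdsWithin_le_nhds
  rw [intervalIntegral.integral_eq_sub_of_hasDerivAt_of_tendsto zero_lt_one hderiv hint ht0 ht1,
    sub_zero]

end ConvergesInBall


/-! ### The hypergeometric functions of Appell and Lauricella -/

/-- The coefficient `(b)_n / n!` of the binomial series of `(1 - x) ^ (-b)`. -/
noncomputable def binomialCoeff (b : ℂ) (n : ℕ) : ℂ := (ascPochhammer ℂ n).eval b / n.factorial

theorem hasSum_binomialCoeff (b : ℂ) {x : ℂ} (hx : ‖x‖ < 1) :
    HasSum (fun n => binomialCoeff b n * x ^ n) (Complex.exp (-b * Complex.log (1 - x))) := by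
  have h := (Complex.one_div_one_sub_cpow_hasFPowerSeriesOnBall_zero b).hasSum
    (y := x) (by simpa [enorm_eq_nnnorm, ← NNReal.coe_lt_one] using hx)
  have hx1 : 1 - x ≠ 0 := fun h => by
    rw [← sub_eq_zero.1 h] at hx
    simp at hx
  have e : Complex.exp (-b * Complex.log (1 - x)) = 1 / (1 - (0 + x)) ^ b := by
    rw [zero_add, Complex.cpow_def_of_ne_zero hx1, one_div, ← Complex.exp_neg]
    ring_nf
  rw [e]
  refine h.congr_fun fun n => ?_
  have h2 : Ring.choose (b + n - 1) n = binomialCoeff b n := by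
    have h3 := Ring.factorial_nsmul_multichoose_eq_ascPochhammer b n
    rw [Ring.multichoose_eq, nsmul_eq_mul] at h3
    rw [binomialCoeff, eq_div_iff (by exact_mod_cast n.factorial_ne_zero), mul_comm, h3,
      Polynomial.ascPochhammer_smeval_eq_eval]
  simp [FormalMultilinearSeries.ofScalars, h2]

/-- The series terminates, so x is unrestricted. This is essential for the argument z/z₀, which need
not lie in the unit disc. -/
theorem hasSum_binomialCoeff_neg (N : ℕ) (x : ℂ) :
    HasSum (fun n => binomialCoeff (-N) n * x ^ n) ((1 - x) ^ N) := by
  have h0 : ∀ n, binomialCoeff (-N) n = (-1) ^ n * (N.choose n : ℂ) := fun n => by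
    rw [binomialCoeff, div_eq_iff (by exact_mod_cast n.factorial_ne_zero),
      ascPochhammer_eval_neg_eq_descPochhammer, descPochhammer_eval_eq_descFactorial,
      Nat.descFactorial_eq_factorial_mul_choose]
    push_cast; ring
  have h1 : (1 - x) ^ N = ∑ n ∈ Finset.range (N + 1), binomialCoeff (-N) n * x ^ n := by
    rw [sub_eq_neg_add, add_pow]
    refine Finset.sum_congr rfl fun n _ => ?_
    rw [h0, one_pow, mul_one, neg_pow]; ring
  rw [h1]
  refine hasSum_sum_of_ne_finset_zero fun n hn => ?_
  rw [h0, Nat.choose_eq_zero_of_lt (by simpa using hn)]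
  simp

theorem convergesInBall_of_summable {c : ℕ → ℂ} {R : ℝ}
    (h : ∀ r : ℝ, 0 ≤ r → r < R → Summable fun n => c n * (r : ℂ) ^ n) :
    ConvergesInBall c (fun n => n) R := fun r h0 hr => by
  refine (h r h0 hr).norm.congr fun n => ?_
  rw [norm_mul, norm_pow, Complex.norm_real, Real.norm_of_nonneg h0]

theorem convergesInBall_binomialCoeff (b : ℂ) {e : ℂ} {R : ℝ} (hR : R ≤ ‖e‖) :
    ConvergesInBall (fun n => binomialCoeff b n * (1 / e) ^ n) (fun n => n) R :=
  convergesInBall_of_summable fun r h0 hr => by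
    have he : 0 < ‖e‖ := (h0.trans_lt hr).trans_le hR
    have : ‖(r : ℂ) / e‖ < 1 := by
      rw [norm_div, Complex.norm_real, Real.norm_of_nonneg h0, div_lt_one he]
      exact hr.trans_le hR
    refine (hasSum_binomialCoeff b this).summable.congr fun n => ?_
    rw [div_eq_mul_one_div, mul_pow]; ring

theorem tsum_binomialCoeff (b : ℂ) {e z : ℂ} (hz : ‖z‖ < ‖e‖) :
    ∑' n, binomialCoeff b n * (1 / e) ^ n * z ^ n =
      Complex.exp (-b * Complex.log (1 - z / e)) := by
  have : ‖z / e‖ < 1 := by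
    rw [norm_div, div_lt_one ((norm_nonneg z).trans_lt hz)]; exact hz
  rw [← (hasSum_binomialCoeff b this).tsum_eq]
  refine tsum_congr fun n => ?_
  rw [div_eq_mul_one_div z, mul_pow]; ring

theorem convergesInBall_binomialCoeff_neg (N : ℕ) (e : ℂ) (R : ℝ) :
    ConvergesInBall (fun n => binomialCoeff (-N) n * (1 / e) ^ n) (fun n => n) R :=
  convergesInBall_of_summable fun r _ _ => by
    refine (hasSum_binomialCoeff_neg N (r / e)).summable.congr fun n => ?_
    rw [div_eq_mul_one_div, mul_pow]; ring

theorem tsum_binomialCoeff_neg (N : ℕ) (e z : ℂ) :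
    ∑' n, binomialCoeff (-N) n * (1 / e) ^ n * z ^ n = (1 - z / e) ^ N := by
  rw [← (hasSum_binomialCoeff_neg N (z / e)).tsum_eq]
  refine tsum_congr fun n => ?_
  rw [div_eq_mul_one_div z, mul_pow]; ring

/-- Both s (1+s)_n and (s)_n (s+n) equal (s)_(n+1). -/
theorem ascPochhammer_eval_div {s : ℂ} (hs : ∀ n : ℕ, s + n ≠ 0) (n : ℕ) :
    (ascPochhammer ℂ n).eval s / (ascPochhammer ℂ n).eval (1 + s) = s / (s + n) := by
  have h1 := ascPochhammer_succ_eval (S := ℂ) n s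
  rw [ascPochhammer_succ_left, Polynomial.eval_mul, Polynomial.eval_X, Polynomial.eval_comp,
    Polynomial.eval_add, Polynomial.eval_X, Polynomial.eval_one, add_comm s 1] at h1
  have h2 : (ascPochhammer ℂ n).eval (1 + s) ≠ 0 := by
    rw [Ne, ascPochhammer_eval_eq_zero_iff]
    rintro ⟨k, -, hk⟩
    exact hs (k + 1) (by push_cast; rw [hk]; ring)
  rw [div_eq_div_iff h2 (hs n), h1]

/-- The coefficients of `(1 - x) ^ (-b) * (1 - x / e) ^ (-b')`. -/
noncomputable def appellCoeff (b b' e₁ e₂ : ℂ) (k : ℕ × ℕ) : ℂ :=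
  binomialCoeff b k.1 * (1 / e₁) ^ k.1 * (binomialCoeff b' k.2 * (1 / e₂) ^ k.2)

/-- The coefficients of `(1 - x / e₁) ^ (-b₁) * (1 - x / e₂) ^ (-b₂) * (1 - x / e₃) ^ (-b₃)`. -/
noncomputable def lauricellaCoeff (b₁ b₂ b₃ e₁ e₂ e₃ : ℂ) (k : ℕ × ℕ × ℕ) : ℂ :=
  binomialCoeff b₁ k.1 * (1 / e₁) ^ k.1 * appellCoeff b₂ b₃ e₂ e₃ k.2

/-- The Pochhammer quotient depends only on the total degree, so it becomes the factor s/(s+n)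
produced by integration. -/
theorem appellF1_eq_tsum (b b' e₁ e₂ z : ℂ) {s : ℂ} (hs : ∀ n : ℕ, s + n ≠ 0) :
    appellF1 s b b' (1 + s) (z / e₁) (z / e₂) = s * ∑' k : ℕ × ℕ, appellCoeff b b' e₁ e₂ k /
      (s + ((k.1 + k.2 : ℕ) : ℂ)) * z ^ (k.1 + k.2) := by
  rw [appellF1, ← tsum_mul_left]
  refine tsum_congr fun k => ?_
  have h := ascPochhammer_eval_div hs (k.1 + k.2)
  calc _ = (ascPochhammer ℂ (k.1 + k.2)).eval s / (ascPochhammer ℂ (k.1 + k.2)).eval (1 + s) *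
        (binomialCoeff b k.1 * binomialCoeff b' k.2 * ((z / e₁) ^ k.1 * (z / e₂) ^ k.2)) := by
        simp only [binomialCoeff, div_eq_mul_inv, mul_inv]; ring
    _ = _ := by
        rw [h, appellCoeff, div_eq_mul_one_div z e₁, div_eq_mul_one_div z e₂, mul_pow, mul_pow,
          pow_add]
        ring

theorem lauricellaFD_eq_tsum (b₁ b₂ b₃ e₁ e₂ e₃ z : ℂ) {s : ℂ} (hs : ∀ n : ℕ, s + n ≠ 0) :
    lauricellaFD s b₁ b₂ b₃ (1 + s) (z / e₁) (z / e₂) (z / e₃) =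
      s * ∑' k : ℕ × ℕ × ℕ, lauricellaCoeff b₁ b₂ b₃ e₁ e₂ e₃ k /
        (s + ((k.1 + (k.2.1 + k.2.2) : ℕ) : ℂ)) * z ^ (k.1 + (k.2.1 + k.2.2)) := by
  rw [lauricellaFD, ← tsum_mul_left]
  refine tsum_congr fun k => ?_
  have h := ascPochhammer_eval_div hs (k.1 + (k.2.1 + k.2.2))
  rw [add_assoc k.1]
  calc _ = (ascPochhammer ℂ (k.1 + (k.2.1 + k.2.2))).eval s /
        (ascPochhammer ℂ (k.1 + (k.2.1 + k.2.2))).eval (1 + s) *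
        (binomialCoeff b₁ k.1 * binomialCoeff b₂ k.2.1 * binomialCoeff b₃ k.2.2 *
          ((z / e₁) ^ k.1 * (z / e₂) ^ k.2.1 * (z / e₃) ^ k.2.2)) := by
        simp only [binomialCoeff, div_eq_mul_inv, mul_inv]; ring
    _ = _ := by
        rw [h, lauricellaCoeff, appellCoeff, div_eq_mul_one_div z e₁, div_eq_mul_one_div z e₂,
          div_eq_mul_one_div z e₃, mul_pow, mul_pow, mul_pow, pow_add, pow_add]
        ring

/-- For `b₂ = 0` the Lauricella function reduces to an Appell function. -/
theorem lauricellaFD_zero_mid (A b₁ b₃ c x₁ x₂ x₃ : ℂ) :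
    lauricellaFD A b₁ 0 b₃ c x₁ x₂ x₃ = appellF1 A b₁ b₃ c x₁ x₃ := by
  rw [lauricellaFD, appellF1]
  have hinj : Function.Injective (fun k : ℕ × ℕ => ((k.1, 0, k.2) : ℕ × ℕ × ℕ)) := by
    rintro ⟨i, j⟩ ⟨i', j'⟩ h
    simpa using h
  rw [← hinj.tsum_eq]
  · refine tsum_congr fun k => ?_
    simp
  · rintro ⟨i, j, k⟩ h
    rcases Nat.eq_zero_or_pos j with rfl | hj
    · exact ⟨(i, k), rfl⟩
    · exfalso
      apply h
      simp [ascPochhammer_ne_zero_eval_zero ℂ hj.ne']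


theorem convergesInBall_appellCoeff (b b' : ℂ) {e₁ e₂ : ℂ} {R : ℝ} (h₁ : R ≤ ‖e₁‖)
    (h₂ : R ≤ ‖e₂‖) :
    ConvergesInBall (appellCoeff b b' e₁ e₂) (fun k => k.1 + k.2) R := by
  have h := (convergesInBall_binomialCoeff b h₁).mul (convergesInBall_binomialCoeff b' h₂)
  exact h

theorem tsum_appellCoeff (b b' : ℂ) {e₁ e₂ z : ℂ} (h₁ : ‖z‖ < ‖e₁‖) (h₂ : ‖z‖ < ‖e₂‖) :
    ∑' k : ℕ × ℕ, appellCoeff b b' e₁ e₂ k * z ^ (k.1 + k.2) =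
      Complex.exp (-b * Complex.log (1 - z / e₁)) * Complex.exp (-b' * Complex.log (1 - z / e₂)) := by
  rw [← tsum_binomialCoeff b h₁, ← tsum_binomialCoeff b' h₂]
  exact (convergesInBall_binomialCoeff b (min_le_left ‖e₁‖ ‖e₂‖)).tsum_mul
    (convergesInBall_binomialCoeff b' (min_le_right ‖e₁‖ ‖e₂‖)) (lt_min h₁ h₂)

theorem convergesInBall_lauricellaCoeff (b b' : ℂ) (N : ℕ) {e₁ e₂ : ℂ} (e₃ : ℂ) {R : ℝ}
    (h₁ : R ≤ ‖e₁‖) (h₂ : R ≤ ‖e₂‖) :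
    ConvergesInBall (lauricellaCoeff b b' (-N) e₁ e₂ e₃) (fun k => k.1 + (k.2.1 + k.2.2)) R := by
  have h := (convergesInBall_binomialCoeff b h₁).mul
    ((convergesInBall_binomialCoeff b' h₂).mul (convergesInBall_binomialCoeff_neg N e₃ R))
  exact h

theorem tsum_lauricellaCoeff (b b' : ℂ) (N : ℕ) {e₁ e₂ : ℂ} (e₃ : ℂ) {z : ℂ} (h₁ : ‖z‖ < ‖e₁‖)
    (h₂ : ‖z‖ < ‖e₂‖) :
    ∑' k : ℕ × ℕ × ℕ, lauricellaCoeff b b' (-N) e₁ e₂ e₃ k * z ^ (k.1 + (k.2.1 + k.2.2)) =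
      Complex.exp (-b * Complex.log (1 - z / e₁)) *
        (Complex.exp (-b' * Complex.log (1 - z / e₂)) * (1 - z / e₃) ^ N) := by
  rw [← tsum_binomialCoeff b h₁, ← tsum_binomialCoeff b' h₂, ← tsum_binomialCoeff_neg N e₃ z]
  have H₁ := convergesInBall_binomialCoeff b (min_le_left ‖e₁‖ ‖e₂‖)
  have H₂ := convergesInBall_binomialCoeff b' (min_le_right ‖e₁‖ ‖e₂‖)
  have H₃ := convergesInBall_binomialCoeff_neg N e₃ (min ‖e₁‖ ‖e₂‖)
  have hz := lt_min h₁ h₂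
  rw [← H₂.tsum_mul H₃ hz, ← H₁.tsum_mul (H₂.mul H₃) hz]
  rfl

/-- In `U`, the function `Y (ℓ z) z` is an indefinite integral of `f (ℓ z) z`; if moreover
`0 < σ`, then `Y l z` is the integral of `f` over the segment from `0` to `z`. -/
def IntegratesTo (R σ : ℝ) (f Y : ℂ → ℂ → ℂ) : Prop :=
  (∀ (U : Set ℂ) (ℓ : ℂ → ℂ), IsOpen U → U ⊆ Metric.ball 0 R → IsLogBranch 0 U ℓ →
    ∀ z ∈ U, HasDerivAt (fun w => Y (ℓ w) w) (f (ℓ z) z) z) ∧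
  (0 < σ → ∀ l z : ℂ, Complex.exp l = z → ‖z‖ < R → HasSegmentIntegral f l z (Y l z))

/-- The common mechanism at all four centres: it remains only to match the closed form and the
integrand with one power series, the constant K holding the powers of -1, -a and -z₀. -/
theorem ConvergesInBall.integratesTo {ι : Type*} {c : ι → ℂ} {d : ι → ℕ} {R : ℝ}
    (h : ConvergesInBall c d R) {s K : ℂ} (hs : ∀ n : ℕ, s + n ≠ 0) {f Y : ℂ → ℂ → ℂ}
    (hY : ∀ l z, Y l z = K * (Complex.exp (s * l) * ∑' i, c i / (s + d i) * z ^ d i))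
    (hf : ∀ l z, Complex.exp l = z → ‖z‖ < R →
      f l z = K * (Complex.exp (s * l) / z * ∑' i, c i * z ^ d i)) :
    IntegratesTo R s.re f Y := by
  refine ⟨fun U ℓ hU hUR hℓ z hz => ?_, fun hσ l z hl hz => ?_⟩
  · have h0 : Complex.exp (ℓ z) = z := by simpa using hℓ.2 z hz
    have hzR : ‖z‖ < R := by simpa using hUR hz
    have hd := h.hasDerivAt_exp_mul hs hzR (hℓ.ne hz) (by simpa using hℓ.hasDerivAt hU hz)
    simp only [hY, hf _ _ h0 hzR]
    exact hd.const_mul K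
  · obtain ⟨h1, h2⟩ := h.hasSegmentIntegral hσ hz hl
      (f := fun l z => Complex.exp (s * l) / z * ∑' i, c i * z ^ d i) (fun u _ _ => rfl)
    have e : Set.EqOn
        (fun u : ℝ => K * (Complex.exp (s * ((Real.log u : ℂ) + l)) / ((u : ℂ) * z) *
          (∑' i, c i * ((u : ℂ) * z) ^ d i) * z))
        (fun u : ℝ => f ((Real.log u : ℂ) + l) ((u : ℂ) * z) * z) (Set.uIoc 0 1) := by
      intro u hu
      rw [Set.uIoc_of_le zero_le_one] at hu
      have hexp : Complex.exp ((Real.log u : ℂ) + l) = u * z := by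
        rw [Complex.exp_add, hl, ← Complex.ofReal_exp, Real.exp_log hu.1]
      have hn : ‖(u : ℂ) * z‖ < R := by
        rw [norm_mul, Complex.norm_real, Real.norm_of_nonneg hu.1.le]
        nlinarith [norm_nonneg z, hu.1, hu.2]
      simp only [hf _ _ hexp hn]
      ring
    refine ⟨(h1.const_mul K).congr e, ?_⟩
    rw [hY, ← h2, ← intervalIntegral.integral_const_mul]
    exact (intervalIntegral.integral_congr_ae (Eventually.of_forall fun u hu => e hu)).symm

theorem exp_mul_div_self {s l z : ℂ} (hl : Complex.exp l = z) :
    Complex.exp (s * l) / z = Complex.exp ((s - 1) * l) := by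
  rw [← hl, ← Complex.exp_sub]; ring_nf

theorem Gamma_div_Gamma_add_one {s : ℂ} (hs : ∀ n : ℕ, s + n ≠ 0) :
    Complex.Gamma s / Complex.Gamma (1 + s) = 1 / s := by
  have h0 : s ≠ 0 := by simpa using hs 0
  rw [add_comm, Complex.Gamma_add_one s h0]
  have : Complex.Gamma s ≠ 0 := Complex.Gamma_ne_zero fun m hm => hs m (by rw [hm]; ring)
  field_simp

/-! ### Closed forms of the integrals at the four centres -/

namespace HeunParams

variable (H : HeunParams) {L₁ Lₐ : ℂ}

theorem ρ_le_one : H.ρ ≤ ‖(1 : ℂ)‖ := by simp [ρ]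

theorem ρ_le_norm_a : H.ρ ≤ ‖H.a‖ := min_le_right _ _

theorem ρ_pos : 0 < H.ρ := lt_min one_pos (norm_pos_iff.2 H.a_ne_zero)

theorem exp_log₁ (h₁ : Complex.exp L₁ = -1) {z : ℂ} (hz : ‖z‖ < H.ρ) :
    Complex.exp (H.log₁ L₁ z) = z - 1 := by
  have : 1 - z ≠ 0 := fun h => by
    have := hz.trans_le H.ρ_le_one
    rw [sub_eq_zero.1 h] at this
    exact lt_irrefl _ this
  rw [log₁, Complex.exp_add, Complex.exp_log this, h₁]; ring

theorem exp_logₐ (hₐ : Complex.exp Lₐ = -H.a) {z : ℂ} (hz : ‖z‖ < H.ρ) :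
    Complex.exp (H.logₐ Lₐ z) = z - H.a := by
  have ha := H.a_ne_zero
  have : 1 - z / H.a ≠ 0 := fun h => by
    have h1 : z = H.a := by field_simp at h; linear_combination -h
    have := hz.trans_le H.ρ_le_norm_a
    rw [h1] at this
    exact lt_irrefl _ this
  rw [logₐ, Complex.exp_add, Complex.exp_log this, hₐ]; field_simp; ring

/-- The factor z^(μ+ν) merges with z^(-γ), so the exponent s = 1 - γ + μ + ν moves with ν while δ
and ε stay fixed. -/
theorem integratesTo_zero (μ : ℂ) (ν : ℕ) (hs : ∀ ν : ℕ, 1 - H.γ + μ + ν ≠ 0) :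
    IntegratesTo H.ρ (1 - H.γ + μ + ν).re (H.integrand L₁ Lₐ (H.pre0 μ) 0 ν)
      (H.term0 L₁ Lₐ μ ν) := by
  have hs' : ∀ n : ℕ, 1 - H.γ + μ + ν + n ≠ 0 := fun n => by
    have := hs (ν + n); push_cast at this; rwa [← add_assoc] at this
  have h0 : 1 - H.γ + μ + ν ≠ 0 := hs ν
  refine (convergesInBall_appellCoeff H.δ H.ε H.ρ_le_one H.ρ_le_norm_a).integratesTo
    (K := Complex.exp (-H.δ * L₁) * Complex.exp (-H.ε * Lₐ)) hs' (fun l z => ?_)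
    (fun l z hl hz => ?_)
  · have := appellF1_eq_tsum H.δ H.ε 1 H.a z hs'
    rw [div_one] at this
    rw [term0, this]
    field_simp
  · rw [tsum_appellCoeff _ _ (hz.trans_le H.ρ_le_one) (hz.trans_le H.ρ_le_norm_a), div_one,
      exp_mul_div_self hl, integrand, pre0, localWeight, weight, log₁, logₐ, sub_zero]
    have : z ^ ν = Complex.exp (ν * l) := by rw [Complex.exp_nat_mul, hl]
    rw [this]
    simp only [← Complex.exp_add, ← Complex.exp_sub]
    ring_nf

variable (hγ : ∀ n : ℕ, H.γ ≠ n + 1)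
include hγ

theorem one_sub_γ_add_ne_zero (n : ℕ) : 1 - H.γ + n ≠ 0 := fun h =>
  hγ n (by linear_combination -h)

/-- As the powers of z - 1 are formed with the same logarithm, (z-1)^(μ+ν) merely replaces δ by δ -
μ - ν. The centre a shifts ε instead. -/
theorem integratesTo_one (h₁ : Complex.exp L₁ = -1) (μ : ℂ) (ν : ℕ) :
    IntegratesTo H.ρ (1 - H.γ).re (H.integrand L₁ Lₐ (H.pre1 L₁ μ) 1 ν)
      (H.term1 L₁ Lₐ μ ν) := by
  have hs := H.one_sub_γ_add_ne_zero hγ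
  have h0 : 1 - H.γ ≠ 0 := by simpa using hs 0
  have e : 2 - H.γ = 1 + (1 - H.γ) := by ring
  refine (convergesInBall_appellCoeff (H.δ - μ - ν) H.ε H.ρ_le_one H.ρ_le_norm_a).integratesTo
    (K := Complex.exp ((-H.δ + μ + ν) * L₁) * Complex.exp (-H.ε * Lₐ)) hs (fun l z => ?_)
    (fun l z hl hz => ?_)
  · have := appellF1_eq_tsum (H.δ - μ - ν) H.ε 1 H.a z hs
    rw [div_one] at this
    rw [term1, e, Gamma_div_Gamma_add_one hs, this]
    field_simp
  · rw [tsum_appellCoeff _ _ (hz.trans_le H.ρ_le_one) (hz.trans_le H.ρ_le_norm_a), div_one,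
      exp_mul_div_self hl, integrand, pre1, localWeight, weight]
    have : (z - 1) ^ ν = Complex.exp (ν * H.log₁ L₁ z) := by
      rw [Complex.exp_nat_mul, H.exp_log₁ h₁ hz]
    rw [this, log₁, logₐ]
    simp only [← Complex.exp_add, ← Complex.exp_sub]
    ring_nf

theorem integratesTo_a (hₐ : Complex.exp Lₐ = -H.a) (μ : ℂ) (ν : ℕ) :
    IntegratesTo H.ρ (1 - H.γ).re (H.integrand L₁ Lₐ (H.preA Lₐ μ) H.a ν)
      (H.termA L₁ Lₐ μ ν) := by
  have hs := H.one_sub_γ_add_ne_zero hγ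
  have h0 : 1 - H.γ ≠ 0 := by simpa using hs 0
  have e : 2 - H.γ = 1 + (1 - H.γ) := by ring
  refine (convergesInBall_appellCoeff H.δ (H.ε - μ - ν) H.ρ_le_one H.ρ_le_norm_a).integratesTo
    (K := Complex.exp (-H.δ * L₁) * Complex.exp ((-H.ε + μ + ν) * Lₐ)) hs (fun l z => ?_)
    (fun l z hl hz => ?_)
  · have := appellF1_eq_tsum H.δ (H.ε - μ - ν) 1 H.a z hs
    rw [div_one] at this
    rw [termA, e, Gamma_div_Gamma_add_one hs, this]
    field_simp
  · rw [tsum_appellCoeff _ _ (hz.trans_le H.ρ_le_one) (hz.trans_le H.ρ_le_norm_a), div_one,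
      exp_mul_div_self hl, integrand, preA, localWeight, weight]
    have : (z - H.a) ^ ν = Complex.exp (ν * H.logₐ Lₐ z) := by
      rw [Complex.exp_nat_mul, H.exp_logₐ hₐ hz]
    rw [this, log₁, logₐ]
    simp only [← Complex.exp_add, ← Complex.exp_sub]
    ring_nf

/-- The extra factor is a polynomial, (-z₀)^(2+ν) (1 - z/z₀)^(2+ν), which contributes a third,
terminating binomial series and hence a Lauricella function. -/
theorem integratesTo_z₀ (hz₀ : H.z₀ ≠ 0) (ν : ℕ) :
    IntegratesTo H.ρ (1 - H.γ).re (H.integrand L₁ Lₐ H.preZ H.z₀ ν) (H.termZ L₁ Lₐ ν) := by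
  have hs := H.one_sub_γ_add_ne_zero hγ
  have h0 : 1 - H.γ ≠ 0 := by simpa using hs 0
  have e : 2 - H.γ = 1 + (1 - H.γ) := by ring
  have e' : (-2 - ν : ℂ) = -((2 + ν : ℕ) : ℂ) := by push_cast; ring
  refine (convergesInBall_lauricellaCoeff H.δ H.ε (2 + ν) H.z₀ H.ρ_le_one
    H.ρ_le_norm_a).integratesTo (K := Complex.exp (-H.δ * L₁) * Complex.exp (-H.ε * Lₐ) *
      (-H.z₀) ^ (2 + ν)) hs (fun l z => ?_) (fun l z hl hz => ?_)
  · have := lauricellaFD_eq_tsum H.δ H.ε (-((2 + ν : ℕ) : ℂ)) 1 H.a H.z₀ z hs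
    rw [div_one] at this
    rw [termZ, e, Gamma_div_Gamma_add_one hs, e', this]
    field_simp
  · rw [tsum_lauricellaCoeff _ _ _ _ (hz.trans_le H.ρ_le_one) (hz.trans_le H.ρ_le_norm_a), div_one,
      exp_mul_div_self hl, integrand, preZ, localWeight, weight, log₁, logₐ, ← pow_add]
    have : (z - H.z₀) ^ (2 + ν) = (-H.z₀) ^ (2 + ν) * (1 - z / H.z₀) ^ (2 + ν) := by
      rw [← mul_pow]; congr 1; field_simp; ring
    rw [this, div_eq_mul_inv, mul_inv, mul_inv, ← Complex.exp_neg, ← Complex.exp_neg,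
      ← Complex.exp_neg]
    have e1 : Complex.exp (-(H.γ * l)) = Complex.exp ((1 - H.γ - 1) * l) := by ring_nf
    have e2 : Complex.exp (-(H.δ * (L₁ + Complex.log (1 - z)))) =
        Complex.exp (-H.δ * L₁) * Complex.exp (-H.δ * Complex.log (1 - z)) := by
      rw [← Complex.exp_add]; ring_nf
    have e3 : Complex.exp (-(H.ε * (Lₐ + Complex.log (1 - z / H.a)))) =
        Complex.exp (-H.ε * Lₐ) * Complex.exp (-H.ε * Complex.log (1 - z / H.a)) := by
      rw [← Complex.exp_add]; ring_nf
    rw [e1, e2, e3]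
    ring

theorem termZ_eq_of_ε_eq_zero (hε : H.ε = 0) (ν : ℕ) (l z : ℂ) :
    H.termZ L₁ Lₐ ν l z = Complex.exp (-H.δ * L₁) * (-H.z₀) ^ (2 + ν) *
      (Complex.exp ((1 - H.γ) * l) / (1 - H.γ)) *
        appellF1 (1 - H.γ) H.δ (-2 - ν) (2 - H.γ) z (z / H.z₀) := by
  have hs := H.one_sub_γ_add_ne_zero hγ
  have e : 2 - H.γ = 1 + (1 - H.γ) := by ring
  rw [termZ, hε, lauricellaFD_zero_mid, e, Gamma_div_Gamma_add_one hs]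
  simp only [neg_zero, zero_mul, Complex.exp_zero]
  ring

end HeunParams


/-! ### Term-by-term integration -/

theorem exists_norm_sub_lt {U : Set ℂ} (hU : IsOpen U) (c : ℂ) {z : ℂ} (hz : z ∈ U) :
    ∃ w ∈ U, ‖z - c‖ < ‖w - c‖ := by
  obtain ⟨r, hr, hball⟩ := Metric.isOpen_iff.1 hU z hz
  by_cases h : z = c
  · refine ⟨z + (r / 2 : ℝ), hball ?_, ?_⟩
    · rw [Metric.mem_ball, dist_eq_norm, add_sub_cancel_left, Complex.norm_real,
        Real.norm_of_nonneg (by positivity)]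
      linarith
    · rw [h, sub_self, norm_zero, add_sub_cancel_left, Complex.norm_real,
        Real.norm_of_nonneg (by positivity)]
      positivity
  · have h0 : 0 < ‖z - c‖ := norm_pos_iff.2 (sub_ne_zero.2 h)
    have ht : 0 < r / (2 * ‖z - c‖) := by positivity
    refine ⟨z + (r / (2 * ‖z - c‖) : ℝ) * (z - c), hball ?_, ?_⟩
    · rw [Metric.mem_ball, dist_eq_norm, add_sub_cancel_left, norm_mul, Complex.norm_real,
        Real.norm_of_nonneg ht.le]
      field_simp
      linarith
    · have : z + (r / (2 * ‖z - c‖) : ℝ) * (z - c) - c =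
          ((1 + r / (2 * ‖z - c‖) : ℝ) : ℂ) * (z - c) := by push_cast; ring
      rw [this, norm_mul, Complex.norm_real, Real.norm_of_nonneg (by positivity)]
      nlinarith

/-- Convergence at a point of U farther from c gives absolute convergence on a larger circle. The
argument also covers z = c, where κ may vanish. -/
theorem summable_coef_of_expansion {U : Set ℂ} (hU : IsOpen U) {c : ℂ} {κ : ℂ → ℂ}
    (hκ : ∀ z ∈ U, z ≠ c → κ z ≠ 0) {coef : ℕ → ℂ}
    (hs : ∀ z ∈ U, Summable fun ν => coef ν * (κ z * (z - c) ^ ν)) {z : ℂ} (hz : z ∈ U) :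
    ∃ r, ‖z - c‖ < r ∧ Summable fun ν => ‖coef ν‖ * r ^ ν := by
  obtain ⟨w, hw, hlt⟩ := exists_norm_sub_lt hU c hz
  refine ⟨_, hlt, ?_⟩
  have hwc : w ≠ c := fun h => by
    rw [h, sub_self, norm_zero] at hlt
    exact absurd hlt (norm_nonneg _).not_gt
  refine ((hs w hw).norm.mul_left ‖κ w‖⁻¹).congr fun ν => ?_
  have : ‖κ w‖ ≠ 0 := norm_ne_zero_iff.2 (hκ w hw hwc)
  rw [norm_mul, norm_mul, norm_pow]
  field_simp

/-- Near each point the differentiated series is dominated by a convergent numerical series, so both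
sides have the same derivative and vanish at the base point. The relation between z and w is
additive along chains, so connectedness makes it global without a uniform bound on U. -/
theorem hasSum_mul_sub_of_hasDerivAt {U : Set ℂ} (hU : IsOpen U) (hc : IsPreconnected U) {c : ℂ}
    {κ y y' : ℂ → ℂ} (hκc : ContinuousOn κ U) (hκ : ∀ z ∈ U, z ≠ c → κ z ≠ 0) {coef : ℕ → ℂ}
    {Y : ℕ → ℂ → ℂ} (hY : ∀ ν, ∀ z ∈ U, HasDerivAt (Y ν) (κ z * (z - c) ^ ν) z)
    (hy : ∀ z ∈ U, HasDerivAt y (y' z) z)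
    (hs : ∀ z ∈ U, HasSum (fun ν => coef ν * (κ z * (z - c) ^ ν)) (y' z)) {z w : ℂ}
    (hz : z ∈ U) (hw : w ∈ U) : HasSum (fun ν => coef ν * (Y ν z - Y ν w)) (y z - y w) := by
  refine hc.induction₂' (fun w z => HasSum (fun ν => coef ν * (Y ν z - Y ν w)) (y z - y w))
    (fun z₁ hz₁ => ?_) (fun a b d _ _ _ h1 h2 => ?_) hw hz
  · obtain ⟨r, hr, hsum⟩ := summable_coef_of_expansion hU hκ (fun z hz => (hs z hz).summable) hz₁
    have hev : ∀ᶠ z in 𝓝 z₁, z ∈ U ∧ ‖κ z‖ < ‖κ z₁‖ + 1 ∧ ‖z - c‖ < r := by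
      refine (hU.eventually_mem hz₁).and (Filter.Eventually.and ?_ ?_)
      · exact (hκc.continuousAt (hU.mem_nhds hz₁)).norm.eventually_lt_const (by simp)
      · have : ContinuousAt (fun z => ‖z - c‖) z₁ := by fun_prop
        exact this.eventually_lt_const hr
    obtain ⟨η, hη, hball⟩ := Metric.eventually_nhds_iff_ball.1 hev
    have hr0 : 0 ≤ r := (norm_nonneg _).trans hr.le
    have hmem : z₁ ∈ Metric.ball z₁ η := Metric.mem_ball_self hη
    have hpre : IsPreconnected (Metric.ball z₁ η) := (convex_ball z₁ η).isPreconnected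
    have hg : ∀ ν, ∀ z ∈ Metric.ball z₁ η, HasDerivAt (fun z => coef ν * (Y ν z - Y ν z₁))
        (coef ν * (κ z * (z - c) ^ ν)) z := fun ν z hz =>
      ((hY ν z (hball z hz).1).sub_const _).const_mul _
    have hu : Summable fun ν => (‖κ z₁‖ + 1) * (‖coef ν‖ * r ^ ν) := hsum.mul_left _
    have hb : ∀ ν, ∀ z ∈ Metric.ball z₁ η, ‖coef ν * (κ z * (z - c) ^ ν)‖ ≤
        (‖κ z₁‖ + 1) * (‖coef ν‖ * r ^ ν) := fun ν z hz => by
      obtain ⟨-, h1, h2⟩ := hball z hz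
      rw [norm_mul, norm_mul, norm_pow]
      calc ‖coef ν‖ * (‖κ z‖ * ‖z - c‖ ^ ν) ≤ ‖coef ν‖ * ((‖κ z₁‖ + 1) * r ^ ν) := by gcongr
        _ = _ := by ring
    have hsum0 : Summable fun ν => coef ν * (Y ν z₁ - Y ν z₁) := by simp
    have key : ∀ z ∈ Metric.ball z₁ η,
        HasSum (fun ν => coef ν * (Y ν z - Y ν z₁)) (y z - y z₁) := by
      intro z hz
      have hsz := summable_of_summable_hasDerivAt_of_isPreconnected hu Metric.isOpen_ball hpre hg hb
        hmem hsum0 hz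
      have hd : ∀ w ∈ Metric.ball z₁ η,
          HasDerivAt (fun z => ∑' ν, coef ν * (Y ν z - Y ν z₁)) (y' w) w := fun w hw => by
        rw [← (hs w (hball w hw).1).tsum_eq]
        exact hasDerivAt_tsum_of_isPreconnected hu Metric.isOpen_ball hpre hg hb hmem hsum0 hw
      obtain ⟨C, hC⟩ := Metric.isOpen_ball.exists_eq_add_of_deriv_eq hpre
        (fun w hw => (hd w hw).differentiableAt.differentiableWithinAt)
        (fun w hw => (hy w (hball w hw).1).differentiableAt.differentiableWithinAt)
        (fun w hw => by rw [(hd w hw).deriv, (hy w (hball w hw).1).deriv])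
      have h1 := hC hmem
      have h2 := hC hz
      simp only [sub_self, mul_zero, tsum_zero] at h1 h2
      have h3 := hsz.hasSum
      rw [h2] at h3
      rwa [show y z + C = y z - y z₁ by linear_combination -h1] at h3
    filter_upwards [eventually_nhdsWithin_of_eventually_nhds
      (Metric.ball_mem_nhds z₁ hη)] with z hz
    refine ⟨key z hz, ?_⟩
    have := (key z hz).neg
    rw [neg_sub] at this
    exact this.congr_fun fun ν => by ring
  · have := h1.add h2
    rw [show y b - y a + (y d - y b) = y d - y a by ring] at this
    exact this.congr_fun fun ν => by ring

/-- Once the integrated series converges at one point, its normalisation is superfluous. -/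
theorem IsNormalisedTermwiseExpansion.isTermwiseExpansion {U : Set ℂ} {ℓ y : ℂ → ℂ} {coef : ℕ → ℂ}
    {Y : ℕ → ℂ → ℂ → ℂ} (h : IsNormalisedTermwiseExpansion U ℓ y coef Y) {w : ℂ} (hw : w ∈ U)
    (hs : Summable fun ν => coef ν * Y ν (ℓ w) w) : IsTermwiseExpansion U ℓ y coef Y := by
  refine ⟨y w - ∑' ν, coef ν * Y ν (ℓ w) w, fun z hz => ?_⟩
  have := (h z hz w hw).add hs.hasSum
  rw [show y z - y w + ∑' ν, coef ν * Y ν (ℓ w) w = y z - (y w - ∑' ν, coef ν * Y ν (ℓ w) w) by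
    ring] at this
  exact this.congr_fun fun ν => by ring

/-- The bound is uniform in ν: the numbers s + ν + d i stay among the s + n, which are bounded away
from 0. -/
theorem ConvergesInBall.exists_norm_tsum_div_add_le {ι : Type*} {c : ι → ℂ} {d : ι → ℕ} {R : ℝ}
    (h : ConvergesInBall c d R) {s : ℂ} (hs : ∀ n : ℕ, s + n ≠ 0) {z : ℂ} (hz : ‖z‖ < R) :
    ∃ K : ℝ, ∀ ν : ℕ, ‖∑' i, c i / (s + ν + d i) * z ^ d i‖ ≤ K := by
  obtain ⟨η, h0, hη⟩ := exists_pos_le_norm_add_natCast hs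
  refine ⟨∑' i, η⁻¹ * ‖c i * z ^ d i‖, fun ν => ?_⟩
  refine tsum_of_norm_bounded ((h.summable_norm hz).mul_left η⁻¹).hasSum fun i => ?_
  rw [norm_mul, norm_div, norm_mul, div_eq_inv_mul, mul_assoc]
  refine mul_le_mul_of_nonneg_right (inv_anti₀ h0 ?_) (by positivity)
  have := hη (ν + d i)
  push_cast at this
  rwa [← add_assoc] at this

namespace HeunParams

variable (H : HeunParams) {L₁ Lₐ : ℂ}

theorem isLogBranch_log₁ (h₁ : Complex.exp L₁ = -1) : IsLogBranch 1 (Metric.ball 0 H.ρ) (H.log₁ L₁) := by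
  refine ⟨fun z hz => ?_, fun z hz => H.exp_log₁ h₁ (by simpa using hz)⟩
  have hz' : ‖z‖ < H.ρ := by simpa using hz
  have : 1 - z ∈ Complex.slitPlane := by
    rw [sub_eq_add_neg]
    refine Complex.mem_slitPlane_of_norm_lt_one ?_
    rw [norm_neg]
    simpa using hz'.trans_le H.ρ_le_one
  have h : ContinuousAt (H.log₁ L₁) z := by
    unfold log₁
    exact continuousAt_const.add (ContinuousAt.clog (by fun_prop) this)
  exact h.continuousWithinAt

theorem isLogBranch_logₐ (hₐ : Complex.exp Lₐ = -H.a) :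
    IsLogBranch H.a (Metric.ball 0 H.ρ) (H.logₐ Lₐ) := by
  refine ⟨fun z hz => ?_, fun z hz => H.exp_logₐ hₐ (by simpa using hz)⟩
  have hz' : ‖z‖ < H.ρ := by simpa using hz
  have : 1 - z / H.a ∈ Complex.slitPlane := by
    rw [sub_eq_add_neg]
    refine Complex.mem_slitPlane_of_norm_lt_one ?_
    rw [norm_neg, norm_div, div_lt_one (norm_pos_iff.2 H.a_ne_zero)]
    exact hz'.trans_le H.ρ_le_norm_a
  have h : ContinuousAt (H.logₐ Lₐ) z := by
    unfold logₐ
    exact continuousAt_const.add (ContinuousAt.clog (by fun_prop) this)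
  exact h.continuousWithinAt

theorem localWeight_ne_zero (l z : ℂ) : H.localWeight L₁ Lₐ l z ≠ 0 := H.weight_ne_zero _ _ _

theorem continuousOn_localWeight (h₁ : Complex.exp L₁ = -1) (hₐ : Complex.exp Lₐ = -H.a)
    {U : Set ℂ} (hU : U ⊆ Metric.ball 0 H.ρ) {ℓ : ℂ → ℂ} (hℓ : ContinuousOn ℓ U) :
    ContinuousOn (fun z => H.localWeight L₁ Lₐ (ℓ z) z) U := by
  have := (H.isLogBranch_log₁ h₁).1.mono hU
  have := (H.isLogBranch_logₐ hₐ).1.mono hU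
  unfold localWeight weight
  fun_prop

theorem isNormalisedTermwiseExpansion (h₁ : Complex.exp L₁ = -1) (hₐ : Complex.exp Lₐ = -H.a)
    {U : Set ℂ} {ℓ y : ℂ → ℂ} (hU : IsOpen U) (hc : IsPreconnected U)
    (hUρ : U ⊆ Metric.ball 0 H.ρ) (hℓ : IsLogBranch 0 U ℓ) (hy : SolvesODE H.P H.Q U y)
    {pre : ℂ → ℂ → ℂ} {c : ℂ} {coef : ℕ → ℂ} {Y : ℕ → ℂ → ℂ → ℂ}
    (hpre : ContinuousOn (fun z => pre (ℓ z) z) U) (hpre0 : ∀ z ∈ U, z ≠ c → pre (ℓ z) z ≠ 0)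
    (hexp : HasExpansion U ℓ (fun z => H.localWeight L₁ Lₐ (ℓ z) z * deriv y z) pre c coef)
    (hY : IsIndefiniteIntegral U ℓ (H.integrand L₁ Lₐ pre c) Y) :
    IsNormalisedTermwiseExpansion U ℓ y coef Y := by
  intro z hz w hw
  refine hasSum_mul_sub_of_hasDerivAt (Y := fun ν z => Y ν (ℓ z) z) hU hc (c := c)
    (κ := fun z => pre (ℓ z) z / H.localWeight L₁ Lₐ (ℓ z) z)
    (hpre.div (H.continuousOn_localWeight h₁ hₐ hUρ hℓ.1) fun z _ => H.localWeight_ne_zero _ _)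
    (fun z hz hzc => div_ne_zero (hpre0 z hz hzc) (H.localWeight_ne_zero _ _))
    (fun ν z hz => (hY ν z hz).congr_deriv ?_) (fun z hz => hy.hasDerivAt hU hz)
    (fun z hz => ?_) hz hw
  · rw [integrand]; ring
  · have h0 := H.localWeight_ne_zero (L₁ := L₁) (Lₐ := Lₐ) (ℓ z) z
    have := (hexp z hz).div_const (H.localWeight L₁ Lₐ (ℓ z) z)
    rw [mul_div_cancel_left₀ _ h0] at this
    exact this.congr_fun fun ν => by ring

/-- At the centre 0, `term0` is w^ν times a factor bounded in ν, so the integrated series converges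
with that of v and no condition on Re γ is needed. -/
theorem isTermwiseExpansion_zero (h₁ : Complex.exp L₁ = -1) (hₐ : Complex.exp Lₐ = -H.a)
    {U : Set ℂ} {ℓ y : ℂ → ℂ} (hU : IsOpen U) (hc : IsPreconnected U)
    (hUρ : U ⊆ Metric.ball 0 H.ρ) (hℓ : IsLogBranch 0 U ℓ) (hy : SolvesODE H.P H.Q U y)
    {μ : ℂ} {coef : ℕ → ℂ} (hs : ∀ ν : ℕ, 1 - H.γ + μ + ν ≠ 0)
    (hexp : HasExpansion U ℓ (fun z => H.localWeight L₁ Lₐ (ℓ z) z * deriv y z)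
      (H.pre0 μ) 0 coef) :
    IsTermwiseExpansion U ℓ y coef (H.term0 L₁ Lₐ μ) := by
  rcases U.eq_empty_or_nonempty with rfl | ⟨w, hw⟩
  · exact ⟨0, by simp⟩
  have hpre : ContinuousOn (fun z => H.pre0 μ (ℓ z) z) U := by
    have := hℓ.1
    unfold pre0; fun_prop
  have hpre0 : ∀ z ∈ U, z ≠ 0 → H.pre0 μ (ℓ z) z ≠ 0 := fun z _ _ => Complex.exp_ne_zero _
  refine (H.isNormalisedTermwiseExpansion h₁ hₐ hU hc hUρ hℓ hy hpre hpre0 hexp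
    fun ν z hz => (H.integratesTo_zero μ ν hs).1 U ℓ hU hUρ hℓ z hz).isTermwiseExpansion hw ?_
  have hwρ : ‖w‖ < H.ρ := by simpa using hUρ hw
  obtain ⟨r, hr, hsum⟩ := summable_coef_of_expansion hU hpre0
    (fun z hz => (hexp z hz).summable) hw
  obtain ⟨K, hK⟩ := (convergesInBall_appellCoeff H.δ H.ε H.ρ_le_one
    H.ρ_le_norm_a).exists_norm_tsum_div_add_le hs hwρ
  have hew : Complex.exp (ℓ w) = w := by simpa using hℓ.2 w hw
  rw [sub_zero] at hr
  set K₁ := ‖Complex.exp (-H.δ * L₁) * Complex.exp (-H.ε * Lₐ) *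
    Complex.exp ((1 - H.γ + μ) * ℓ w)‖ with hK₁
  refine Summable.of_norm_bounded (hsum.mul_left (K₁ * K)) fun ν => ?_
  have hs' : ∀ n : ℕ, 1 - H.γ + μ + ν + n ≠ 0 := fun n => by
    have := hs (ν + n); push_cast at this; rwa [← add_assoc] at this
  have h0 : 1 - H.γ + μ + ν ≠ 0 := hs ν
  have e1 := appellF1_eq_tsum H.δ H.ε 1 H.a w hs'
  rw [div_one] at e1
  have e2 : Complex.exp ((1 - H.γ + μ + ν) * ℓ w) =
      Complex.exp ((1 - H.γ + μ) * ℓ w) * w ^ ν := by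
    rw [add_mul, Complex.exp_add, Complex.exp_nat_mul, hew]
  have e3 : H.term0 L₁ Lₐ μ ν (ℓ w) w = Complex.exp (-H.δ * L₁) * Complex.exp (-H.ε * Lₐ) *
      Complex.exp ((1 - H.γ + μ) * ℓ w) * (w ^ ν * ∑' k : ℕ × ℕ, appellCoeff H.δ H.ε 1 H.a k /
        (1 - H.γ + μ + ν + ((k.1 + k.2 : ℕ) : ℂ)) * w ^ (k.1 + k.2)) := by
    rw [term0, e1, e2]
    field_simp
  rw [e3, norm_mul, norm_mul, norm_mul (w ^ ν), norm_pow, ← hK₁]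
  have hK0 : 0 ≤ K := (norm_nonneg _).trans (hK 0)
  have hr0 : 0 ≤ r := (norm_nonneg w).trans hr.le
  calc _ ≤ ‖coef ν‖ * (K₁ * (r ^ ν * K)) := by
        gcongr
        exact hK ν
    _ = _ := by ring

end HeunParams


/-! ### Local expansions of `v` -/

/-- On this disc (z-e)/(c-e) differs from 1 by less than 1, so the principal logarithm applies. -/
theorem isLogBranch_ball {c e : ℂ} (h : c ≠ e) :
    IsLogBranch e (Metric.ball c ‖c - e‖)
      (fun z => Complex.log ((z - e) / (c - e)) + Complex.log (c - e)) := by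
  have h0 : c - e ≠ 0 := sub_ne_zero.2 h
  have hs : ∀ z ∈ Metric.ball c ‖c - e‖, (z - e) / (c - e) ∈ Complex.slitPlane := by
    intro z hz
    have : (z - e) / (c - e) = 1 + (z - c) / (c - e) := by field_simp; ring
    rw [this]
    refine Complex.mem_slitPlane_of_norm_lt_one ?_
    rw [norm_div, div_lt_one (norm_pos_iff.2 h0)]
    simpa [dist_eq_norm] using hz
  refine ⟨fun z hz => ?_, fun z hz => ?_⟩
  · refine ContinuousAt.continuousWithinAt ?_
    have h1 : ContinuousAt (fun z => Complex.log ((z - e) / (c - e))) z :=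
      ContinuousAt.clog (f := fun z => (z - e) / (c - e)) (by fun_prop) (hs z hz)
    exact h1.add continuousAt_const
  · rw [Complex.exp_add, Complex.exp_log (Complex.slitPlane_ne_zero (hs z hz)), Complex.exp_log h0,
      div_mul_cancel₀ _ h0]

/-- On connected U the given branch differs by a constant from one defined on the whole disc, which
absorbs the power of z - e into a holomorphic factor. -/
theorem IsLogBranch.exists_extension {e c : ℂ} {U : Set ℂ} {ℓ : ℂ → ℂ} (h : IsLogBranch e U ℓ)
    (hU : IsOpen U) (hc : IsPreconnected U) {r : ℝ} (hr : r ≤ ‖c - e‖) (hUr : U ⊆ Metric.ball c r)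
    (s : ℂ) : ∃ W : ℂ → ℂ, DifferentiableOn ℂ W (Metric.ball c r) ∧
      ∀ z ∈ U, Complex.exp (s * ℓ z) = W z := by
  -- Degenerate case: then r ≤ 0, the disc is empty, and so is U.
  by_cases hce : c = e
  · refine ⟨0, differentiableOn_const 0, fun z hz => ?_⟩
    rw [hce, sub_self, norm_zero] at hr
    rw [Metric.ball_eq_empty.2 hr] at hUr
    exact (hUr hz).elim
  · have hB := (isLogBranch_ball hce).mono (Metric.ball_subset_ball hr)
    obtain ⟨C, hC⟩ := h.exists_eq_add_const (hB.mono hUr) hU hc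
    refine ⟨fun z => Complex.exp (s * (Complex.log ((z - e) / (c - e)) + Complex.log (c - e) + C)),
      fun z hz => ?_, fun z hz => by rw [hC z hz]⟩
    exact (((hB.hasDerivAt Metric.isOpen_ball hz).add_const C).const_mul
      s).cexp.differentiableAt.differentiableWithinAt

theorem exists_hasSum_of_eq_mul {U : Set ℂ} {p v h : ℂ → ℂ} {c : ℂ} {r : ℝ}
    (hUr : U ⊆ Metric.ball c r) (hh : DifferentiableOn ℂ h (Metric.ball c r))
    (hv : ∀ z ∈ U, v z = p z * h z) :
    ∃ coef : ℕ → ℂ, ∀ z ∈ U, HasSum (fun ν => coef ν * (p z * (z - c) ^ ν)) (v z) := by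
  refine ⟨fun n => (n.factorial : ℂ)⁻¹ * iteratedDeriv n h c, fun z hz => ?_⟩
  rw [hv z hz]
  refine ((Complex.hasSum_taylorSeries_on_ball hh (hUr hz)).mul_left (p z)).congr_fun fun n => ?_
  simp only [smul_eq_mul]; ring

/-- For σ = 0 the power (z-c)^θ is left in front of V g'. For σ = 1 - θ the product of the two
powers is z - c, which cancels the pole of y'/(z-c)^σ and leaves a holomorphic function. -/
theorem exists_hasSum_of_frobenius {U : Set ℂ} (hU : IsOpen U) {c θ σ μ : ℂ} {r : ℝ}
    {l y g V v : ℂ → ℂ} (hl : IsLogBranch c U l) (hUr : U ⊆ Metric.ball c r)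
    (hσ : (σ = 0 ∧ μ = θ) ∨ (σ = 1 - θ ∧ μ = 0)) (hg : DifferentiableOn ℂ g (Metric.ball c r))
    (hV : DifferentiableOn ℂ V (Metric.ball c r))
    (hy : ∀ z ∈ U, y z = Complex.exp (σ * l z) * g z)
    (hv : ∀ z ∈ U, v z = Complex.exp (θ * l z) * V z * deriv y z) :
    ∃ coef : ℕ → ℂ, ∀ z ∈ U,
      HasSum (fun ν => coef ν * (Complex.exp (μ * l z) * (z - c) ^ ν)) (v z) := by
  have hg' := hg.deriv Metric.isOpen_ball
  have hd : ∀ z ∈ U, deriv y z =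
      Complex.exp (σ * l z) * (σ * (z - c)⁻¹) * g z + Complex.exp (σ * l z) * deriv g z := by
    intro z hz
    have hev : y =ᶠ[𝓝 z] fun z => Complex.exp (σ * l z) * g z := by
      filter_upwards [hU.mem_nhds hz] with w hw using hy w hw
    rw [hev.deriv_eq]
    exact ((((hl.hasDerivAt hU hz).const_mul σ).cexp).mul
      (hg.differentiableAt (Metric.isOpen_ball.mem_nhds (hUr hz))).hasDerivAt).deriv
  rcases hσ with ⟨rfl, rfl⟩ | ⟨rfl, rfl⟩
  · refine exists_hasSum_of_eq_mul hUr (hV.mul hg') fun z hz => ?_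
    rw [hv z hz, hd z hz]
    simp only [Pi.mul_apply, zero_mul, Complex.exp_zero]; ring
  · refine exists_hasSum_of_eq_mul hUr (h := fun z => V z * ((1 - θ) * g z + (z - c) * deriv g z))
      (by fun_prop) fun z hz => ?_
    have h0 : z - c ≠ 0 := sub_ne_zero.2 (hl.ne hz)
    have e : Complex.exp (θ * l z) * Complex.exp ((1 - θ) * l z) = z - c := by
      rw [← Complex.exp_add, ← hl.2 z hz]; ring_nf
    rw [hv z hz, hd z hz, zero_mul, Complex.exp_zero]
    calc _ = Complex.exp (θ * l z) * Complex.exp ((1 - θ) * l z) * V z *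
          ((1 - θ) * (z - c)⁻¹ * g z + deriv g z) := by ring
      _ = _ := by rw [e]; field_simp

theorem exists_eq_sub_sq_mul {f : ℂ → ℂ} {c : ℂ} {r : ℝ} (hr : 0 < r)
    (hf : DifferentiableOn ℂ f (Metric.ball c r)) (h0 : f c = 0) (h1 : deriv f c = 0) :
    ∃ h : ℂ → ℂ, DifferentiableOn ℂ h (Metric.ball c r) ∧ ∀ z, f z = (z - c) ^ 2 * h z := by
  have hn : Metric.ball c r ∈ 𝓝 c := Metric.ball_mem_nhds c hr
  refine ⟨dslope (dslope f c) c, (Complex.differentiableOn_dslope hn).2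
    ((Complex.differentiableOn_dslope hn).2 hf), fun z => ?_⟩
  have e1 := sub_smul_dslope f c z
  have e2 := sub_smul_dslope (dslope f c) c z
  rw [dslope_same, h1, sub_zero] at e2
  rw [h0, sub_zero] at e1
  rw [← e1, ← e2]
  simp only [smul_eq_mul]; ring

/-! ### Expansions of `v` at the four centres -/

namespace HeunParams

variable (H : HeunParams) {L₁ Lₐ : ℂ} (h₁ : Complex.exp L₁ = -1) (hₐ : Complex.exp Lₐ = -H.a)
  {U : Set ℂ} {ℓ y : ℂ → ℂ} (hU : IsOpen U) (hc : IsPreconnected U)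
  (hUρ : U ⊆ Metric.ball 0 H.ρ) (hℓ : IsLogBranch 0 U ℓ)

include h₁ hₐ hU hc hUρ hℓ

theorem exists_expansion_zero {σ μ : ℂ} {g : ℂ → ℂ} {r : ℝ}
    (hσ : (σ = 0 ∧ μ = H.γ) ∨ (σ = 1 - H.γ ∧ μ = 0)) (hr : r ≤ H.ρ) (hUr : U ⊆ Metric.ball 0 r)
    (hg : DifferentiableOn ℂ g (Metric.ball 0 r)) (hy : ∀ z ∈ U, y z = H.pre0 σ (ℓ z) z * g z) :
    ∃ coef, HasExpansion U ℓ (fun z => H.localWeight L₁ Lₐ (ℓ z) z * deriv y z)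
      (H.pre0 μ) 0 coef := by
  obtain ⟨W₁, hW₁, e₁⟩ := ((H.isLogBranch_log₁ h₁).mono hUρ).exists_extension hU hc (c := 0)
    (by simpa using hr.trans H.ρ_le_one) hUr H.δ
  obtain ⟨Wₐ, hWₐ, eₐ⟩ := ((H.isLogBranch_logₐ hₐ).mono hUρ).exists_extension hU hc (c := 0)
    (by simpa using hr.trans H.ρ_le_norm_a) hUr H.ε
  refine exists_hasSum_of_frobenius hU (V := fun z => W₁ z * Wₐ z) hℓ hUr hσ hg (by fun_prop) hy
    fun z hz => ?_
  rw [localWeight, weight, e₁ z hz, eₐ z hz]; ring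

theorem exists_expansion_one {σ μ : ℂ} {g : ℂ → ℂ} {r : ℝ}
    (hσ : (σ = 0 ∧ μ = H.δ) ∨ (σ = 1 - H.δ ∧ μ = 0)) (hr : r ≤ min 1 ‖1 - H.a‖)
    (hUr : U ⊆ Metric.ball 1 r)
    (hg : DifferentiableOn ℂ g (Metric.ball 1 r)) (hy : ∀ z ∈ U, y z = H.pre1 L₁ σ (ℓ z) z * g z) :
    ∃ coef, HasExpansion U ℓ (fun z => H.localWeight L₁ Lₐ (ℓ z) z * deriv y z)
      (H.pre1 L₁ μ) 1 coef := by
  obtain ⟨W₀, hW₀, e₀⟩ := hℓ.exists_extension hU hc (c := 1)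
    (by simpa using hr.trans (min_le_left _ _)) hUr H.γ
  obtain ⟨Wₐ, hWₐ, eₐ⟩ := ((H.isLogBranch_logₐ hₐ).mono hUρ).exists_extension hU hc (c := 1)
    (hr.trans (min_le_right _ _)) hUr H.ε
  refine exists_hasSum_of_frobenius hU (V := fun z => W₀ z * Wₐ z)
    ((H.isLogBranch_log₁ h₁).mono hUρ) hUr hσ hg (by fun_prop) hy fun z hz => ?_
  rw [localWeight, weight, e₀ z hz, eₐ z hz]; ring

theorem exists_expansion_a {σ μ : ℂ} {g : ℂ → ℂ} {r : ℝ}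
    (hσ : (σ = 0 ∧ μ = H.ε) ∨ (σ = 1 - H.ε ∧ μ = 0)) (hr : r ≤ min ‖H.a‖ ‖H.a - 1‖)
    (hUr : U ⊆ Metric.ball H.a r) (hg : DifferentiableOn ℂ g (Metric.ball H.a r))
    (hy : ∀ z ∈ U, y z = H.preA Lₐ σ (ℓ z) z * g z) :
    ∃ coef, HasExpansion U ℓ (fun z => H.localWeight L₁ Lₐ (ℓ z) z * deriv y z)
      (H.preA Lₐ μ) H.a coef := by
  obtain ⟨W₀, hW₀, e₀⟩ := hℓ.exists_extension hU hc (c := H.a)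
    (by simpa using hr.trans (min_le_left _ _)) hUr H.γ
  obtain ⟨W₁, hW₁, e₁⟩ := ((H.isLogBranch_log₁ h₁).mono hUρ).exists_extension hU hc (c := H.a)
    (hr.trans (min_le_right _ _)) hUr H.δ
  refine exists_hasSum_of_frobenius hU (V := fun z => W₀ z * W₁ z)
    ((H.isLogBranch_logₐ hₐ).mono hUρ) hUr hσ hg (by fun_prop) hy fun z hz => ?_
  rw [localWeight, weight, e₀ z hz, e₁ z hz]; ring

/-- The disc contains no singular point of Heun's equation, and Q(z₀) = 0. The equation at z₀
therefore gives y'' = 0 there, so y' is divisible by (z-z₀)². -/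
theorem exists_expansion_z₀ (hαβ : H.α * H.β ≠ 0) {r : ℝ}
    (hr : r ≤ min ‖H.z₀‖ (min ‖H.z₀ - 1‖ ‖H.z₀ - H.a‖)) (hUr : U ⊆ Metric.ball H.z₀ r)
    (hy : SolvesODE H.P H.Q (Metric.ball H.z₀ r) y) (hy0 : deriv y H.z₀ = 0) :
    ∃ coef, HasExpansion U ℓ (fun z => H.localWeight L₁ Lₐ (ℓ z) z * deriv y z)
      H.preZ H.z₀ coef := by
  rcases U.eq_empty_or_nonempty with rfl | ⟨w, hw⟩
  · exact ⟨0, fun z hz => hz.elim⟩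
  have hr0 : 0 < r := Metric.pos_of_mem_ball (hUr hw)
  obtain ⟨W₀, hW₀, e₀⟩ := hℓ.exists_extension hU hc (c := H.z₀)
    (by simpa using hr.trans (min_le_left _ _)) hUr H.γ
  obtain ⟨W₁, hW₁, e₁⟩ := ((H.isLogBranch_log₁ h₁).mono hUρ).exists_extension hU hc (c := H.z₀)
    (hr.trans ((min_le_right _ _).trans (min_le_left _ _))) hUr H.δ
  obtain ⟨Wₐ, hWₐ, eₐ⟩ := ((H.isLogBranch_logₐ hₐ).mono hUρ).exists_extension hU hc (c := H.z₀)
    (hr.trans ((min_le_right _ _).trans (min_le_right _ _))) hUr H.ε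
  have hQ : H.Q H.z₀ = 0 := by
    rw [Q, show H.α * H.β * H.z₀ = H.q by rw [z₀, mul_div_cancel₀ _ hαβ], sub_self, zero_div]
  have h2 : deriv (deriv y) H.z₀ = 0 := by
    have := hy.2 H.z₀ (Metric.mem_ball_self hr0)
    simpa [hQ, hy0] using this
  obtain ⟨h, hh, he⟩ := exists_eq_sub_sq_mul hr0 (hy.1.deriv Metric.isOpen_ball) hy0 h2
  refine exists_hasSum_of_eq_mul (p := fun z => H.preZ (ℓ z) z)
    (h := fun z => W₀ z * W₁ z * Wₐ z * h z) hUr (by fun_prop) fun z hz => ?_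
  rw [localWeight, weight, e₀ z hz, e₁ z hz, eₐ z hz, he z, preZ]; ring

end HeunParams


/-! ### Growth of the coefficients of a power series with one singularity on the unit circle -/

/-- Grönwall's inequality with the integrable kernel `(1 - t) ^ (η - 1)`. -/
theorem le_of_deriv_le_rpow_mul {E E' : ℝ → ℝ} {C η : ℝ} (hη : 0 < η) (hC : 0 ≤ C)
    (hE0 : ∀ t, 0 ≤ E t)
    (hd : ∀ t, 1 / 2 ≤ t → t < 1 → HasDerivAt E (E' t) t)
    (hle : ∀ t, 1 / 2 ≤ t → t < 1 → E' t ≤ C * (1 - t) ^ (η - 1) * E t) {t : ℝ} (h1 : 1 / 2 ≤ t)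
    (h2 : t < 1) : E t ≤ E (1 / 2) * Real.exp (C / η * (1 / 2 : ℝ) ^ η) := by
  -- φ' is minus the kernel, so E exp φ is non-increasing; φ stays bounded up to t = 1 because η >
  -- 0.
  set φ : ℝ → ℝ := fun t => C / η * (1 - t) ^ η
  have hφ : ∀ t, t < 1 → HasDerivAt φ (-(C * (1 - t) ^ (η - 1))) t := fun t ht => by
    have h := (((hasDerivAt_id t).const_sub 1).rpow_const (p := η)
      (Or.inl (by simp only [id]; linarith))).const_mul (C / η)
    refine h.congr_deriv ?_
    simp only [id]
    field_simp
  have hanti : AntitoneOn (fun t => E t * Real.exp (φ t)) (Set.Icc (1 / 2) t) := by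
    have hmem : ∀ s ∈ Set.Icc (1 / 2) t, 1 / 2 ≤ s ∧ s < 1 := fun s hs => ⟨hs.1, hs.2.trans_lt h2⟩
    have hd' : ∀ s ∈ Set.Icc (1 / 2) t, HasDerivAt (fun t => E t * Real.exp (φ t))
        (E' s * Real.exp (φ s) + E s * (Real.exp (φ s) * (-(C * (1 - s) ^ (η - 1))))) s :=
      fun s hs => (hd s (hmem s hs).1 (hmem s hs).2).mul (hφ s (hmem s hs).2).exp
    refine antitoneOn_of_deriv_nonpos (convex_Icc _ _)
      (fun s hs => (hd' s hs).continuousAt.continuousWithinAt)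
      (fun s hs => (hd' s (interior_subset hs)).differentiableAt.differentiableWithinAt)
      fun s hs => ?_
    have hs' := interior_subset hs
    rw [(hd' s hs').deriv]
    have := hle s (hmem s hs').1 (hmem s hs').2
    have h3 := mul_le_mul_of_nonneg_right this (Real.exp_pos (φ s)).le
    linarith
  have h := hanti ⟨le_rfl, h1⟩ ⟨h1, le_rfl⟩ h1
  have h3 : E t * 1 ≤ E t * Real.exp (φ t) := by
    refine mul_le_mul_of_nonneg_left (Real.one_le_exp ?_) (hE0 t)
    have : 0 ≤ (1 - t) ^ η := Real.rpow_nonneg (by linarith) _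
    positivity
  have e : φ (1 / 2) = C / η * (1 / 2 : ℝ) ^ η := by simp only [φ]; norm_num
  rw [← e]
  simp only at h
  linarith

/-- Squares are used because the norm itself need not be differentiable at a zero. -/
theorem HasDerivAt.norm_sq_le {F : ℝ → ℂ} {F' : ℂ} {t : ℝ} (h : HasDerivAt F F' t) :
    ∃ D, HasDerivAt (fun t => ‖F t‖ ^ 2) D t ∧ D ≤ 2 * (‖F t‖ * ‖F'‖) :=
  ⟨_, h.norm_sq, mul_le_mul_of_nonneg_left (real_inner_le_norm _ _) zero_le_two⟩

/-- An a priori estimate on a ray for a system which is singular near the end of the ray, `d` being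
the distance of the end of the ray from the singular point. -/
theorem system_bound {p η A d : ℝ} (hη : 0 < η) (hη2 : η ≤ 1 / 2) (hηp : η ≤ p) (hA : 0 ≤ A)
    (hd0 : 0 ≤ d) (hd2 : d ≤ 2) {F G F' G' : ℝ → ℂ}
    (hF : ∀ t, 1 / 2 ≤ t → t < 1 → HasDerivAt F (F' t) t)
    (hG : ∀ t, 1 / 2 ≤ t → t < 1 → HasDerivAt G (G' t) t)
    (hF' : ∀ t, 1 / 2 ≤ t → t < 1 → ‖F' t‖ ≤ A * (‖F t‖ + (1 - t + d) ^ (-p) * ‖G t‖))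
    (hG' : ∀ t, 1 / 2 ≤ t → t < 1 → ‖G' t‖ ≤ A * (‖G t‖ + (1 - t + d) ^ (p - 1) * ‖F t‖))
    {t : ℝ} (h1 : 1 / 2 ≤ t) (h2 : t < 1) :
    ‖G t‖ ^ 2 + ((1 - t + d) ^ (p - η) * ‖F t‖) ^ 2 ≤
      (‖G (1 / 2)‖ ^ 2 + ((1 - 1 / 2 + d) ^ (p - η) * ‖F (1 / 2)‖) ^ 2) *
        Real.exp (10 * A / η * (1 / 2 : ℝ) ^ η) := by
  -- ψ is a smooth stand-in for the distance of the point of the ray from the singular point.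
  set ψ : ℝ → ℝ := fun t => 1 - t + d
  have hψ0 : ∀ t, t < 1 → 0 < ψ t := fun t ht => by simp only [ψ]; linarith
  have key : ∀ t, 1 / 2 ≤ t → t < 1 → ∃ D, HasDerivAt
      (fun t => ‖G t‖ ^ 2 + (ψ t ^ (p - η) * ‖F t‖) ^ 2) D t ∧
      D ≤ 10 * A * (1 - t) ^ (η - 1) * (‖G t‖ ^ 2 + (ψ t ^ (p - η) * ‖F t‖) ^ 2) := by
    intro t ht1 ht2
    obtain ⟨DF, hDF, hDF'⟩ := (hF t ht1 ht2).norm_sq_le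
    obtain ⟨DG, hDG, hDG'⟩ := (hG t ht1 ht2).norm_sq_le
    have hψt := hψ0 t ht2
    have hψd : HasDerivAt ψ (-1) t := ((hasDerivAt_id t).const_sub 1).add_const d
    have hpow : HasDerivAt (fun t => ψ t ^ (p - η)) (-1 * (p - η) * ψ t ^ (p - η - 1)) t :=
      hψd.rpow_const (Or.inl hψt.ne')
    have hE := hDG.add ((hpow.pow 2).mul hDF)
    have hfun : (fun t => ‖G t‖ ^ 2 + (ψ t ^ (p - η) * ‖F t‖) ^ 2) =
        (fun t => ‖G t‖ ^ 2) + (fun t => ψ t ^ (p - η)) ^ 2 * (fun t => ‖F t‖ ^ 2) := by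
      funext t; simp [mul_pow]
    rw [hfun]
    refine ⟨_, hE, ?_⟩
    have hF1 := hF' t ht1 ht2
    have hG1 := hG' t ht1 ht2
    change ‖F' t‖ ≤ A * (‖F t‖ + ψ t ^ (-p) * ‖G t‖) at hF1
    change ‖G' t‖ ≤ A * (‖G t‖ + ψ t ^ (p - 1) * ‖F t‖) at hG1
    set X := ‖G t‖
    set B := ψ t ^ (p - η) with hB
    set Y := ‖F t‖
    have hX : 0 ≤ X := norm_nonneg _
    have hY : 0 ≤ Y := norm_nonneg _
    have hB0 : 0 ≤ B := Real.rpow_nonneg hψt.le _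
    set k := (1 - t) ^ (η - 1) with hk
    have h1t : 0 < 1 - t := by linarith
    have hψ3 : ψ t ≤ 3 := by simp only [ψ]; linarith
    have hk1 : ψ t ^ (η - 1) ≤ k :=
      Real.rpow_le_rpow_of_nonpos h1t (by simp only [ψ]; linarith) (by linarith)
    have hle3 : ∀ e : ℝ, 0 ≤ e → e ≤ 1 → ψ t ^ e ≤ 3 := fun e he he1 => by
      calc ψ t ^ e ≤ 3 ^ e := Real.rpow_le_rpow hψt.le hψ3 he
        _ ≤ 3 ^ (1 : ℝ) := Real.rpow_le_rpow_of_exponent_le (by norm_num) he1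
        _ = 3 := Real.rpow_one 3
    have hψη : 0 ≤ ψ t ^ (η - 1) := Real.rpow_nonneg hψt.le _
    have hk3 : 1 ≤ 3 * k := by
      have : (1 : ℝ) = ψ t ^ (1 - η) * ψ t ^ (η - 1) := by
        rw [← Real.rpow_add hψt]; simp
      rw [this]
      exact mul_le_mul (hle3 _ (by linarith) (by linarith)) hk1 hψη (by norm_num)
    have hk4 : ψ t ^ (-η) ≤ 3 * k := by
      have : ψ t ^ (-η) = ψ t ^ (1 - 2 * η) * ψ t ^ (η - 1) := by
        rw [← Real.rpow_add hψt]; ring_nf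
      rw [this]
      exact mul_le_mul (hle3 _ (by linarith) (by linarith)) hk1 hψη (by norm_num)
    -- The weight B = ψ^(p-η) balances the two couplings: they become ψ^(η-1) and ψ^(-η), both
    -- controlled by the integrable kernel k; the second uses η ≤ 1/2.
    have e1 : ψ t ^ (p - 1) = ψ t ^ (η - 1) * B := by
      rw [hB, ← Real.rpow_add hψt]; ring_nf
    have e2 : B * ψ t ^ (-p) = ψ t ^ (-η) := by
      rw [hB, ← Real.rpow_add hψt]; ring_nf
    have hXY : 2 * (X * (B * Y)) ≤ X ^ 2 + (B * Y) ^ 2 := by nlinarith [sq_nonneg (X - B * Y)]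
    set Z := B * Y with hZ
    have hZ0 : 0 ≤ Z := mul_nonneg hB0 hY
    have b1 : DG ≤ 2 * A * X ^ 2 + 2 * A * k * (X * Z) := by
      calc DG ≤ 2 * (X * ‖G' t‖) := hDG'
        _ ≤ 2 * (X * (A * (X + ψ t ^ (p - 1) * Y))) := by gcongr
        _ = 2 * A * X ^ 2 + 2 * A * ψ t ^ (η - 1) * (X * Z) := by rw [e1, hZ]; ring
        _ ≤ _ := by gcongr
    have b2 : B ^ 2 * DF ≤ 2 * A * Z ^ 2 + 2 * A * (3 * k) * (X * Z) := by
      calc B ^ 2 * DF ≤ B ^ 2 * (2 * (Y * ‖F' t‖)) := by gcongr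
        _ ≤ B ^ 2 * (2 * (Y * (A * (Y + ψ t ^ (-p) * X)))) := by gcongr
        _ = 2 * A * Z ^ 2 + 2 * A * (B * ψ t ^ (-p)) * (X * Z) := by rw [hZ]; ring
        _ ≤ _ := by rw [e2]; gcongr
    -- The weight decreases along the ray since η ≤ p, so the term from differentiating it has the
    -- favourable sign.
    have b3 : 2 * B * (-1 * (p - η) * ψ t ^ (p - η - 1)) * Y ^ 2 ≤ 0 := by
      have : 0 ≤ ψ t ^ (p - η - 1) := Real.rpow_nonneg hψt.le _
      have h3 : 0 ≤ 2 * B * ((p - η) * ψ t ^ (p - η - 1)) * Y ^ 2 := by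
        have : 0 ≤ p - η := by linarith
        positivity
      linarith
    have hk0 : 0 ≤ k := Real.rpow_nonneg h1t.le _
    have b4 : 2 * A * (X ^ 2 + Z ^ 2) ≤ 2 * A * (3 * k) * (X ^ 2 + Z ^ 2) := by
      have : 0 ≤ 2 * A * (X ^ 2 + Z ^ 2) := by positivity
      nlinarith
    have b5 : A * k * (2 * (X * Z)) ≤ A * k * (X ^ 2 + Z ^ 2) := by gcongr
    simp only [Pi.pow_apply, Nat.cast_ofNat, Nat.add_one_sub_one, pow_one]
    -- The constant 10 is 6 from the diagonal terms, through 1 ≤ 3k, plus 4 from the cross terms 8 X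
    -- Z ≤ 4 (X² + Z²).
    change DG + (2 * B * (-1 * (p - η) * ψ t ^ (p - η - 1)) * Y ^ 2 + B ^ 2 * DF) ≤
      10 * A * k * (X ^ 2 + Z ^ 2)
    linarith
  choose! D hD using key
  exact le_of_deriv_le_rpow_mul hη (by positivity : 0 ≤ 10 * A) (fun t => by positivity)
    (fun t a b => (hD t a b).1) (fun t a b => (hD t a b).2) h1 h2


/-! ### Pointwise growth towards the boundary point `1` -/

theorem one_sub_mem_slitPlane {ζ : ℂ} (h : ‖ζ‖ < 1) : 1 - ζ ∈ Complex.slitPlane := by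
  rw [sub_eq_add_neg]
  exact Complex.mem_slitPlane_of_norm_lt_one (by rwa [norm_neg])

/-- Comparable distances may be exchanged inside powers of either sign. -/
theorem rpow_le_three_rpow_mul {x y : ℝ} (hx : 0 < x) (hxy : x ≤ y) (hyx : y ≤ 3 * x) (a : ℝ) :
    x ^ a ≤ 3 ^ |a| * y ^ a := by
  have hy : 0 < y := hx.trans_le hxy
  rcases le_total 0 a with ha | ha
  · calc x ^ a ≤ y ^ a := Real.rpow_le_rpow hx.le hxy ha
      _ ≤ 3 ^ |a| * y ^ a := by
        refine le_mul_of_one_le_left (Real.rpow_nonneg hy.le _) ?_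
        exact Real.one_le_rpow (by norm_num) (abs_nonneg a)
  · calc x ^ a ≤ (y / 3) ^ a := Real.rpow_le_rpow_of_nonpos (by positivity) (by linarith) ha
      _ = 3 ^ |a| * y ^ a := by
        rw [Real.div_rpow hy.le (by norm_num), abs_of_nonpos ha, Real.rpow_neg (by norm_num)]
        ring

/-- The modulus of w^P is |w|^(Re P) exp(-arg w · Im P), and |arg w| ≤ π. -/
theorem norm_cpow_bounds {w : ℂ} (hw : w ≠ 0) (P : ℂ) :
    ‖w ^ P‖ ≤ Real.exp (Real.pi * |P.im|) * ‖w‖ ^ P.re ∧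
      ‖w‖ ^ P.re ≤ Real.exp (Real.pi * |P.im|) * ‖w ^ P‖ := by
  have h : |w.arg * P.im| ≤ Real.pi * |P.im| := by
    rw [abs_mul]
    exact mul_le_mul_of_nonneg_right (Complex.abs_arg_le_pi w) (abs_nonneg _)
  have hn : 0 ≤ ‖w‖ ^ P.re := Real.rpow_nonneg (norm_nonneg w) _
  rw [Complex.norm_cpow_of_ne_zero hw]
  constructor
  · rw [div_eq_mul_inv, ← Real.exp_neg, mul_comm]
    refine mul_le_mul_of_nonneg_right (Real.exp_le_exp.2 ?_) hn
    exact (neg_le_abs _).trans h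
  · rw [mul_div_assoc', le_div_iff₀ (Real.exp_pos _), mul_comm]
    refine mul_le_mul_of_nonneg_right (Real.exp_le_exp.2 ?_) hn
    exact (le_abs_self _).trans h

/-- The factor (1-ζ)^P removes the singular diagonal term from the equation for g. On each radius
the system then fits `system_bound`, with constants independent of the direction because the initial
values lie on the compact circle |ζ| = 1/2. -/
theorem norm_deriv_le_rpow {f g : ℂ → ℂ} {P : ℂ} {K : ℝ} (hK : 0 ≤ K) (hP : 0 < P.re)
    (hf : DifferentiableOn ℂ f (Metric.ball 0 1))
    (hg : DifferentiableOn ℂ g (Metric.ball 0 1 \ {0}))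
    (h1 : ∀ ζ : ℂ, 1 / 2 ≤ ‖ζ‖ → ‖ζ‖ < 1 → ‖deriv f ζ‖ ≤ K * (‖f ζ‖ + ‖g ζ‖))
    (h2 : ∀ ζ : ℂ, 1 / 2 ≤ ‖ζ‖ → ‖ζ‖ < 1 →
      ‖deriv g ζ - P / (1 - ζ) * g ζ‖ ≤ K * (‖g ζ‖ + ‖f ζ‖ / ‖1 - ζ‖)) :
    ∃ C : ℝ, 0 ≤ C ∧ ∀ ζ : ℂ, 1 / 2 ≤ ‖ζ‖ → ‖ζ‖ < 1 → ‖deriv f ζ‖ ≤ C * ‖1 - ζ‖ ^ (-P.re) := by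
  set p := P.re with hp
  set η := min (p / 2) (1 / 2) with hη
  have hη0 : 0 < η := lt_min (by linarith) (by norm_num)
  have hη2 : η ≤ 1 / 2 := min_le_right _ _
  have hηp : η ≤ p := (min_le_left _ _).trans (by linarith)
  set M := Real.exp (Real.pi * |P.im|) with hM
  have hM1 : 1 ≤ M := Real.one_le_exp (by positivity)
  have hfd : ∀ ζ : ℂ, ‖ζ‖ < 1 → HasDerivAt f (deriv f ζ) ζ := fun ζ h =>
    (hf.differentiableAt (Metric.isOpen_ball.mem_nhds (by simpa using h))).hasDerivAt
  have hgd : ∀ ζ : ℂ, 1 / 2 ≤ ‖ζ‖ → ‖ζ‖ < 1 → HasDerivAt g (deriv g ζ) ζ := fun ζ h h' => by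
    refine (hg.differentiableAt ((Metric.isOpen_ball.sdiff isClosed_singleton).mem_nhds
      ⟨by simpa using h', ?_⟩)).hasDerivAt
    rintro rfl
    norm_num at h
  set G : ℂ → ℂ := fun ζ => (1 - ζ) ^ P * g ζ with hG
  have hw0 : ∀ ζ : ℂ, ‖ζ‖ < 1 → 1 - ζ ≠ 0 := fun ζ h =>
    Complex.slitPlane_ne_zero (one_sub_mem_slitPlane h)
  have hGd : ∀ ζ : ℂ, 1 / 2 ≤ ‖ζ‖ → ‖ζ‖ < 1 →
      HasDerivAt G ((1 - ζ) ^ P * (deriv g ζ - P / (1 - ζ) * g ζ)) ζ := fun ζ h h' => by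
    have e1 : HasDerivAt (fun ζ : ℂ => (1 - ζ) ^ P) (P * (1 - ζ) ^ (P - 1) * -1) ζ :=
      ((hasDerivAt_id ζ).const_sub 1).cpow_const (one_sub_mem_slitPlane h')
    refine (e1.mul (hgd ζ h h')).congr_deriv ?_
    rw [Complex.cpow_sub _ _ (hw0 ζ h'), Complex.cpow_one]
    ring
  have hgG : ∀ ζ : ℂ, ‖ζ‖ < 1 → ‖g ζ‖ ≤ M * (‖1 - ζ‖ ^ (-p) * ‖G ζ‖) := fun ζ h => by
    have hpos : 0 < ‖1 - ζ‖ := norm_pos_iff.2 (hw0 ζ h)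
    have e := (norm_cpow_bounds (hw0 ζ h) P).2
    have : 0 < ‖1 - ζ‖ ^ p := Real.rpow_pos_of_pos hpos p
    rw [Real.rpow_neg hpos.le, hG, norm_mul]
    calc ‖g ζ‖ = (‖1 - ζ‖ ^ p)⁻¹ * (‖1 - ζ‖ ^ p * ‖g ζ‖) := by field_simp
      _ ≤ (‖1 - ζ‖ ^ p)⁻¹ * (M * ‖(1 - ζ) ^ P‖ * ‖g ζ‖) := by gcongr
      _ = _ := by ring
  -- initial values
  have hsph : IsCompact (Metric.sphere (0 : ℂ) (1 / 2)) := isCompact_sphere _ _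
  have hsn : ∀ ζ ∈ Metric.sphere (0 : ℂ) (1 / 2), 1 / 2 ≤ ‖ζ‖ ∧ ‖ζ‖ < 1 := fun ζ hζ => by
    rw [mem_sphere_zero_iff_norm] at hζ
    rw [hζ]; norm_num
  obtain ⟨C₀, hC₀⟩ := hsph.exists_bound_of_continuousOn (f := f) fun ζ hζ =>
    (hfd ζ (hsn ζ hζ).2).continuousAt.continuousWithinAt
  obtain ⟨C₁, hC₁⟩ := hsph.exists_bound_of_continuousOn (f := G) fun ζ hζ =>
    (hGd ζ (hsn ζ hζ).1 (hsn ζ hζ).2).continuousAt.continuousWithinAt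
  set A := K * (M * 3 ^ (p + 1)) with hA
  have h31 : (1 : ℝ) ≤ 3 ^ (p + 1) := Real.one_le_rpow (by norm_num) (by linarith)
  have hMA : 1 ≤ M * 3 ^ (p + 1) := one_le_mul_of_one_le_of_one_le hM1 h31
  have hA0 : 0 ≤ A := by positivity
  set S := (C₁ ^ 2 + (3 ^ (p - η) * C₀) ^ 2) * Real.exp (10 * A / η * (1 / 2 : ℝ) ^ η) with hS
  have main : ∀ ζ : ℂ, 1 / 2 ≤ ‖ζ‖ → ‖ζ‖ < 1 →
      ‖G ζ‖ ^ 2 + (‖1 - ζ‖ ^ (p - η) * ‖f ζ‖) ^ 2 ≤ S := by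
    intro ζ hζ1 hζ2
    have hζ0 : (‖ζ‖ : ℂ) ≠ 0 := by
      exact_mod_cast (by linarith : (0 : ℝ) < ‖ζ‖).ne'
    set e : ℂ := ζ / ‖ζ‖ with he
    have hen : ‖e‖ = 1 := by
      rw [he, norm_div, Complex.norm_real, norm_norm, div_self]
      exact_mod_cast hζ0
    have hζe : ((‖ζ‖ : ℝ) : ℂ) * e = ζ := by rw [he]; field_simp
    have hnorm : ∀ t : ℝ, 1 / 2 ≤ t → ‖(t : ℂ) * e‖ = t := fun t ht => by
      rw [norm_mul, hen, mul_one, Complex.norm_real, Real.norm_of_nonneg (by linarith)]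
    set d := ‖1 - e‖ with hd
    have hd2 : d ≤ 2 := by
      calc d ≤ ‖(1 : ℂ)‖ + ‖e‖ := norm_sub_le _ _
        _ = 2 := by rw [hen]; norm_num
    -- The triangle inequality bounds both 1 - t and d - (1-t) by |1 - te|; hence the factor 3.
    have hcomp : ∀ t : ℝ, 1 / 2 ≤ t → t < 1 →
        ‖1 - (t : ℂ) * e‖ ≤ 1 - t + d ∧ 1 - t + d ≤ 3 * ‖1 - (t : ℂ) * e‖ := by
      intro t ht1 ht2
      have n1 : ‖((1 - t : ℝ) : ℂ) * e‖ = 1 - t := by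
        rw [norm_mul, hen, mul_one, Complex.norm_real, Real.norm_of_nonneg (by linarith)]
      have e1 : 1 - (t : ℂ) * e = ((1 - t : ℝ) : ℂ) * e + (1 - e) := by push_cast; ring
      have i1 : ‖1 - (t : ℂ) * e‖ ≤ 1 - t + d := by
        rw [e1]; exact (norm_add_le _ _).trans_eq (by rw [n1])
      have i2 : 1 - t ≤ ‖1 - (t : ℂ) * e‖ := by
        have := norm_sub_norm_le (1 : ℂ) ((t : ℂ) * e)
        rwa [hnorm t ht1, norm_one] at this
      have i3 : d ≤ ‖1 - (t : ℂ) * e‖ + (1 - t) := by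
        have e2 : 1 - e = (1 - (t : ℂ) * e) - ((1 - t : ℝ) : ℂ) * e := by rw [e1]; ring
        rw [hd, e2]
        exact (norm_sub_le _ _).trans_eq (by rw [n1])
      exact ⟨i1, by linarith⟩
    have hray : ∀ t : ℝ, HasDerivAt (fun t : ℝ => (t : ℂ) * e) e t := fun t => by
      simpa using (Complex.ofRealCLM.hasDerivAt (x := t)).mul_const e
    have hsys := system_bound (F := fun t => f (t * e)) (G := fun t => G (t * e))
      (F' := fun t => e * deriv f (t * e)) (G' := fun t => e * ((1 - t * e) ^ P *
        (deriv g (t * e) - P / (1 - t * e) * g (t * e)))) (t := ‖ζ‖) hη0 hη2 hηp hA0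
      (norm_nonneg (1 - e)) hd2 (fun t ht1 ht2 => ?_) (fun t ht1 ht2 => ?_) (fun t ht1 ht2 => ?_)
      (fun t ht1 ht2 => ?_) hζ1 hζ2
    · rw [hζe] at hsys
      have hin : ‖((1 / 2 : ℝ) : ℂ) * e‖ = 1 / 2 := hnorm _ le_rfl
      have hmem : ((1 / 2 : ℝ) : ℂ) * e ∈ Metric.sphere (0 : ℂ) (1 / 2) := by
        rw [mem_sphere_zero_iff_norm]; exact hin
      have hpη : 0 ≤ p - η := by linarith
      have i1 := hC₀ _ hmem
      have i2 := hC₁ _ hmem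
      refine le_trans ?_ (hsys.trans ?_)
      · have hc := (hcomp ‖ζ‖ hζ1 hζ2).1
        rw [hζe] at hc
        gcongr
      · rw [hS]
        gcongr
        linarith
    · exact (hfd _ (by rw [hnorm t ht1]; exact ht2)).scomp t (hray t)
    · exact (hGd _ (by rw [hnorm t ht1]; exact ht1) (by rw [hnorm t ht1]; exact ht2)).scomp t
        (hray t)
    · have n1 : 1 / 2 ≤ ‖(t : ℂ) * e‖ := by rw [hnorm t ht1]; exact ht1
      have n2 : ‖(t : ℂ) * e‖ < 1 := by rw [hnorm t ht1]; exact ht2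
      have hpos : 0 < ‖1 - (t : ℂ) * e‖ := norm_pos_iff.2 (hw0 _ n2)
      obtain ⟨c1, c2⟩ := hcomp t ht1 ht2
      have hψ : 0 ≤ (1 - t + d) ^ (-p) := Real.rpow_nonneg (hpos.le.trans c1) _
      have i1 := rpow_le_three_rpow_mul hpos c1 c2 (-p)
      have i2 : (3 : ℝ) ^ |(-p)| ≤ 3 ^ (p + 1) := by
        rw [abs_neg, abs_of_pos hP]
        exact Real.rpow_le_rpow_of_exponent_le (by norm_num) (by linarith)
      rw [norm_mul, hen, one_mul]
      calc _ ≤ K * (‖f (t * e)‖ + ‖g (t * e)‖) := h1 _ n1 n2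
        _ ≤ K * (1 * ‖f (t * e)‖ + M * (3 ^ |(-p)| * (1 - t + d) ^ (-p) * ‖G (t * e)‖)) := by
          have := hgG _ n2
          rw [one_mul]
          gcongr
          refine this.trans ?_
          gcongr
        _ ≤ K * ((M * 3 ^ (p + 1)) * ‖f (t * e)‖ +
            M * (3 ^ (p + 1) * (1 - t + d) ^ (-p) * ‖G (t * e)‖)) := by gcongr
        _ = _ := by rw [hA]; ring
    · have n1 : 1 / 2 ≤ ‖(t : ℂ) * e‖ := by rw [hnorm t ht1]; exact ht1
      have n2 : ‖(t : ℂ) * e‖ < 1 := by rw [hnorm t ht1]; exact ht2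
      have hpos : 0 < ‖1 - (t : ℂ) * e‖ := norm_pos_iff.2 (hw0 _ n2)
      obtain ⟨c1, c2⟩ := hcomp t ht1 ht2
      have hψ : 0 ≤ (1 - t + d) ^ (p - 1) := Real.rpow_nonneg (hpos.le.trans c1) _
      have i1 := rpow_le_three_rpow_mul hpos c1 c2 (p - 1)
      have i2 : (3 : ℝ) ^ |p - 1| ≤ 3 ^ (p + 1) := by
        refine Real.rpow_le_rpow_of_exponent_le (by norm_num) ?_
        rw [abs_le]; constructor <;> linarith
      have i3 := (norm_cpow_bounds (hw0 _ n2) P).1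
      have i4 : ‖1 - (t : ℂ) * e‖ ^ p / ‖1 - (t : ℂ) * e‖ = ‖1 - (t : ℂ) * e‖ ^ (p - 1) := by
        rw [Real.rpow_sub_one hpos.ne']
      rw [norm_mul, hen, one_mul, norm_mul]
      calc _ ≤ ‖(1 - (t : ℂ) * e) ^ P‖ * (K * (‖g (t * e)‖ + ‖f (t * e)‖ / ‖1 - (t : ℂ) * e‖)) := by
            gcongr
            exact h2 _ n1 n2
        _ = K * (1 * ‖G (t * e)‖ +
            ‖(1 - (t : ℂ) * e) ^ P‖ / ‖1 - (t : ℂ) * e‖ * ‖f (t * e)‖) := by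
          rw [hG, norm_mul]; ring
        _ ≤ K * (1 * ‖G (t * e)‖ + M * ‖1 - (t : ℂ) * e‖ ^ p / ‖1 - (t : ℂ) * e‖ *
            ‖f (t * e)‖) := by gcongr
        _ = K * (1 * ‖G (t * e)‖ + M * ‖1 - (t : ℂ) * e‖ ^ (p - 1) * ‖f (t * e)‖) := by
          rw [mul_div_assoc, i4]
        _ ≤ K * (1 * ‖G (t * e)‖ + M * (3 ^ |p - 1| * (1 - t + d) ^ (p - 1)) * ‖f (t * e)‖) := by
          gcongr
        _ ≤ K * ((M * 3 ^ (p + 1)) * ‖G (t * e)‖ +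
            M * (3 ^ (p + 1) * (1 - t + d) ^ (p - 1)) * ‖f (t * e)‖) := by gcongr
        _ = _ := by rw [hA]; ring
  refine ⟨K * (2 * √S + M * √S), by positivity, fun ζ hζ1 hζ2 => ?_⟩
  have hm := main ζ hζ1 hζ2
  have hpos : 0 < ‖1 - ζ‖ := norm_pos_iff.2 (hw0 ζ hζ2)
  have hw2 : ‖1 - ζ‖ ≤ 2 := by
    calc ‖1 - ζ‖ ≤ ‖(1 : ℂ)‖ + ‖ζ‖ := norm_sub_le _ _
      _ ≤ 2 := by rw [norm_one]; linarith
  have hGS : ‖G ζ‖ ≤ √S := Real.le_sqrt_of_sq_le (by nlinarith [sq_nonneg (‖1 - ζ‖ ^ (p - η) * ‖f ζ‖)])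
  have hfS : ‖1 - ζ‖ ^ (p - η) * ‖f ζ‖ ≤ √S := Real.le_sqrt_of_sq_le (by nlinarith [sq_nonneg ‖G ζ‖])
  -- The energy gives the slightly better exponent η - p; the surplus |1-ζ|^η is at most 2.
  have hfb : ‖f ζ‖ ≤ 2 * √S * ‖1 - ζ‖ ^ (-p) := by
    have e1 : ‖f ζ‖ = ‖1 - ζ‖ ^ η * ‖1 - ζ‖ ^ (-p) * (‖1 - ζ‖ ^ (p - η) * ‖f ζ‖) := by
      rw [← Real.rpow_add hpos, ← mul_assoc, ← Real.rpow_add hpos]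
      ring_nf
      simp
    have e2 : ‖1 - ζ‖ ^ η ≤ 2 := by
      calc ‖1 - ζ‖ ^ η ≤ 2 ^ η := Real.rpow_le_rpow hpos.le hw2 hη0.le
        _ ≤ 2 ^ (1 : ℝ) := Real.rpow_le_rpow_of_exponent_le (by norm_num) (by linarith)
        _ = 2 := Real.rpow_one 2
    have e3 : 0 ≤ ‖1 - ζ‖ ^ (-p) := Real.rpow_nonneg hpos.le _
    rw [e1]
    calc _ ≤ 2 * ‖1 - ζ‖ ^ (-p) * √S := by gcongr
      _ = _ := by ring
  have hgb : ‖g ζ‖ ≤ M * √S * ‖1 - ζ‖ ^ (-p) := by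
    have e3 : 0 ≤ ‖1 - ζ‖ ^ (-p) := Real.rpow_nonneg hpos.le _
    calc _ ≤ M * (‖1 - ζ‖ ^ (-p) * ‖G ζ‖) := hgG ζ hζ2
      _ ≤ M * (‖1 - ζ‖ ^ (-p) * √S) := by gcongr
      _ = _ := by ring
  calc _ ≤ K * (‖f ζ‖ + ‖g ζ‖) := h1 ζ hζ1 hζ2
    _ ≤ K * (2 * √S * ‖1 - ζ‖ ^ (-p) + M * √S * ‖1 - ζ‖ ^ (-p)) := by gcongr
    _ = _ := by ring


/-! ### Taylor coefficients from means over circles -/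

/-- |1 - r e^(iθ)|² = (1-r)² + 4r sin²(θ/2) is at least sin²(θ/2) for r ≥ 1/2, and Jordan's
inequality bounds the sine below. The two entries of the minimum are the distances to θ = 0 and θ =
2π. -/
theorem norm_one_sub_circleMap_ge {r θ : ℝ} (h1 : 1 / 2 ≤ r) (hθ0 : 0 ≤ θ)
    (hθ : θ ≤ 2 * Real.pi) : min (θ / Real.pi) ((2 * Real.pi - θ) / Real.pi) ≤
      ‖1 - circleMap 0 r θ‖ := by
  have hpi := Real.pi_pos
  have hsin : Real.sin (θ / 2) ≤ ‖1 - circleMap 0 r θ‖ := by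
    refine (le_abs_self _).trans (abs_le_of_sq_le_sq ?_ (norm_nonneg _))
    have e1 : 1 - circleMap 0 r θ =
        ((1 - r * Real.cos θ : ℝ) : ℂ) + ((-(r * Real.sin θ) : ℝ) : ℂ) * Complex.I := by
      rw [circleMap, zero_add, Complex.exp_mul_I]; push_cast; ring
    have e2 : ‖1 - circleMap 0 r θ‖ ^ 2 = (1 - r * Real.cos θ) ^ 2 + (r * Real.sin θ) ^ 2 := by
      rw [e1, Complex.sq_norm, Complex.normSq_add_mul_I, neg_sq]
    have e3 : Real.cos θ = 1 - 2 * Real.sin (θ / 2) ^ 2 := by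
      have h1 := Real.cos_two_mul (θ / 2)
      rw [mul_div_cancel₀ _ (two_ne_zero)] at h1
      have h2 := Real.sin_sq_add_cos_sq (θ / 2)
      linarith
    have e4 := Real.sin_sq_add_cos_sq θ
    have e5 : ‖1 - circleMap 0 r θ‖ ^ 2 = (1 - r) ^ 2 + 4 * r * Real.sin (θ / 2) ^ 2 := by
      rw [e2]
      linear_combination r ^ 2 * e4 - 2 * r * e3
    rw [e5]
    nlinarith [sq_nonneg (1 - r), sq_nonneg (Real.sin (θ / 2))]
  refine le_trans ?_ hsin
  rcases le_total θ Real.pi with h | h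
  · refine (min_le_left _ _).trans ?_
    have := Real.mul_le_sin (x := θ / 2) (by linarith) (by linarith)
    calc θ / Real.pi = 2 / Real.pi * (θ / 2) := by ring
      _ ≤ _ := this
  · refine (min_le_right _ _).trans ?_
    have := Real.mul_le_sin (x := Real.pi - θ / 2) (by linarith) (by linarith)
    rw [Real.sin_pi_sub] at this
    calc (2 * Real.pi - θ) / Real.pi = 2 / Real.pi * (Real.pi - θ / 2) := by ring
      _ ≤ _ := this

/-- Cauchy's estimate with the mean of |k| in place of its maximum; the mean barely feels a
singularity at a single boundary point. -/
theorem norm_coeff_le_of_circle {k : ℂ → ℂ} {c : ℕ → ℂ}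
    (hs : ∀ ζ ∈ Metric.ball (0 : ℂ) 1, HasSum (fun n => c n * ζ ^ n) (k ζ))
    (hk : DifferentiableOn ℂ k (Metric.ball 0 1)) {r : ℝ} (h0 : 0 < r) (h1 : r < 1) (n : ℕ) :
    ‖c n‖ ≤ ((2 * Real.pi)⁻¹ * ∫ θ : ℝ in 0..2 * Real.pi, ‖k (circleMap 0 r θ)‖) * r⁻¹ ^ n := by
  have e1 : HasFPowerSeriesAt k (FormalMultilinearSeries.ofScalars ℂ c) 0 := by
    rw [hasFPowerSeriesAt_iff]
    filter_upwards [Metric.ball_mem_nhds (0 : ℂ) one_pos] with ζ hζ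
    rw [zero_add]
    refine (hs ζ hζ).congr_fun fun n => ?_
    rw [FormalMultilinearSeries.coeff_ofScalars, smul_eq_mul, mul_comm]
  lift r to NNReal using h0.le
  have e2 := ((hk.mono (Metric.closedBall_subset_ball h1)).hasFPowerSeriesOnBall
    (by exact_mod_cast h0)).hasFPowerSeriesAt
  have e3 := norm_cauchyPowerSeries_le k 0 r n
  rw [← e1.eq_formalMultilinearSeries e2, FormalMultilinearSeries.ofScalars_norm,
    abs_of_pos h0] at e3
  exact e3

/-- The majorants θ^(-η) and (2π-θ)^(-η) are integrable and independent of r, so J depends on η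
alone. -/
theorem exists_circle_integral_bound {η : ℝ} (hη0 : 0 < η) (hη1 : η ≤ 1 / 2) : ∃ J : ℝ, 0 ≤ J ∧
    ∀ (k : ℂ → ℂ) (B r : ℝ), 1 / 2 ≤ r → r < 1 → 0 ≤ B → ContinuousOn k (Metric.ball 0 1) →
      (∀ ζ : ℂ, ‖ζ‖ = r → ‖k ζ‖ ≤ B * ‖1 - ζ‖ ^ (-η)) →
      ∫ θ : ℝ in 0..2 * Real.pi, ‖k (circleMap 0 r θ)‖ ≤ B * J := by
  have hpi := Real.pi_pos
  have i1 : IntervalIntegrable (fun θ : ℝ => Real.pi ^ η * θ ^ (-η)) MeasureTheory.volume 0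
      (2 * Real.pi) := (intervalIntegral.intervalIntegrable_rpow' (by linarith)).const_mul _
  have i2 : IntervalIntegrable (fun θ : ℝ => Real.pi ^ η * (2 * Real.pi - θ) ^ (-η))
      MeasureTheory.volume 0 (2 * Real.pi) := by
    have := (i1.comp_sub_left (2 * Real.pi)).symm
    simpa using this
  refine ⟨∫ θ : ℝ in 0..2 * Real.pi, (Real.pi ^ η * θ ^ (-η) +
    Real.pi ^ η * (2 * Real.pi - θ) ^ (-η)), ?_, fun k B r h1 h2 hB hk hle => ?_⟩
  · refine intervalIntegral.integral_nonneg (by positivity) fun θ hθ => ?_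
    have : 0 ≤ 2 * Real.pi - θ := by linarith [hθ.2]
    have := hθ.1
    positivity
  · rw [← intervalIntegral.integral_const_mul]
    have hmem : ∀ θ, circleMap 0 r θ ∈ Metric.ball (0 : ℂ) 1 := fun θ => by
      rw [mem_ball_zero_iff, norm_circleMap_zero, abs_of_pos (by linarith)]
      exact h2
    refine intervalIntegral.integral_mono_on_of_le_Ioo (by positivity) ?_
      ((i1.add i2).const_mul B) fun θ hθ => ?_
    · refine Continuous.intervalIntegrable ?_ _ _
      exact (hk.comp_continuous (continuous_circleMap 0 r) hmem).norm
    · have hn : ‖circleMap 0 r θ‖ = r := by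
        rw [norm_circleMap_zero, abs_of_pos (by linarith)]
      refine (hle _ hn).trans (mul_le_mul_of_nonneg_left ?_ hB)
      have hge := norm_one_sub_circleMap_ge h1 hθ.1.le hθ.2.le
      have p1 : 0 < θ := hθ.1
      have p2 : 0 < 2 * Real.pi - θ := by linarith [hθ.2]
      have key : ∀ x : ℝ, 0 < x → x / Real.pi ≤ ‖1 - circleMap 0 r θ‖ →
          ‖1 - circleMap 0 r θ‖ ^ (-η) ≤ Real.pi ^ η * x ^ (-η) := fun x hx hxle => by
        calc _ ≤ (x / Real.pi) ^ (-η) :=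
              Real.rpow_le_rpow_of_nonpos (by positivity) hxle (by linarith)
          _ = _ := by
            rw [Real.div_rpow hx.le hpi.le, Real.rpow_neg hpi.le, div_inv_eq_mul, mul_comm]
      rcases min_le_iff.1 hge with h | h
      · exact (key _ p1 h).trans (le_add_of_nonneg_right (by positivity))
      · exact (key _ p2 h).trans (le_add_of_nonneg_left (by positivity))

/-- If `f'` grows at most like `|1 - ζ| ^ (-p)`, the Taylor coefficients of `f`, divided by
`n ^ p`, are summable. -/
theorem summable_coeff_of_norm_deriv_le {f : ℂ → ℂ} {b : ℕ → ℂ} {p C : ℝ} (hp : 0 < p)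
    (hC : 0 ≤ C) (hs : ∀ ζ ∈ Metric.ball (0 : ℂ) 1, HasSum (fun n => b n * ζ ^ n) (f ζ))
    (hf' : ∀ ζ : ℂ, 1 / 2 ≤ ‖ζ‖ → ‖ζ‖ < 1 → ‖deriv f ζ‖ ≤ C * ‖1 - ζ‖ ^ (-p)) :
    Summable fun n : ℕ => ‖b n‖ * (n : ℝ) ^ (-p) := by
  set η := min (p / 2) (1 / 2) with hη
  have hη0 : 0 < η := lt_min (by linarith) (by norm_num)
  have hη2 : η ≤ 1 / 2 := min_le_right _ _
  have hηp : η ≤ p := (min_le_left _ _).trans (by linarith)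
  have hconv : ConvergesInBall b (fun n => n) 1 := convergesInBall_of_summable fun r h0 h1 =>
    (hs r (by simpa [abs_of_nonneg h0] using h1)).summable
  have hfeq : ∀ ζ ∈ Metric.ball (0 : ℂ) 1, f =ᶠ[𝓝 ζ] fun w => ∑' n, b n * w ^ n := fun ζ hζ => by
    filter_upwards [Metric.isOpen_ball.mem_nhds hζ] with w hw using (hs w hw).tsum_eq.symm
  have hfd : ∀ ζ ∈ Metric.ball (0 : ℂ) 1, DifferentiableAt ℂ f ζ := fun ζ hζ => by
    obtain ⟨D, hD, -⟩ := hconv.hasDerivAt (by simpa using hζ)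
    exact (hD.congr_of_eventuallyEq (hfeq ζ hζ)).differentiableAt
  have hks : ∀ ζ ∈ Metric.ball (0 : ℂ) 1,
      HasSum (fun n => n * b n * ζ ^ n) (ζ * deriv f ζ) := fun ζ hζ => by
    obtain ⟨D, hD, hsum⟩ := hconv.hasDerivAt (by simpa using hζ)
    rw [(hD.congr_of_eventuallyEq (hfeq ζ hζ)).deriv]
    exact hsum.congr_fun fun n => by ring
  have hfd' : DifferentiableOn ℂ f (Metric.ball 0 1) := fun ζ hζ =>
    (hfd ζ hζ).differentiableWithinAt
  have hkd : DifferentiableOn ℂ (fun ζ => ζ * deriv f ζ) (Metric.ball 0 1) :=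
    differentiableOn_id.mul (hfd'.deriv Metric.isOpen_ball)
  obtain ⟨J, hJ, hbound⟩ := exists_circle_integral_bound hη0 hη2
  have hmain : ∀ n : ℕ, 1 ≤ n → ‖b n‖ * (n : ℝ) ^ (-p) ≤
      ((2 * Real.pi)⁻¹ * (C * 2 ^ (p - η) * J) * Real.exp 1) * (n : ℝ) ^ (-(1 + η)) := by
    intro n hn
    have hn0 : (1 : ℝ) ≤ n := by exact_mod_cast hn
    -- This radius keeps r^(-n) below e while (1-r)^(-(p-η)) costs only n^(p-η) up to a constant.
    set r : ℝ := n / (n + 1) with hr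
    have hr1 : r < 1 := by rw [hr, div_lt_one (by linarith)]; linarith
    have hr2 : 1 / 2 ≤ r := by rw [hr, div_le_div_iff₀ (by norm_num) (by linarith)]; linarith
    have h1r : 1 - r = (n + 1 : ℝ)⁻¹ := by rw [hr]; field_simp; ring
    have hB : ∀ ζ : ℂ, ‖ζ‖ = r → ‖ζ * deriv f ζ‖ ≤
        C * (1 - r) ^ (-(p - η)) * ‖1 - ζ‖ ^ (-η) := by
      intro ζ hζ
      have hge : 1 - r ≤ ‖1 - ζ‖ := by
        have := norm_sub_norm_le (1 : ℂ) ζ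
        rwa [hζ, norm_one] at this
      have hpos : 0 < ‖1 - ζ‖ := by linarith
      -- Only the part -(p-η) of the exponent is estimated by its maximum on the circle; the part -η
      -- is left to be integrated.
      have e1 : ‖1 - ζ‖ ^ (-p) = ‖1 - ζ‖ ^ (-(p - η)) * ‖1 - ζ‖ ^ (-η) := by
        rw [← Real.rpow_add hpos]; ring_nf
      have e2 : ‖1 - ζ‖ ^ (-(p - η)) ≤ (1 - r) ^ (-(p - η)) :=
        Real.rpow_le_rpow_of_nonpos (by linarith) hge (by linarith)
      have e3 : 0 ≤ ‖1 - ζ‖ ^ (-η) := Real.rpow_nonneg hpos.le _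
      calc ‖ζ * deriv f ζ‖ ≤ 1 * ‖deriv f ζ‖ := by
            rw [norm_mul, hζ]; gcongr
        _ ≤ C * (‖1 - ζ‖ ^ (-(p - η)) * ‖1 - ζ‖ ^ (-η)) := by
            rw [one_mul, ← e1]
            exact hf' ζ (by rw [hζ]; exact hr2) (by rw [hζ]; exact hr1)
        _ ≤ C * ((1 - r) ^ (-(p - η)) * ‖1 - ζ‖ ^ (-η)) := by gcongr
        _ = _ := by ring
    have hCr : 0 ≤ C * (1 - r) ^ (-(p - η)) :=
      mul_nonneg hC (Real.rpow_nonneg (by linarith) _)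
    have i1 := norm_coeff_le_of_circle hks hkd (by linarith : 0 < r) hr1 n
    have i2 := hbound _ _ r hr2 hr1 hCr hkd.continuousOn hB
    have i3 : r⁻¹ ^ n ≤ Real.exp 1 := by
      have e1 : r⁻¹ = 1 + (n : ℝ)⁻¹ := by rw [hr]; field_simp
      rw [e1]
      calc (1 + (n : ℝ)⁻¹) ^ n ≤ Real.exp ((n : ℝ)⁻¹) ^ n := by
            gcongr
            rw [add_comm]; exact Real.add_one_le_exp _
        _ = Real.exp 1 := by
            rw [← Real.exp_nat_mul, mul_inv_cancel₀ (by linarith)]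
    have i4 : (1 - r) ^ (-(p - η)) ≤ 2 ^ (p - η) * (n : ℝ) ^ (p - η) := by
      rw [h1r, Real.inv_rpow (by linarith), ← Real.rpow_neg (by linarith), neg_neg,
        ← Real.mul_rpow (by norm_num) (by linarith)]
      exact Real.rpow_le_rpow (by linarith) (by linarith) (by linarith)
    have i5 : (n : ℝ) * ‖b n‖ ≤
        ((2 * Real.pi)⁻¹ * (C * (2 ^ (p - η) * (n : ℝ) ^ (p - η)) * J)) * Real.exp 1 := by
      have hpi := Real.pi_pos
      calc (n : ℝ) * ‖b n‖ = ‖(n : ℂ) * b n‖ := by rw [norm_mul, Complex.norm_natCast]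
        _ ≤ _ := i1
        _ ≤ ((2 * Real.pi)⁻¹ * (C * (1 - r) ^ (-(p - η)) * J)) * Real.exp 1 := by
          have : 0 < r := by linarith
          gcongr
        _ ≤ _ := by gcongr
    have hn0' : (0 : ℝ) < n := by linarith
    have e1 : (n : ℝ) ^ (-p) = n * ((n : ℝ) ^ (-p) * (n : ℝ)⁻¹) := by field_simp
    have e2 : (n : ℝ) ^ (-(1 + η)) = (n : ℝ) ^ (p - η) * ((n : ℝ) ^ (-p) * (n : ℝ)⁻¹) := by
      rw [← Real.rpow_neg_one, ← Real.rpow_add hn0', ← Real.rpow_add hn0']; ring_nf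
    have e3 : 0 ≤ (n : ℝ) ^ (-p) * (n : ℝ)⁻¹ := by positivity
    rw [e1, e2]
    calc _ = n * ‖b n‖ * ((n : ℝ) ^ (-p) * (n : ℝ)⁻¹) := by ring
      _ ≤ ((2 * Real.pi)⁻¹ * (C * (2 ^ (p - η) * (n : ℝ) ^ (p - η)) * J)) * Real.exp 1 *
          ((n : ℝ) ^ (-p) * (n : ℝ)⁻¹) := by gcongr
      _ = _ := by ring
  have hsum : Summable fun n : ℕ => ((2 * Real.pi)⁻¹ * (C * 2 ^ (p - η) * J) * Real.exp 1) *
      (n : ℝ) ^ (-(1 + η)) := (Real.summable_nat_rpow.2 (by linarith)).mul_left _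
  refine Summable.of_nonneg_of_le (fun n => by positivity) (fun n => ?_) hsum
  -- For n = 0 both sides vanish, as `0 ^ x = 0` for real x ≠ 0.
  rcases Nat.eq_zero_or_pos n with rfl | hn
  · rw [Nat.cast_zero, Real.zero_rpow (by linarith), mul_zero, Real.zero_rpow (by linarith),
      mul_zero]
  · exact hmain n hn


/-! ### Continuation of `v` to the disc whose boundary circle passes through `0` -/

theorem ConvergesInBall.hasSum_sub {coef : ℕ → ℂ} {R : ℝ} (h : ConvergesInBall coef (fun n => n) R)
    {c z : ℂ} (hz : z ∈ Metric.ball c R) :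
    HasSum (fun n => coef n * (z - c) ^ n) (∑' n, coef n * (z - c) ^ n) :=
  (h.summable (by simpa [dist_eq_norm] using hz)).hasSum

theorem ConvergesInBall.differentiableOn_sub {coef : ℕ → ℂ} {R : ℝ}
    (h : ConvergesInBall coef (fun n => n) R) (c : ℂ) :
    DifferentiableOn ℂ (fun z => ∑' n, coef n * (z - c) ^ n) (Metric.ball c R) := fun z hz => by
  obtain ⟨D, hD, -⟩ := h.hasDerivAt (z := z - c) (by simpa [dist_eq_norm] using hz)
  have h1 : HasDerivAt (fun z => z - c) 1 z := (hasDerivAt_id z).sub_const c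
  exact (HasDerivAt.comp z hD h1).differentiableAt.differentiableWithinAt

/-- Division by an affine function. -/
theorem exists_eq_affine_mul {D : Set ℂ} (hD : IsOpen D) {k : ℂ → ℂ}
    (hk : DifferentiableOn ℂ k D) {c A B : ℂ} (hAB : A ≠ 0 ∨ B ≠ 0)
    (h0 : ∀ z ∈ D \ {c}, A * z - B = 0 → k z = 0) :
    ∃ g : ℂ → ℂ, DifferentiableOn ℂ g (D \ {c}) ∧ ∀ z ∈ D \ {c}, k z = (A * z - B) * g z := by
  by_cases hz : A ≠ 0 ∧ B / A ∈ D \ {c}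
  · obtain ⟨hA, hz⟩ := hz
    have e : A * (B / A) - B = 0 := by rw [mul_div_cancel₀ _ hA, sub_self]
    refine ⟨fun z => dslope k (B / A) z / A, ?_, fun z _ => ?_⟩
    · exact (((Complex.differentiableOn_dslope (hD.mem_nhds hz.1)).2 hk).mono
        Set.sdiff_subset).div_const A
    · have h1 := sub_smul_dslope k (B / A) z
      rw [h0 _ hz e, sub_zero, smul_eq_mul] at h1
      rw [← h1]; field_simp
  · have hne : ∀ z ∈ D \ {c}, A * z - B ≠ 0 := fun z hzD h => by
      have hA : A ≠ 0 := by
        rintro rfl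
        rcases hAB with h' | h'
        · exact h' rfl
        · exact h' (by linear_combination -h)
      refine hz ⟨hA, ?_⟩
      rwa [show B / A = z by rw [div_eq_iff hA]; linear_combination -h]
    refine ⟨fun z => k z / (A * z - B), (hk.mono Set.sdiff_subset).div (by fun_prop) hne,
      fun z hzD => ?_⟩
    have := hne z hzD
    field_simp

/-- The affine factor has at most one zero, and continuity of X fills that point. -/
theorem eq_zero_of_affine_sq_mul {D : Set ℂ} (hD : IsOpen D) {X : ℂ → ℂ} (hX : ContinuousOn X D)
    {A B : ℂ} (hAB : A ≠ 0 ∨ B ≠ 0) (h : ∀ z ∈ D, (A * z - B) ^ 2 * X z = 0) :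
    ∀ z ∈ D, X z = 0 := by
  intro z hz
  have hev : ∀ᶠ w in 𝓝[≠] z, X w = 0 := by
    filter_upwards [eventually_nhdsWithin_of_eventually_nhds (hD.eventually_mem hz),
      eventually_punctured_ne z (B / A)] with w hw hne
    refine (mul_eq_zero.1 (h w hw)).resolve_left (pow_ne_zero 2 fun hq => ?_)
    by_cases hA : A = 0
    · subst hA
      rcases hAB with h' | h'
      · exact h' rfl
      · exact h' (by linear_combination -hq)
    · exact hne (by rw [eq_div_iff hA]; linear_combination hq)
  have h1 : Tendsto X (𝓝[≠] z) (𝓝 (X z)) :=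
    (hX.continuousAt (hD.mem_nhds hz)).tendsto.mono_left nhdsWithin_le_nhds
  exact tendsto_nhds_unique h1
    ((tendsto_congr' (show X =ᶠ[𝓝[≠] z] fun _ => 0 from hev)).2 tendsto_const_nhds)

theorem eqOn_ball_of_eqOn {c : ℂ} {r : ℝ} {V : Set ℂ} (hV : IsOpen V) (hVne : V.Nonempty)
    (hVD : V ⊆ Metric.ball c r) {f g : ℂ → ℂ} (hf : DifferentiableOn ℂ f (Metric.ball c r))
    (hg : DifferentiableOn ℂ g (Metric.ball c r)) (h : Set.EqOn f g V) :
    Set.EqOn f g (Metric.ball c r) := by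
  obtain ⟨w, hw⟩ := hVne
  refine (hf.analyticOnNhd Metric.isOpen_ball).eqOn_of_preconnected_of_eventuallyEq
    (hg.analyticOnNhd Metric.isOpen_ball) (convex_ball c r).isPreconnected (hVD hw) ?_
  filter_upwards [hV.mem_nhds hw] with z hz using h hz

/-! ### The companion function on the punctured disc -/

namespace HeunParams

variable (H : HeunParams)

/-- The polynomial `z (z - 1) (z - a)`. -/
def disc (z : ℂ) : ℂ := z * (z - 1) * (z - H.a)

/-- The numerator of
`(1 - μ) / (z - c) + (γ - 1) / z + (δ - 1) / (z - 1) + (ε - 1) / (z - a)`. -/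
def residuePoly (c μ z : ℂ) : ℂ :=
  (1 - μ) * H.disc z + (z - c) * ((H.γ - 1) * ((z - 1) * (z - H.a)) +
    (H.δ - 1) * (z * (z - H.a)) + (H.ε - 1) * (z * (z - 1)))

theorem differentiable_disc : Differentiable ℂ H.disc := by unfold disc; fun_prop

theorem differentiable_residuePoly (c μ : ℂ) : Differentiable ℂ (H.residuePoly c μ) := by
  have := H.differentiable_disc
  unfold residuePoly; fun_prop

/-- Only f is known on the whole disc, while g₀ lives on V. The extension is g = k/(αβz - q) with k
= (z-c) f' + μ f; eliminating g₀ gives an equation for k that propagates to the disc by the identity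
theorem and forces k to vanish at the zero of the divisor. The scalar lam also accommodates the case
αβ = q = 0, where g = 0 is taken. -/
theorem exists_companion {c μ : ℂ} {f g₀ : ℂ → ℂ} {V : Set ℂ}
    (hf : DifferentiableOn ℂ f (Metric.ball c ‖c‖)) (hV : IsOpen V) (hVne : V.Nonempty)
    (hVD : V ⊆ Metric.ball c ‖c‖)
    (hdisc : ∀ z ∈ Metric.ball c ‖c‖ \ {c}, H.disc z ≠ 0)
    (h1 : ∀ z ∈ V, (z - c) * deriv f z + μ * f z = (H.α * H.β * z - H.q) * g₀ z)
    (h2 : ∀ z ∈ V, ∃ g', HasDerivAt g₀ g' z ∧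
      H.disc z * (z - c) * g' = H.residuePoly c μ z * g₀ z - (z - c) ^ 2 * f z) :
    ∃ (g : ℂ → ℂ) (lam : ℂ), ‖lam‖ ≤ 1 ∧ DifferentiableOn ℂ g (Metric.ball c ‖c‖ \ {c}) ∧
      ∀ z ∈ Metric.ball c ‖c‖ \ {c},
        (z - c) * deriv f z + μ * f z = (H.α * H.β * z - H.q) * g z ∧
        H.disc z * (z - c) * deriv g z =
          H.residuePoly c μ z * g z - lam * ((z - c) ^ 2 * f z) := by
  set D := Metric.ball c ‖c‖ with hD
  have hDo : IsOpen D := Metric.isOpen_ball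
  set k : ℂ → ℂ := fun z => (z - c) * deriv f z + μ * f z with hk
  have hf' : DifferentiableOn ℂ (deriv f) D := hf.deriv hDo
  have hkd : DifferentiableOn ℂ k D := by fun_prop
  have hkd' : DifferentiableOn ℂ (deriv k) D := hkd.deriv hDo
  have hdd : DifferentiableOn ℂ H.disc D := H.differentiable_disc.differentiableOn
  have hrd : DifferentiableOn ℂ (H.residuePoly c μ) D :=
    (H.differentiable_residuePoly c μ).differentiableOn
  by_cases hpq : H.α * H.β ≠ 0 ∨ H.q ≠ 0
  -- The equation for k is multiplied out so that all its coefficients are polynomials, as the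
  -- identity theorem on the full disc requires.
  · have hV' : ∀ z ∈ V, (H.α * H.β * z - H.q) * H.disc z * (z - c) * deriv k z =
        H.α * H.β * H.disc z * (z - c) * k z + (H.α * H.β * z - H.q) * H.residuePoly c μ z * k z -
          (z - c) ^ 2 * (H.α * H.β * z - H.q) ^ 2 * f z := by
      intro z hz
      obtain ⟨g', hg', e⟩ := h2 z hz
      have hev : k =ᶠ[𝓝 z] fun z => (H.α * H.β * z - H.q) * g₀ z := by
        filter_upwards [hV.mem_nhds hz] with w hw using h1 w hw
      have hq : HasDerivAt (fun z => H.α * H.β * z - H.q) (H.α * H.β * 1) z :=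
        ((hasDerivAt_id z).const_mul (H.α * H.β)).sub_const H.q
      have hd : deriv (fun z => (H.α * H.β * z - H.q) * g₀ z) z = _ := (hq.mul hg').deriv
      rw [hev.deriv_eq, hd, show k z = _ from h1 z hz]
      linear_combination (H.α * H.β * z - H.q) ^ 2 * e
    have hstar := eqOn_ball_of_eqOn hV hVne hVD
      (f := fun z => (H.α * H.β * z - H.q) * H.disc z * (z - c) * deriv k z)
      (g := fun z => H.α * H.β * H.disc z * (z - c) * k z +
        (H.α * H.β * z - H.q) * H.residuePoly c μ z * k z -
          (z - c) ^ 2 * (H.α * H.β * z - H.q) ^ 2 * f z) (by fun_prop) (by fun_prop) hV'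
    have hk0 : ∀ z ∈ D \ {c}, H.α * H.β * z - H.q = 0 → k z = 0 := by
      intro z hz hq
      have hA : H.α * H.β ≠ 0 := fun h => by
        rcases hpq with h' | h'
        · exact h' h
        · exact h' (by linear_combination -hq + z * h)
      have e := hstar hz.1
      simp only [hq] at e
      have hzc : z - c ≠ 0 := sub_ne_zero.2 hz.2
      have e' : H.α * H.β * H.disc z * (z - c) * k z = 0 := by linear_combination -e
      exact (mul_eq_zero.1 e').resolve_left (mul_ne_zero (mul_ne_zero hA (hdisc z hz)) hzc)
    obtain ⟨g, hg, hkg⟩ := exists_eq_affine_mul hDo hkd hpq hk0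
    have hDc : IsOpen (D \ {c}) := hDo.sdiff isClosed_singleton
    have hX : ∀ z ∈ D \ {c}, H.disc z * (z - c) * deriv g z -
        (H.residuePoly c μ z * g z - (z - c) ^ 2 * f z) = 0 := by
      refine eq_zero_of_affine_sq_mul hDc ?_ hpq fun z hz => ?_
      · have hgc := hg.continuousOn
        have hgc' := (hg.deriv hDc).continuousOn
        have := hf.continuousOn.mono (Set.sdiff_subset (t := {c}))
        have := hdd.continuousOn.mono (Set.sdiff_subset (t := {c}))
        have := hrd.continuousOn.mono (Set.sdiff_subset (t := {c}))
        fun_prop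
      · have hev : k =ᶠ[𝓝 z] fun z => (H.α * H.β * z - H.q) * g z := by
          filter_upwards [hDc.mem_nhds hz] with w hw using hkg w hw
        have hq : HasDerivAt (fun z => H.α * H.β * z - H.q) (H.α * H.β * 1) z :=
          ((hasDerivAt_id z).const_mul (H.α * H.β)).sub_const H.q
        have hd : deriv (fun z => (H.α * H.β * z - H.q) * g z) z = _ :=
          (hq.mul (hg.differentiableAt (hDc.mem_nhds hz)).hasDerivAt).deriv
        have e := hstar hz.1
        simp only [hev.deriv_eq, hd, hkg z hz] at e
        linear_combination e
    refine ⟨g, 1, by simp, hg, fun z hz => ⟨hkg z hz, ?_⟩⟩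
    linear_combination hX z hz
  -- Here the first equation reads k = 0 and no longer determines g; choosing g = 0 requires lam = 0
  -- in the second.
  · rw [not_or, not_not, not_not] at hpq
    have hk0 := eqOn_ball_of_eqOn hV hVne hVD (f := k) (g := fun _ => 0) hkd (by fun_prop)
      fun z hz => by
        have := h1 z hz
        rwa [hpq.1, hpq.2, zero_mul, sub_zero, zero_mul] at this
    refine ⟨fun _ => 0, 0, by simp, by fun_prop, fun z hz => ⟨?_, by simp⟩⟩
    rw [mul_zero]
    exact hk0 hz.1

/-- The substitution z = c(1-ζ) sends c to 0 and 0 to 1. On the annulus 1/2 ≤ |ζ| < 1 the only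
unbounded coefficients come from z = 0, where g'/g has the residue γ - 1; this is the system of
`norm_deriv_le_rpow` with P = 1 - γ. -/
theorem summable_of_companion {c μ lam : ℂ} {f g : ℂ → ℂ} {coef : ℕ → ℂ} (hc : c ≠ 0)
    (hγ : H.γ.re < 1) (h1 : 1 = c ∨ ‖c‖ < ‖c - 1‖) (ha : H.a = c ∨ ‖c‖ < ‖c - H.a‖)
    (hlam : ‖lam‖ ≤ 1) (hf : DifferentiableOn ℂ f (Metric.ball c ‖c‖))
    (hg : DifferentiableOn ℂ g (Metric.ball c ‖c‖ \ {c}))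
    (hfg : ∀ z ∈ Metric.ball c ‖c‖ \ {c},
        (z - c) * deriv f z + μ * f z = (H.α * H.β * z - H.q) * g z ∧
        H.disc z * (z - c) * deriv g z =
          H.residuePoly c μ z * g z - lam * ((z - c) ^ 2 * f z))
    (hs : ∀ z ∈ Metric.ball c ‖c‖, HasSum (fun n => coef n * (z - c) ^ n) (f z)) :
    Summable fun n : ℕ => ‖coef n * (-c) ^ n‖ * (n : ℝ) ^ (-(1 - H.γ).re) := by
  have hcn : 0 < ‖c‖ := norm_pos_iff.2 hc
  have hP : 0 < (1 - H.γ).re := by simpa using hγ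
  have hmem : ∀ ζ : ℂ, ‖ζ‖ < 1 → c * (1 - ζ) ∈ Metric.ball c ‖c‖ := fun ζ h => by
    rw [Metric.mem_ball, dist_eq_norm, show c * (1 - ζ) - c = -(c * ζ) by ring, norm_neg, norm_mul]
    nlinarith
  have hmem' : ∀ ζ : ℂ, ‖ζ‖ < 1 → ζ ≠ 0 → c * (1 - ζ) ∈ Metric.ball c ‖c‖ \ {c} := fun ζ h h0 => by
    refine ⟨hmem ζ h, fun e => ?_⟩
    have : c * ζ = 0 := by linear_combination -(Set.mem_singleton_iff.1 e)
    exact (mul_ne_zero hc h0) this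
  have hlin : ∀ ζ : ℂ, HasDerivAt (fun ζ : ℂ => c * (1 - ζ)) (-c) ζ := fun ζ => by
    simpa using ((hasDerivAt_id ζ).const_sub 1).const_mul c
  have hDc : IsOpen (Metric.ball c ‖c‖ \ {c}) := Metric.isOpen_ball.sdiff isClosed_singleton
  have hfd : ∀ ζ : ℂ, ‖ζ‖ < 1 →
      HasDerivAt (fun ζ => f (c * (1 - ζ))) (deriv f (c * (1 - ζ)) * (-c)) ζ := fun ζ h =>
    (hf.differentiableAt (Metric.isOpen_ball.mem_nhds (hmem ζ h))).hasDerivAt.comp ζ (hlin ζ)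
  have hgd : ∀ ζ : ℂ, ‖ζ‖ < 1 → ζ ≠ 0 →
      HasDerivAt (fun ζ => g (c * (1 - ζ))) (deriv g (c * (1 - ζ)) * (-c)) ζ := fun ζ h h0 =>
    (hg.differentiableAt (hDc.mem_nhds (hmem' ζ h h0))).hasDerivAt.comp ζ (hlin ζ)
  -- If e = c, the annulus keeps z away from e; otherwise the strict inequality keeps e off the
  -- closed disc.
  have hbd : ∀ e : ℂ, e = c ∨ ‖c‖ < ‖c - e‖ → ∃ m : ℝ, 0 ≤ m ∧ ∀ ζ : ℂ, 1 / 2 ≤ ‖ζ‖ → ‖ζ‖ < 1 →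
      c * (1 - ζ) - e ≠ 0 ∧ ‖(c * (1 - ζ) - e)⁻¹‖ ≤ m := by
    rintro e (rfl | he)
    · refine ⟨2 / ‖e‖, by positivity, fun ζ h h' => ?_⟩
      have h0 : 0 < ‖ζ‖ := by linarith
      rw [show e * (1 - ζ) - e = -(e * ζ) by ring]
      refine ⟨neg_ne_zero.2 (mul_ne_zero hc (norm_pos_iff.1 h0)), ?_⟩
      rw [norm_inv, norm_neg, norm_mul, inv_eq_one_div, div_le_div_iff₀ (by positivity) hcn]
      nlinarith
    · refine ⟨(‖c - e‖ - ‖c‖)⁻¹, by rw [inv_nonneg]; linarith, fun ζ h h' => ?_⟩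
      have hge : ‖c - e‖ - ‖c‖ ≤ ‖c * (1 - ζ) - e‖ := by
        have h1 := norm_sub_norm_le (c - e) (c * ζ)
        rw [show c - e - c * ζ = c * (1 - ζ) - e by ring, norm_mul] at h1
        nlinarith
      have hpos : 0 < ‖c - e‖ - ‖c‖ := by linarith
      refine ⟨norm_pos_iff.1 (hpos.trans_le hge), ?_⟩
      rw [norm_inv]
      exact inv_anti₀ hpos hge
  obtain ⟨m₁, hm₁0, hm₁⟩ := hbd 1 h1
  obtain ⟨mₐ, hmₐ0, hmₐ⟩ := hbd H.a ha
  -- The factors 2 in K₁ and K₂ come from |ζ|⁻¹ ≤ 2 and |z| ≤ 2|c|.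
  set K₁ : ℝ := 2 * (‖H.α * H.β‖ * (2 * ‖c‖) + ‖H.q‖ + ‖μ‖) with hK₁
  set K₂ : ℝ := ‖1 - μ‖ * 2 + ‖c‖ * (‖H.δ - 1‖ * m₁ + ‖H.ε - 1‖ * mₐ) + ‖c‖ * (m₁ * mₐ) with hK₂
  have hK₁0 : 0 ≤ K₁ := by positivity
  have hK₂0 : 0 ≤ K₂ := by positivity
  have hbound := norm_deriv_le_rpow (f := fun ζ => f (c * (1 - ζ)))
    (g := fun ζ => g (c * (1 - ζ))) (P := 1 - H.γ) (K := K₁ + K₂) (by positivity) hP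
    (fun ζ h => (hfd ζ (by simpa using h)).differentiableAt.differentiableWithinAt)
    (fun ζ h => (hgd ζ (by simpa using h.1) h.2).differentiableAt.differentiableWithinAt)
    (fun ζ h h' => ?_) (fun ζ h h' => ?_)
  · obtain ⟨C, hC0, hC⟩ := hbound
    refine summable_coeff_of_norm_deriv_le hP hC0 (f := fun ζ => f (c * (1 - ζ)))
      (fun ζ h => ?_) hC
    refine (hs _ (hmem ζ (by simpa using h))).congr_fun fun n => ?_
    rw [show c * (1 - ζ) - c = -c * ζ by ring, mul_pow]; ring
  · have h0 : ζ ≠ 0 := fun e => by rw [e, norm_zero] at h; norm_num at h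
    have hn0 : 0 < ‖ζ‖ := norm_pos_iff.2 h0
    rw [(hfd ζ h').deriv]
    obtain ⟨e1, -⟩ := hfg _ (hmem' ζ h' h0)
    set z := c * (1 - ζ) with hz
    have e2 : deriv f z * (-c) = ((H.α * H.β * z - H.q) * g z - μ * f z) / ζ := by
      rw [eq_div_iff h0, ← e1, show z - c = -(c * ζ) by rw [hz]; ring]; ring
    have hzn : ‖z‖ ≤ 2 * ‖c‖ := by
      rw [hz, norm_mul]
      have : ‖1 - ζ‖ ≤ 2 := (norm_sub_le _ _).trans (by rw [norm_one]; linarith)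
      nlinarith
    have e3 : ‖H.α * H.β * z - H.q‖ ≤ ‖H.α * H.β‖ * (2 * ‖c‖) + ‖H.q‖ := by
      refine (norm_sub_le _ _).trans ?_
      rw [norm_mul]; gcongr
    rw [e2, norm_div, div_le_iff₀ hn0]
    have e4 : ‖(H.α * H.β * z - H.q) * g z - μ * f z‖ ≤
        (‖H.α * H.β‖ * (2 * ‖c‖) + ‖H.q‖) * ‖g z‖ + ‖μ‖ * ‖f z‖ := by
      refine (norm_sub_le _ _).trans ?_
      rw [norm_mul, norm_mul]; gcongr
    have hfn := norm_nonneg (f z)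
    have hgn := norm_nonneg (g z)
    calc _ ≤ _ := e4
      _ ≤ (‖H.α * H.β‖ * (2 * ‖c‖) + ‖H.q‖) * (‖f z‖ + ‖g z‖) + ‖μ‖ * (‖f z‖ + ‖g z‖) := by
        gcongr <;> linarith
      _ = K₁ * (‖f z‖ + ‖g z‖) * (1 / 2) := by rw [hK₁]; ring
      _ ≤ (K₁ + K₂) * (‖f z‖ + ‖g z‖) * ‖ζ‖ := by gcongr; linarith
  · have h0 : ζ ≠ 0 := fun e => by rw [e, norm_zero] at h; norm_num at h
    have hn0 : 0 < ‖ζ‖ := norm_pos_iff.2 h0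
    have hw0 : 1 - ζ ≠ 0 := Complex.slitPlane_ne_zero (one_sub_mem_slitPlane h')
    rw [(hgd ζ h' h0).deriv]
    obtain ⟨-, e1⟩ := hfg _ (hmem' ζ h' h0)
    obtain ⟨n₁, b₁⟩ := hm₁ ζ h h'
    obtain ⟨nₐ, bₐ⟩ := hmₐ ζ h h'
    have hz0 : c * (1 - ζ) ≠ 0 := mul_ne_zero hc hw0
    have hzc : c * (1 - ζ) - c = -(c * ζ) := by ring
    have hzc0 : c * (1 - ζ) - c ≠ 0 := by rw [hzc]; exact neg_ne_zero.2 (mul_ne_zero hc h0)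
    -- Partial fractions: subtracting (1-γ)/(1-ζ) removes exactly the pole of the coefficient of g
    -- at z = 0.
    have e2 : deriv g (c * (1 - ζ)) * (-c) - (1 - H.γ) / (1 - ζ) * g (c * (1 - ζ)) =
        ((1 - μ) * ζ⁻¹ + -c * ((H.δ - 1) * (c * (1 - ζ) - 1)⁻¹ +
          (H.ε - 1) * (c * (1 - ζ) - H.a)⁻¹)) * g (c * (1 - ζ)) +
        -(c * ζ) * (lam * ((c * (1 - ζ) - 1)⁻¹ * (c * (1 - ζ) - H.a)⁻¹)) *
          (f (c * (1 - ζ)) / (1 - ζ)) := by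
      have e3 : deriv g (c * (1 - ζ)) = (H.residuePoly c μ (c * (1 - ζ)) * g (c * (1 - ζ)) -
          lam * ((c * (1 - ζ) - c) ^ 2 * f (c * (1 - ζ)))) /
            (H.disc (c * (1 - ζ)) * (c * (1 - ζ) - c)) := by
        rw [eq_div_iff, ← e1]
        · ring
        · exact mul_ne_zero (mul_ne_zero (mul_ne_zero hz0 n₁) nₐ) hzc0
      rw [e3, residuePoly, disc, hzc]
      generalize g (c * (1 - ζ)) = g', f (c * (1 - ζ)) = f'
      generalize hu : c * (1 - ζ) - 1 = u at *
      generalize hv : c * (1 - ζ) - H.a = v at *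
      field_simp
      ring
    rw [e2]
    set z := c * (1 - ζ) with hz
    have hζi : ‖ζ⁻¹‖ ≤ 2 := by
      rw [norm_inv, inv_eq_one_div, div_le_iff₀ hn0]; linarith
    have i1 : ‖(1 - μ) * ζ⁻¹ + -c * ((H.δ - 1) * (z - 1)⁻¹ + (H.ε - 1) * (z - H.a)⁻¹)‖ ≤
        ‖1 - μ‖ * 2 + ‖c‖ * (‖H.δ - 1‖ * m₁ + ‖H.ε - 1‖ * mₐ) := by
      refine (norm_add_le _ _).trans ?_
      rw [norm_mul, norm_mul, norm_neg]
      gcongr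
      refine (norm_add_le _ _).trans ?_
      rw [norm_mul, norm_mul]
      gcongr
    have i2 : ‖-(c * ζ) * (lam * ((z - 1)⁻¹ * (z - H.a)⁻¹))‖ ≤ ‖c‖ * (m₁ * mₐ) := by
      rw [norm_mul, norm_neg, norm_mul, norm_mul, norm_mul]
      calc ‖c‖ * ‖ζ‖ * (‖lam‖ * (‖(z - 1)⁻¹‖ * ‖(z - H.a)⁻¹‖)) ≤
            ‖c‖ * 1 * (1 * (m₁ * mₐ)) := by gcongr
        _ = _ := by ring
    have hgn := norm_nonneg (g z)
    have hfn : 0 ≤ ‖f z‖ / ‖1 - ζ‖ := by positivity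
    calc _ ≤ (‖1 - μ‖ * 2 + ‖c‖ * (‖H.δ - 1‖ * m₁ + ‖H.ε - 1‖ * mₐ)) * ‖g z‖ +
          ‖c‖ * (m₁ * mₐ) * (‖f z‖ / ‖1 - ζ‖) := by
          refine (norm_add_le _ _).trans ?_
          rw [norm_mul, norm_mul, norm_div]
          gcongr
      _ ≤ (‖1 - μ‖ * 2 + ‖c‖ * (‖H.δ - 1‖ * m₁ + ‖H.ε - 1‖ * mₐ)) * (‖g z‖ + ‖f z‖ / ‖1 - ζ‖) +
          ‖c‖ * (m₁ * mₐ) * (‖g z‖ + ‖f z‖ / ‖1 - ζ‖) := by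
          gcongr <;> linarith
      _ = K₂ * (‖g z‖ + ‖f z‖ / ‖1 - ζ‖) := by rw [hK₂]; ring
      _ ≤ _ := by gcongr; linarith

end HeunParams


/-- From (1 - u u₀)^ν ≤ exp(-ν u₀ u) the integral over the segment is bounded by a Gamma integral,
of size |c|^ν ν^(-p). Thus integration from the boundary point compensates for the possible
divergence of the series of v there. -/
theorem summable_mul_of_segment_bound {p u₀ M : ℝ} {c l w : ℂ} (hp : 0 < p) (hu₀ : 0 < u₀)
    (hu₁ : u₀ < 1) {coef I : ℕ → ℂ} {F : ℕ → ℂ → ℂ → ℂ}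
    (hI : ∀ ν, HasSegmentIntegral (F ν) l w (I ν))
    (hF : ∀ ν, ∀ u : ℝ, 0 < u → u ≤ 1 → ‖F ν ((Real.log u : ℂ) + l) (u * w) * w‖ ≤
      M * u ^ (p - 1) * (‖c‖ * (1 - u * u₀)) ^ ν)
    (hs : Summable fun n : ℕ => ‖coef n * (-c) ^ n‖ * (n : ℝ) ^ (-p)) :
    Summable fun ν => coef ν * I ν := by
  have hM : 0 ≤ M := by
    have h := (norm_nonneg _).trans (hF 0 1 one_pos le_rfl)
    simpa using h
  refine Summable.of_norm_bounded_eventually_nat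
    (hs.mul_left (M * ((1 / u₀) ^ p * Real.Gamma p))) ?_
  filter_upwards [eventually_gt_atTop 0] with ν hν
  have hν0 : (0 : ℝ) < ν := by exact_mod_cast hν
  have hr : 0 < ν * u₀ := by positivity
  have hG := Real.integral_rpow_mul_exp_neg_mul_Ioi hp hr
  have hGp := Real.Gamma_pos_of_pos hp
  have hint : MeasureTheory.IntegrableOn
      (fun t : ℝ => t ^ (p - 1) * Real.exp (-(ν * u₀ * t))) (Set.Ioi 0) := by
    -- A non-integrable function has integral 0 by convention, whereas the Gamma integral is
    -- positive.
    by_contra h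
    rw [MeasureTheory.integral_undef h] at hG
    have : 0 < (1 / (ν * u₀)) ^ p * Real.Gamma p := by positivity
    linarith
  have hint' : MeasureTheory.IntegrableOn (fun t : ℝ => M * ‖c‖ ^ ν *
      (t ^ (p - 1) * Real.exp (-(ν * u₀ * t)))) (Set.Ioi 0) := hint.const_mul _
  have hle : ‖I ν‖ ≤ M * ‖c‖ ^ ν * ((1 / (ν * u₀)) ^ p * Real.Gamma p) := by
    rw [← (hI ν).2, ← hG, ← MeasureTheory.integral_const_mul]
    refine (intervalIntegral.norm_integral_le_of_norm_le (g := fun t : ℝ => M * ‖c‖ ^ ν *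
      (t ^ (p - 1) * Real.exp (-(ν * u₀ * t)))) zero_le_one ?_ ?_).trans ?_
    · refine Eventually.of_forall fun u hu => (hF ν u hu.1 hu.2).trans ?_
      have hpos : 0 ≤ 1 - u * u₀ := by nlinarith [hu.1, hu.2]
      have h1 : (1 - u * u₀) ^ ν ≤ Real.exp (-(ν * u₀ * u)) := by
        calc (1 - u * u₀) ^ ν ≤ Real.exp (-(u * u₀)) ^ ν := by
              gcongr
              have := Real.add_one_le_exp (-(u * u₀))
              linarith
          _ = _ := by rw [← Real.exp_nat_mul]; ring_nf
      have h2 : 0 ≤ u ^ (p - 1) := Real.rpow_nonneg hu.1.le _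
      rw [mul_pow]
      calc M * u ^ (p - 1) * (‖c‖ ^ ν * (1 - u * u₀) ^ ν) ≤
            M * u ^ (p - 1) * (‖c‖ ^ ν * Real.exp (-(ν * u₀ * u))) := by gcongr
        _ = _ := by ring
    · rw [intervalIntegrable_iff_integrableOn_Ioc_of_le zero_le_one]
      exact hint'.mono_set Set.Ioc_subset_Ioi_self
    · rw [intervalIntegral.integral_of_le zero_le_one]
      refine MeasureTheory.setIntegral_mono_set hint' ?_ Set.Ioc_subset_Ioi_self.eventuallyLE
      filter_upwards [MeasureTheory.ae_restrict_mem measurableSet_Ioi] with t ht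
      have : 0 ≤ t ^ (p - 1) := Real.rpow_nonneg (Set.mem_Ioi.1 ht).le _
      exact mul_nonneg (by positivity) (mul_nonneg this (Real.exp_pos _).le)
  have e1 : (1 / (ν * u₀)) ^ p = (1 / u₀) ^ p * (ν : ℝ) ^ (-p) := by
    rw [one_div, mul_inv, Real.mul_rpow (by positivity) (by positivity), Real.rpow_neg hν0.le,
      Real.inv_rpow hν0.le, one_div, mul_comm]
  rw [norm_mul, norm_mul, norm_pow, norm_neg]
  calc ‖coef ν‖ * ‖I ν‖ ≤ ‖coef ν‖ * (M * ‖c‖ ^ ν * ((1 / (ν * u₀)) ^ p * Real.Gamma p)) := by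
        gcongr
    _ = _ := by rw [e1]; ring

/-! ### Integration from the boundary point `0` -/

namespace HeunParams

variable (H : HeunParams) {L₁ Lₐ : ℂ}

theorem hasDerivAt_localWeight (h₁ : Complex.exp L₁ = -1) (hₐ : Complex.exp Lₐ = -H.a) {U : Set ℂ}
    {ℓ : ℂ → ℂ} (hU : IsOpen U) (hUρ : U ⊆ Metric.ball 0 H.ρ) (hℓ : IsLogBranch 0 U ℓ) {z : ℂ}
    (hz : z ∈ U) : HasDerivAt (fun z => H.localWeight L₁ Lₐ (ℓ z) z)
      (H.localWeight L₁ Lₐ (ℓ z) z * H.P z) z :=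
  H.hasDerivAt_weight (by simpa using hℓ.hasDerivAt hU hz)
    ((H.isLogBranch_log₁ h₁).hasDerivAt Metric.isOpen_ball (hUρ hz))
    ((H.isLogBranch_logₐ hₐ).hasDerivAt Metric.isOpen_ball (hUρ hz))

theorem disc_ne_zero_of_mem_ball (h₁ : Complex.exp L₁ = -1) (hₐ : Complex.exp Lₐ = -H.a) {z : ℂ}
    (hz : z ∈ Metric.ball 0 H.ρ) (h0 : z ≠ 0) : z - 1 ≠ 0 ∧ z - H.a ≠ 0 ∧ H.disc z ≠ 0 := by
  have n1 := sub_ne_zero.2 ((H.isLogBranch_log₁ h₁).ne hz)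
  have na := sub_ne_zero.2 ((H.isLogBranch_logₐ hₐ).ne hz)
  exact ⟨n1, na, mul_ne_zero (mul_ne_zero h0 n1) na⟩

/-- The functions `f` and `g₀ = -(z - c) w y / (p z (z - 1) (z - a))`, where `v = p f`, satisfy a
first order system. -/
theorem companion_system (h₁ : Complex.exp L₁ = -1) (hₐ : Complex.exp Lₐ = -H.a) {U V : Set ℂ}
    {ℓ y : ℂ → ℂ} (hU : IsOpen U) (hUρ : U ⊆ Metric.ball 0 H.ρ) (hℓ : IsLogBranch 0 U ℓ)
    (hy : SolvesODE H.P H.Q U y) (hV : IsOpen V) (hVU : V ⊆ U) {c μ : ℂ} {p f : ℂ → ℂ}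
    (hVc : ∀ z ∈ V, z ≠ c) (hp : ∀ z ∈ V, HasDerivAt p (μ / (z - c) * p z) z)
    (hp0 : ∀ z ∈ V, p z ≠ 0) (hf : ∀ z ∈ V, DifferentiableAt ℂ f z)
    (hv : ∀ z ∈ V, H.localWeight L₁ Lₐ (ℓ z) z * deriv y z = p z * f z) {z : ℂ} (hz : z ∈ V) :
    ((z - c) * deriv f z + μ * f z = (H.α * H.β * z - H.q) *
      (-((z - c) * H.localWeight L₁ Lₐ (ℓ z) z * y z) / (p z * H.disc z))) ∧
    ∃ g', HasDerivAt
      (fun z => -((z - c) * H.localWeight L₁ Lₐ (ℓ z) z * y z) / (p z * H.disc z)) g' z ∧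
      H.disc z * (z - c) * g' = H.residuePoly c μ z *
        (-((z - c) * H.localWeight L₁ Lₐ (ℓ z) z * y z) / (p z * H.disc z)) -
          (z - c) ^ 2 * f z := by
  have z0 : z ≠ 0 := hℓ.ne (hVU hz)
  obtain ⟨n1, na, nd⟩ := H.disc_ne_zero_of_mem_ball h₁ hₐ (hUρ (hVU hz)) z0
  have nc : z - c ≠ 0 := sub_ne_zero.2 (hVc z hz)
  have np := hp0 z hz
  have nw := H.localWeight_ne_zero (L₁ := L₁) (Lₐ := Lₐ) (ℓ z) z
  have hw := H.hasDerivAt_localWeight h₁ hₐ hU hUρ hℓ (hVU hz)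
  have hy1 := hy.hasDerivAt hU (hVU hz)
  have hv1 := hv z hz
  constructor
  · have e1 : HasDerivAt (fun z => H.localWeight L₁ Lₐ (ℓ z) z * deriv y z)
        (-(H.localWeight L₁ Lₐ (ℓ z) z * H.Q z * y z)) z := by
      refine (hw.mul (hy.hasDerivAt_deriv hU (hVU hz))).congr_deriv ?_
      ring
    have hev : (fun z => H.localWeight L₁ Lₐ (ℓ z) z * deriv y z) =ᶠ[𝓝 z] fun z => p z * f z := by
      filter_upwards [hV.mem_nhds hz] with w hw using hv w hw
    have e2 := e1.unique (((hp z hz).mul (hf z hz).hasDerivAt).congr_of_eventuallyEq hev)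
    rw [Q] at e2
    have nd' : z * (z - 1) * (z - H.a) ≠ 0 := nd
    rw [disc]
    field_simp at e2 ⊢
    linear_combination -e2
  · have hN := ((((hasDerivAt_id z).sub_const c).mul hw).mul hy1).neg
    have hΔ : HasDerivAt H.disc ((1 * (z - 1) + z * 1) * (z - H.a) + z * (z - 1) * 1) z :=
      ((hasDerivAt_id z).mul ((hasDerivAt_id z).sub_const 1)).mul ((hasDerivAt_id z).sub_const H.a)
    refine ⟨_, hN.div ((hp z hz).mul hΔ) (mul_ne_zero np nd), ?_⟩
    have hy' : deriv y z = p z * f z / H.localWeight L₁ Lₐ (ℓ z) z := by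
      rw [eq_div_iff nw, ← hv1]; ring
    simp only [Pi.mul_apply, Pi.neg_apply, id, hy', residuePoly, P, disc]
    generalize H.localWeight L₁ Lₐ (ℓ z) z = W at *
    generalize p z = p' at *
    field_simp
    ring

/-- By `hN` it is enough that the integrated series converge at one point. This is tested at w on
the segment from 0 to c, combining the coefficient estimate of `summable_of_companion` with the
decay of the integrals. -/
theorem isTermwiseExpansion_of_center (h₁ : Complex.exp L₁ = -1) (hₐ : Complex.exp Lₐ = -H.a)
    {U : Set ℂ} {ℓ y : ℂ → ℂ} (hU : IsOpen U) (hUρ : U ⊆ Metric.ball 0 H.ρ)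
    (hℓ : IsLogBranch 0 U ℓ) (hy : SolvesODE H.P H.Q U y) {c μ : ℂ} {p : ℂ → ℂ}
    {pre : ℂ → ℂ → ℂ} (hpre : ∀ l z, pre l z = p z) (hc : c ≠ 0)
    (hp : ∀ z ∈ Metric.ball 0 H.ρ, HasDerivAt p (μ / (z - c) * p z) z)
    (hp0 : ∀ z ∈ Metric.ball 0 H.ρ, z ≠ c → p z ≠ 0)
    (hγ : H.γ.re < 1) (hc1 : 1 = c ∨ ‖c‖ < ‖c - 1‖) (hca : H.a = c ∨ ‖c‖ < ‖c - H.a‖)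
    (hUc : Metric.ball c ‖c‖ ∩ Metric.ball 0 H.ρ ⊆ U) {coef : ℕ → ℂ} {Y : ℕ → ℂ → ℂ → ℂ}
    (hexp : HasExpansion U ℓ (fun z => H.localWeight L₁ Lₐ (ℓ z) z * deriv y z) pre c coef)
    (hseg : ∀ ν : ℕ, ∀ z ∈ U,
      HasSegmentIntegral (H.integrand L₁ Lₐ pre c ν) (ℓ z) z (Y ν (ℓ z) z))
    (hN : IsNormalisedTermwiseExpansion U ℓ y coef Y) : IsTermwiseExpansion U ℓ y coef Y := by
  have hcn : 0 < ‖c‖ := norm_pos_iff.2 hc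
  have hρ := H.ρ_pos
  have hexp' : ∀ z ∈ U, HasSum (fun ν => coef ν * (p z * (z - c) ^ ν))
      (H.localWeight L₁ Lₐ (ℓ z) z * deriv y z) := fun z hz =>
    (hexp z hz).congr_fun fun ν => by rw [hpre]
  set u₀ : ℝ := min (H.ρ / (2 * ‖c‖)) (1 / 2) with hu₀
  have hu₀0 : 0 < u₀ := lt_min (by positivity) (by norm_num)
  have hu₀1 : u₀ < 1 := (min_le_right _ _).trans_lt (by norm_num)
  have hnorm : ∀ u : ℝ, u ≤ 1 → ‖c * u - c‖ = ‖c‖ * (1 - u) := fun u hu => by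
    rw [show c * u - c = c * ((u - 1 : ℝ) : ℂ) by push_cast; ring, norm_mul, Complex.norm_real,
      Real.norm_of_nonpos (by linarith)]
    ring
  have hpt : ∀ u : ℝ, 0 < u → u ≤ u₀ → c * u ∈ Metric.ball c ‖c‖ ∩ Metric.ball 0 (min H.ρ ‖c‖) := by
    intro u h0 h1
    have hcu : ‖c * u‖ = ‖c‖ * u := by
      rw [norm_mul, Complex.norm_real, Real.norm_of_nonneg h0.le]
    refine ⟨?_, ?_⟩
    · rw [Metric.mem_ball, dist_eq_norm, hnorm u (by linarith)]
      nlinarith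
    · rw [mem_ball_zero_iff, hcu]
      refine lt_min ?_ (by nlinarith)
      have : u ≤ H.ρ / (2 * ‖c‖) := h1.trans (min_le_left _ _)
      rw [le_div_iff₀ (by positivity)] at this
      linarith
  -- The radius min ρ |c| excludes c, where p may vanish, while V still contains points c u with u
  -- arbitrarily small.
  set V := Metric.ball c ‖c‖ ∩ Metric.ball 0 (min H.ρ ‖c‖) with hVdef
  have hVsub : V ⊆ Metric.ball c ‖c‖ ∩ Metric.ball 0 H.ρ := fun z hz =>
    ⟨hz.1, Metric.ball_subset_ball (min_le_left _ _) hz.2⟩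
  have hVU : V ⊆ U := hVsub.trans hUc
  have hVo : IsOpen V := Metric.isOpen_ball.inter Metric.isOpen_ball
  have hVc : ∀ z ∈ V, z ≠ c := by
    rintro z hz rfl
    exact lt_irrefl _ ((mem_ball_zero_iff.1 hz.2).trans_le (min_le_right _ _))
  -- The points c u of U have distance |c|(1-u) from c, so letting u tend to 0 gives radius of
  -- convergence at least |c|.
  have hconv : ConvergesInBall coef (fun n => n) ‖c‖ := by
    intro r h0 hr
    set u : ℝ := min u₀ ((‖c‖ - r) / ‖c‖) with hu
    have hu0 : 0 < u := lt_min hu₀0 (div_pos (by linarith) hcn)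
    obtain ⟨r', hr', hsum⟩ := summable_coef_of_expansion hU
      (fun z hz hzc => hp0 z (hUρ hz) hzc) (fun z hz => (hexp' z hz).summable)
      (hVU (hpt u hu0 (min_le_left _ _)))
    rw [hnorm u ((min_le_left _ _).trans hu₀1.le)] at hr'
    have : u ≤ (‖c‖ - r) / ‖c‖ := min_le_right _ _
    rw [le_div_iff₀ hcn] at this
    refine Summable.of_nonneg_of_le (fun n => by positivity) (fun n => ?_) hsum
    have : r ≤ r' := by linarith
    gcongr
  set f : ℂ → ℂ := fun z => ∑' n, coef n * (z - c) ^ n with hfdef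
  have hfd : DifferentiableOn ℂ f (Metric.ball c ‖c‖) := hconv.differentiableOn_sub c
  have hfs : ∀ z ∈ Metric.ball c ‖c‖, HasSum (fun n => coef n * (z - c) ^ n) (f z) := fun z hz =>
    hconv.hasSum_sub hz
  have hv : ∀ z ∈ V, H.localWeight L₁ Lₐ (ℓ z) z * deriv y z = p z * f z := fun z hz =>
    (hexp' z (hVU hz)).unique (((hfs z hz.1).mul_left (p z)).congr_fun fun n => by ring)
  have hsys := fun z (hz : z ∈ V) => H.companion_system h₁ hₐ hU hUρ hℓ hy hVo hVU hVc
    (fun z hz => hp z (hVsub hz).2) (fun z hz => hp0 z (hVsub hz).2 (hVc z hz))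
    (fun z hz => hfd.differentiableAt (Metric.isOpen_ball.mem_nhds hz.1)) hv hz
  have hdisc : ∀ z ∈ Metric.ball c ‖c‖ \ {c}, H.disc z ≠ 0 := by
    rintro z ⟨hz, hzc⟩
    have key : ∀ e : ℂ, e = c ∨ ‖c‖ ≤ ‖c - e‖ → z ≠ e := by
      rintro e (he | he) rfl
      · exact hzc he
      · rw [Metric.mem_ball, dist_comm, dist_eq_norm] at hz
        exact absurd hz he.not_gt
    exact mul_ne_zero (mul_ne_zero (key 0 (Or.inr (by simp)))
      (sub_ne_zero.2 (key 1 (hc1.imp id le_of_lt)))) (sub_ne_zero.2 (key H.a (hca.imp id le_of_lt)))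
  obtain ⟨g, lam, hlam, hg, hfg⟩ := H.exists_companion hfd hVo ⟨_, hpt u₀ hu₀0 le_rfl⟩
    (fun z hz => hz.1) hdisc (fun z hz => (hsys z hz).1) (fun z hz => (hsys z hz).2)
  have hsum := H.summable_of_companion hc hγ hc1 hca hlam hfd hg hfg hfs
  set w := c * (u₀ : ℂ) with hw
  have hwU : w ∈ U := hVU (hpt u₀ hu₀0 le_rfl)
  have hwρ : ‖w‖ < H.ρ := mem_ball_zero_iff.1 (hUρ hwU)
  refine hN.isTermwiseExpansion hwU ?_
  -- a bound for the regular factor of the integrand on the segment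
  have hT : ContinuousOn (fun z => p z / (Complex.exp (H.δ * H.log₁ L₁ z) *
      Complex.exp (H.ε * H.logₐ Lₐ z))) (Metric.closedBall 0 ‖w‖) := by
    have hsub : Metric.closedBall (0 : ℂ) ‖w‖ ⊆ Metric.ball 0 H.ρ :=
      Metric.closedBall_subset_ball hwρ
    have c1 := (H.isLogBranch_log₁ h₁).1.mono hsub
    have c2 := (H.isLogBranch_logₐ hₐ).1.mono hsub
    have c3 : ContinuousOn p (Metric.closedBall 0 ‖w‖) := fun z hz =>
      (hp z (hsub hz)).continuousAt.continuousWithinAt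
    refine c3.div (by fun_prop) fun z _ => mul_ne_zero (Complex.exp_ne_zero _) (Complex.exp_ne_zero _)
  obtain ⟨M, hM⟩ := (isCompact_closedBall (0 : ℂ) ‖w‖).exists_bound_of_continuousOn hT
  refine summable_mul_of_segment_bound (p := (1 - H.γ).re) (u₀ := u₀) (c := c)
    (M := ‖Complex.exp (-(H.γ * ℓ w))‖ * M * ‖w‖) (by simpa using hγ) hu₀0 hu₀1
    (fun ν => hseg ν w hwU) (fun ν u hu0 hu1 => ?_) hsum
  have hmem : (u : ℂ) * w ∈ Metric.closedBall (0 : ℂ) ‖w‖ := by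
    rw [mem_closedBall_zero_iff, norm_mul, Complex.norm_real, Real.norm_of_nonneg hu0.le]
    nlinarith [norm_nonneg w]
  have hMu := hM _ hmem
  have e1 : ‖(u : ℂ) * w - c‖ = ‖c‖ * (1 - u * u₀) := by
    have := hnorm (u * u₀) (by nlinarith)
    rw [← this, hw]; push_cast; ring_nf
  have e2 : ‖Complex.exp (-(H.γ * ((Real.log u : ℂ) + ℓ w)))‖ =
      ‖Complex.exp (-(H.γ * ℓ w))‖ * u ^ ((1 - H.γ).re - 1) := by
    rw [show -(H.γ * ((Real.log u : ℂ) + ℓ w)) = -(H.γ * ℓ w) + -H.γ * (Real.log u : ℂ) by ring,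
      Complex.exp_add, norm_mul, Complex.norm_exp (-H.γ * _), Complex.re_mul_ofReal,
      Real.rpow_def_of_pos hu0]
    congr 2
    simp; ring
  have e3 : H.integrand L₁ Lₐ pre c ν ((Real.log u : ℂ) + ℓ w) (u * w) =
      Complex.exp (-(H.γ * ((Real.log u : ℂ) + ℓ w))) * (p (u * w) /
        (Complex.exp (H.δ * H.log₁ L₁ (u * w)) * Complex.exp (H.ε * H.logₐ Lₐ (u * w)))) *
          ((u : ℂ) * w - c) ^ ν := by
    rw [integrand, hpre, localWeight, weight, Complex.exp_neg]
    field_simp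
  rw [e3, norm_mul, norm_mul, norm_mul, norm_pow, e1, e2]
  have hpos : 0 ≤ 1 - u * u₀ := by nlinarith
  have hu' : 0 ≤ u ^ ((1 - H.γ).re - 1) := Real.rpow_nonneg hu0.le _
  calc _ ≤ ‖Complex.exp (-(H.γ * ℓ w))‖ * u ^ ((1 - H.γ).re - 1) * M *
        (‖c‖ * (1 - u * u₀)) ^ ν * ‖w‖ := by gcongr
    _ = _ := by ring

end HeunParams


/-! ### Assembly of the four centres -/

namespace HeunParams

variable (H : HeunParams) {L₁ Lₐ : ℂ} (h₁ : Complex.exp L₁ = -1) (hₐ : Complex.exp Lₐ = -H.a)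
  {U : Set ℂ} {ℓ y : ℂ → ℂ} (hU : IsOpen U) (hc : IsPreconnected U)
  (hUρ : U ⊆ Metric.ball 0 H.ρ) (hℓ : IsLogBranch 0 U ℓ) (hy : SolvesODE H.P H.Q U y)

include h₁ hₐ hU hc hUρ hℓ hy

/-- Term-by-term integration of an expansion at a centre `c ≠ 0`. -/
theorem expansion_of_center {c μ : ℂ} {p : ℂ → ℂ} {pre : ℂ → ℂ → ℂ} (hpre : ∀ l z, pre l z = p z)
    (hc0 : c ≠ 0) (hp : ∀ z ∈ Metric.ball 0 H.ρ, HasDerivAt p (μ / (z - c) * p z) z)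
    (hp0 : ∀ z ∈ Metric.ball 0 H.ρ, z ≠ c → p z ≠ 0) {Y : ℕ → ℂ → ℂ → ℂ}
    (hY : ∀ ν, IntegratesTo H.ρ (1 - H.γ).re (H.integrand L₁ Lₐ pre c ν) (Y ν)) {coef : ℕ → ℂ}
    (hexp : HasExpansion U ℓ (fun z => H.localWeight L₁ Lₐ (ℓ z) z * deriv y z) pre c coef) :
    IsIndefiniteIntegral U ℓ (H.integrand L₁ Lₐ pre c) Y ∧
    (H.γ.re < 1 → ∀ ν : ℕ, ∀ z ∈ U,
      HasSegmentIntegral (H.integrand L₁ Lₐ pre c ν) (ℓ z) z (Y ν (ℓ z) z)) ∧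
    IsNormalisedTermwiseExpansion U ℓ y coef Y ∧
    (H.γ.re < 1 → 1 = c ∨ ‖c‖ < ‖c - 1‖ → H.a = c ∨ ‖c‖ < ‖c - H.a‖ →
      Metric.ball c ‖c‖ ∩ Metric.ball 0 H.ρ ⊆ U → IsTermwiseExpansion U ℓ y coef Y) := by
  have hI : IsIndefiniteIntegral U ℓ (H.integrand L₁ Lₐ pre c) Y := fun ν z hz =>
    (hY ν).1 U ℓ hU hUρ hℓ z hz
  have hseg : H.γ.re < 1 → ∀ ν : ℕ, ∀ z ∈ U,
      HasSegmentIntegral (H.integrand L₁ Lₐ pre c ν) (ℓ z) z (Y ν (ℓ z) z) := fun hγ ν z hz =>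
    (hY ν).2 (by simpa using hγ) _ _ (by simpa using hℓ.2 z hz) (by simpa using hUρ hz)
  have hN : IsNormalisedTermwiseExpansion U ℓ y coef Y :=
    H.isNormalisedTermwiseExpansion h₁ hₐ hU hc hUρ hℓ hy
      (fun z hz => by
        simp only [hpre]
        exact (hp z (hUρ hz)).continuousAt.continuousWithinAt)
      (fun z hz hzc => by rw [hpre]; exact hp0 z (hUρ hz) hzc) hexp hI
  exact ⟨hI, hseg, hN, fun hγ hc1 hca hUc => H.isTermwiseExpansion_of_center h₁ hₐ hU hUρ hℓ hy
    hpre hc0 hp hp0 hγ hc1 hca hUc hexp (hseg hγ) hN⟩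

end HeunParams

theorem mainTheorem8 (H : HeunParams) :
    -- the equation satisfied by `v`, for any holomorphic branches of the powers
    (∀ (U : Set ℂ) (ℓ₀ ℓ₁ ℓₐ y : ℂ → ℂ), IsOpen U →
      IsLogBranch 0 U ℓ₀ → IsLogBranch 1 U ℓ₁ → IsLogBranch H.a U ℓₐ →
      SolvesODE H.P H.Q U y →
      DifferentiableOn ℂ (fun z => H.weight (ℓ₀ z) (ℓ₁ z) (ℓₐ z) * deriv y z) U ∧
      SolvesODE H.derivP H.Q (U \ {z | H.α * H.β * z = H.q})
        (fun z => H.weight (ℓ₀ z) (ℓ₁ z) (ℓₐ z) * deriv y z)) ∧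
    -- this equation is Fuchsian, with five singular points
    (H.α * H.β ≠ 0 → H.q ≠ 0 → H.q ≠ H.α * H.β → H.q ≠ H.a * (H.α * H.β) →
      (∀ c : ℂ, c ≠ 0 → c ≠ 1 → c ≠ H.a → c ≠ H.z₀ → IsOrdinaryPoint H.derivP H.Q c) ∧
      IsRegularSingularPoint H.derivP H.Q 0 0 H.γ ∧
      IsRegularSingularPoint H.derivP H.Q 1 0 H.δ ∧
      IsRegularSingularPoint H.derivP H.Q H.a 0 H.ε ∧
      IsRegularSingularPoint H.derivP H.Q H.z₀ 0 2 ∧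
      IsRegularSingularAtInfinity H.derivP H.Q (-H.α) (-H.β)) ∧
    -- in the four exceptional cases it is again a Heun equation
    (H.α * H.β = 0 ∨ H.q = 0 ∨ H.q = H.α * H.β ∨ H.q = H.a * (H.α * H.β) →
      ∃ H' : HeunParams, H'.a = H.a ∧
        ∀ z : ℂ, z ≠ 0 → z ≠ 1 → z ≠ H.a → H.α * H.β * z ≠ H.q →
          H.derivP z = H'.P z ∧ H.Q z = H'.Q z) ∧
    -- the expansions
    (∀ (L₁ Lₐ : ℂ), Complex.exp L₁ = -1 → Complex.exp Lₐ = -H.a →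
      ∀ (U : Set ℂ) (ℓ y : ℂ → ℂ), IsOpen U → IsPreconnected U →
      U ⊆ Metric.ball 0 H.ρ → IsLogBranch 0 U ℓ → SolvesODE H.P H.Q U y →
      -- around `0`
      ((∀ (σ μ : ℂ) (g : ℂ → ℂ) (r : ℝ), (σ = 0 ∧ μ = H.γ) ∨ (σ = 1 - H.γ ∧ μ = 0) →
          r ≤ H.ρ → U ⊆ Metric.ball 0 r → DifferentiableOn ℂ g (Metric.ball 0 r) →
          (∀ z ∈ U, y z = H.pre0 σ (ℓ z) z * g z) →
          ∃ coef, HasExpansion U ℓ (fun z => H.localWeight L₁ Lₐ (ℓ z) z * deriv y z)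
            (H.pre0 μ) 0 coef) ∧
        (∀ (μ : ℂ) (coef : ℕ → ℂ), μ = 0 ∨ μ = H.γ → (∀ ν : ℕ, 1 - H.γ + μ + ν ≠ 0) →
          HasExpansion U ℓ (fun z => H.localWeight L₁ Lₐ (ℓ z) z * deriv y z)
            (H.pre0 μ) 0 coef →
          IsIndefiniteIntegral U ℓ (H.integrand L₁ Lₐ (H.pre0 μ) 0) (H.term0 L₁ Lₐ μ) ∧
          (∀ ν : ℕ, 0 < (1 - H.γ + μ + ν).re → ∀ z ∈ U,
            HasSegmentIntegral (H.integrand L₁ Lₐ (H.pre0 μ) 0 ν) (ℓ z) z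
              (H.term0 L₁ Lₐ μ ν (ℓ z) z)) ∧
          IsTermwiseExpansion U ℓ y coef (H.term0 L₁ Lₐ μ))) ∧
      -- around `1`
      ((∀ (σ μ : ℂ) (g : ℂ → ℂ) (r : ℝ), (σ = 0 ∧ μ = H.δ) ∨ (σ = 1 - H.δ ∧ μ = 0) →
          r ≤ min 1 ‖1 - H.a‖ → U ⊆ Metric.ball 1 r → DifferentiableOn ℂ g (Metric.ball 1 r) →
          (∀ z ∈ U, y z = H.pre1 L₁ σ (ℓ z) z * g z) →
          ∃ coef, HasExpansion U ℓ (fun z => H.localWeight L₁ Lₐ (ℓ z) z * deriv y z)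
            (H.pre1 L₁ μ) 1 coef) ∧
        (∀ (μ : ℂ) (coef : ℕ → ℂ), μ = 0 ∨ μ = H.δ → (∀ n : ℕ, H.γ ≠ n + 1) →
          HasExpansion U ℓ (fun z => H.localWeight L₁ Lₐ (ℓ z) z * deriv y z)
            (H.pre1 L₁ μ) 1 coef →
          IsIndefiniteIntegral U ℓ (H.integrand L₁ Lₐ (H.pre1 L₁ μ) 1) (H.term1 L₁ Lₐ μ) ∧
          (H.γ.re < 1 → ∀ ν : ℕ, ∀ z ∈ U,
            HasSegmentIntegral (H.integrand L₁ Lₐ (H.pre1 L₁ μ) 1 ν) (ℓ z) z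
              (H.term1 L₁ Lₐ μ ν (ℓ z) z)) ∧
          IsNormalisedTermwiseExpansion U ℓ y coef (H.term1 L₁ Lₐ μ) ∧
          (H.γ.re < 1 → 1 < ‖1 - H.a‖ → Metric.ball 1 1 ∩ Metric.ball 0 H.ρ ⊆ U →
            IsTermwiseExpansion U ℓ y coef (H.term1 L₁ Lₐ μ)))) ∧
      -- around `a`
      ((∀ (σ μ : ℂ) (g : ℂ → ℂ) (r : ℝ), (σ = 0 ∧ μ = H.ε) ∨ (σ = 1 - H.ε ∧ μ = 0) →
          r ≤ min ‖H.a‖ ‖H.a - 1‖ → U ⊆ Metric.ball H.a r →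
          DifferentiableOn ℂ g (Metric.ball H.a r) →
          (∀ z ∈ U, y z = H.preA Lₐ σ (ℓ z) z * g z) →
          ∃ coef, HasExpansion U ℓ (fun z => H.localWeight L₁ Lₐ (ℓ z) z * deriv y z)
            (H.preA Lₐ μ) H.a coef) ∧
        (∀ (μ : ℂ) (coef : ℕ → ℂ), μ = 0 ∨ μ = H.ε → (∀ n : ℕ, H.γ ≠ n + 1) →
          HasExpansion U ℓ (fun z => H.localWeight L₁ Lₐ (ℓ z) z * deriv y z)
            (H.preA Lₐ μ) H.a coef →
          IsIndefiniteIntegral U ℓ (H.integrand L₁ Lₐ (H.preA Lₐ μ) H.a) (H.termA L₁ Lₐ μ) ∧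
          (H.γ.re < 1 → ∀ ν : ℕ, ∀ z ∈ U,
            HasSegmentIntegral (H.integrand L₁ Lₐ (H.preA Lₐ μ) H.a ν) (ℓ z) z
              (H.termA L₁ Lₐ μ ν (ℓ z) z)) ∧
          IsNormalisedTermwiseExpansion U ℓ y coef (H.termA L₁ Lₐ μ) ∧
          (H.γ.re < 1 → ‖H.a‖ < ‖H.a - 1‖ →
            Metric.ball H.a ‖H.a‖ ∩ Metric.ball 0 H.ρ ⊆ U →
            IsTermwiseExpansion U ℓ y coef (H.termA L₁ Lₐ μ)))) ∧
      -- around `q / (α β)`, exponent `2`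
      (H.α * H.β ≠ 0 → H.q ≠ 0 →
        (∀ r : ℝ, r ≤ min ‖H.z₀‖ (min ‖H.z₀ - 1‖ ‖H.z₀ - H.a‖) → U ⊆ Metric.ball H.z₀ r →
          SolvesODE H.P H.Q (Metric.ball H.z₀ r) y → deriv y H.z₀ = 0 →
          ∃ coef, HasExpansion U ℓ (fun z => H.localWeight L₁ Lₐ (ℓ z) z * deriv y z)
            H.preZ H.z₀ coef) ∧
        (∀ coef : ℕ → ℂ, (∀ n : ℕ, H.γ ≠ n + 1) →
          HasExpansion U ℓ (fun z => H.localWeight L₁ Lₐ (ℓ z) z * deriv y z)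
            H.preZ H.z₀ coef →
          IsIndefiniteIntegral U ℓ (H.integrand L₁ Lₐ H.preZ H.z₀) (H.termZ L₁ Lₐ) ∧
          (H.γ.re < 1 → ∀ ν : ℕ, ∀ z ∈ U,
            HasSegmentIntegral (H.integrand L₁ Lₐ H.preZ H.z₀ ν) (ℓ z) z
              (H.termZ L₁ Lₐ ν (ℓ z) z)) ∧
          IsNormalisedTermwiseExpansion U ℓ y coef (H.termZ L₁ Lₐ) ∧
          (H.γ.re < 1 → ‖H.z₀‖ < ‖H.z₀ - 1‖ → ‖H.z₀‖ < ‖H.z₀ - H.a‖ →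
            Metric.ball H.z₀ ‖H.z₀‖ ∩ Metric.ball 0 H.ρ ⊆ U →
            IsTermwiseExpansion U ℓ y coef (H.termZ L₁ Lₐ)) ∧
          -- for `ε = 0` the Lauricella functions reduce to Appell functions
          (H.ε = 0 → ∀ ν : ℕ, ∀ z ∈ U,
            H.termZ L₁ Lₐ ν (ℓ z) z =
              Complex.exp (-H.δ * L₁) * (-H.z₀) ^ (2 + ν) *
                (Complex.exp ((1 - H.γ) * ℓ z) / (1 - H.γ)) *
                appellF1 (1 - H.γ) H.δ (-2 - ν) (2 - H.γ) z (z / H.z₀))))) := by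
  refine ⟨fun U ℓ₀ ℓ₁ ℓₐ y hU h₀ h₁ hₐ hy => H.solvesODE_weight_mul_deriv hU h₀ h₁ hₐ hy,
    fun hαβ hq₀ hq₁ hqₐ => ⟨fun c c0 c1 ca cz => H.isOrdinaryPoint hαβ c0 c1 ca cz,
      H.isRegularSingularPoint_zero hαβ hq₀, H.isRegularSingularPoint_one hαβ hq₁,
      H.isRegularSingularPoint_a hαβ hqₐ, H.isRegularSingularPoint_z₀ hαβ hq₀ hq₁ hqₐ,
      H.isRegularSingularAtInfinity hαβ⟩, H.exists_heun_of_exceptional, ?_⟩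
  intro L₁ Lₐ h₁ hₐ U ℓ y hU hc hUρ hℓ hy
  refine ⟨⟨fun σ μ g r hσ hr hUr hg hyg =>
      H.exists_expansion_zero h₁ hₐ hU hc hUρ hℓ hσ hr hUr hg hyg, fun μ coef _ hs hexp => ?_⟩,
    ⟨fun σ μ g r hσ hr hUr hg hyg =>
      H.exists_expansion_one h₁ hₐ hU hc hUρ hℓ hσ hr hUr hg hyg, fun μ coef _ hγ hexp => ?_⟩,
    ⟨fun σ μ g r hσ hr hUr hg hyg =>
      H.exists_expansion_a h₁ hₐ hU hc hUρ hℓ hσ hr hUr hg hyg, fun μ coef _ hγ hexp => ?_⟩,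
    fun hαβ hq => ⟨fun r hr hUr hy' hy0 =>
      H.exists_expansion_z₀ h₁ hₐ hU hc hUρ hℓ hαβ hr hUr hy' hy0, fun coef hγ hexp => ?_⟩⟩
  · exact ⟨fun ν z hz => (H.integratesTo_zero μ ν hs).1 U ℓ hU hUρ hℓ z hz,
      fun ν hν z hz => (H.integratesTo_zero μ ν hs).2 hν _ _ (by simpa using hℓ.2 z hz)
        (by simpa using hUρ hz),
      H.isTermwiseExpansion_zero h₁ hₐ hU hc hUρ hℓ hy hs hexp⟩
  · obtain ⟨hI, hseg, hN, hT⟩ := H.expansion_of_center h₁ hₐ hU hc hUρ hℓ hy (c := 1) (μ := μ)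
      (p := fun z => Complex.exp (μ * H.log₁ L₁ z)) (fun _ _ => rfl) one_ne_zero
      (fun z hz => (((H.isLogBranch_log₁ h₁).hasDerivAt Metric.isOpen_ball hz).const_mul
        μ).cexp.congr_deriv (by ring))
      (fun _ _ _ => Complex.exp_ne_zero _) (H.integratesTo_one hγ h₁ μ) hexp
    refine ⟨hI, hseg, hN, fun hγ' ha hUc => hT hγ' (Or.inl rfl) (Or.inr ?_) ?_⟩
    · rwa [norm_one]
    · rwa [norm_one]
  · obtain ⟨hI, hseg, hN, hT⟩ := H.expansion_of_center h₁ hₐ hU hc hUρ hℓ hy (c := H.a) (μ := μ)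
      (p := fun z => Complex.exp (μ * H.logₐ Lₐ z)) (fun _ _ => rfl) H.a_ne_zero
      (fun z hz => (((H.isLogBranch_logₐ hₐ).hasDerivAt Metric.isOpen_ball hz).const_mul
        μ).cexp.congr_deriv (by ring))
      (fun _ _ _ => Complex.exp_ne_zero _) (H.integratesTo_a hγ hₐ μ) hexp
    exact ⟨hI, hseg, hN, fun hγ' ha hUc => hT hγ' (Or.inr ha) (Or.inl rfl) hUc⟩
  · have hz₀ : H.z₀ ≠ 0 := div_ne_zero hq hαβ
    obtain ⟨hI, hseg, hN, hT⟩ := H.expansion_of_center h₁ hₐ hU hc hUρ hℓ hy (c := H.z₀) (μ := 2)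
      (p := fun z => (z - H.z₀) ^ 2) (fun _ _ => rfl) hz₀
      (fun z _ => by
        have h : HasDerivAt (fun z => (z - H.z₀) ^ 2) (2 * (z - H.z₀)) z :=
          (((hasDerivAt_id z).sub_const H.z₀).fun_pow 2).congr_deriv (by simp)
        refine h.congr_deriv ?_
        -- At z₀ the quotient 2/(z-z₀) is 0 by convention, which agrees with the vanishing
        -- derivative of the square.
        by_cases hz : z - H.z₀ = 0
        · simp [hz]
        · field_simp)
      (fun z _ hz => pow_ne_zero 2 (sub_ne_zero.2 hz)) (H.integratesTo_z₀ hγ hz₀) hexp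
    exact ⟨hI, hseg, hN, fun hγ' h1 ha hUc => hT hγ' (Or.inr h1) (Or.inr ha) hUc,
      fun hε ν z _ => H.termZ_eq_of_ε_eq_zero hγ hε ν (ℓ z) z⟩
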